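/- Let $V:\mathbb R\to\mathbb R$ be an even, smooth potential such that $\langle x\rangle^nV^{(k)}(x)$ is bounded for all $n,k\ge 0$, where $\langle x\rangle=\sqrt{1+x^2}$. Suppose that the discrete spectrum of $-\partial_x^2+V$ on $L^2(\mathbb R)$ is $\{-\omega_0,-\omega_1\}$ with $\omega_0>\omega_1>0$, and that $0$ is not a resonance (a bounded solution of $u''=Vu$ vanishes). Let $\psi_j$ be a real-valued generator of $\ker(-\partial_x^2+V+\omega_j)$ with $\|\psi_j\|_{L^2}=1$, write $\langle f,g\rangle=\int_{\mathbb R}fg\,dx$, $$A=\langle\psi_0^6,1\rangle,\quad B=\langle\psi_0^4,\psi_1^2\rangle,\quad D=\langle\psi_0^2,\psi_1^4\rangle,$$ and suppose that for a fixed $a_0>0$ $$5B-A>a_0,\qquad 5B^2-AD>a_0. \tag{H4}$$ Let $P_cf=f-\langle\psi_0,f\rangle\psi_0-\langle\psi_1,f\rangle\psi_1$. For all $a_0,K,\kappa>0$ there are $\varepsilon,r,\delta,C>0$, depending only on $a_0,K,\kappa$, such that the following holds for every such $V$ with $\sup|V|\le K$, $\omega_1\ge\kappa$ and $\omega_0-\omega_1<\delta$.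 (0) For $|\rho_0|,|\rho_1|,|\omega-\omega_0|<\varepsilon$ there is exactly one real $\eta=\eta(\rho_0,\rho_1,\omega)\in H^2(\mathbb R)$ with $\|\eta\|_{H^1}<r$, $\langle\eta,\psi_0\rangle=\langle\eta,\psi_1\rangle=0$ and $$(-\partial_x^2+V+\omega)\eta=P_c(\rho_0\psi_0+\rho_1\psi_1+\eta)^5 .$$ Define the Lyapunov–Schmidt reduced system by $$F(\rho_0,\rho_1,\omega)=(\omega-\omega_0)\rho_0-\langle\psi_0,(\rho_0\psi_0+\rho_1\psi_1+\eta)^5\rangle,\qquad G(\rho_0,\rho_1,\omega)=\omega-\omega_1-\tfrac1{\rho_1}\langle\psi_1,(\rho_0\psi_0+\rho_1\psi_1+\eta)^5\rangle,$$ where at $\rho_1=0$ the last quotient is replaced by the derivative $\partial_{\rho_1}|_{\rho_1=0}$ of the pairing. There is exactly one $(\rho_0^*,\omega^*)$ with $0<\rho_0^*<\varepsilon$, $|\omega^*-\omega_0|<\varepsilon$ and $F(\rho_0^*,0,\omega^*)=G(\rho_0^*,0,\omega^*)=0$. (1) $F$ and $G$ are smooth at $(\rho_0^*,0,\omega^*)$,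 and the Jacobian matrix $\frac{\partial(F,G)}{\partial(\rho_0,\omega)}$ has rank $2$ there. (2) There are $\tau>0$ and smooth functions $\rho_0(\cdot),\omega(\cdot)$ on $(-\tau,\tau)$ with $\rho_0(0)=\rho_0^*$, $\omega(0)=\omega^*$, with values in the above range of parameters, such that for $|\rho_1|<\tau$ $$F(\rho_0(\rho_1),\rho_1,\omega(\rho_1))=G(\rho_0(\rho_1),\rho_1,\omega(\rho_1))=0 .$$ The function $\phi=\rho_0(\rho_1)\psi_0+\rho_1\psi_1+\eta(\rho_0(\rho_1),\rho_1,\omega(\rho_1))\in H^2(\mathbb R)$ solves $-\phi''+V\phi+\omega(\rho_1)\phi=\phi^5$, and it is neither even nor odd when $\rho_1\neq0$. (3) $\rho_0'(0)=\omega'(0)=0$, and as $\rho_1\to0$ $$\rho_0(\rho_1)=\rho_0^*+\tfrac{\rho_0''(0)}2\rho_1^2+o(\rho_1^2),\qquad \omega(\rho_1)=\omega^*+\tfrac{\omega''(0)}2\rho_1^2+o(\rho_1^2).$$ (4) $\omega''(0)>0$, and $$\Bigl|\omega''(0)-20(\rho_0^*)^2\,\frac{5B^2-AD}{5B-A}\Bigr|\le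 C(\rho_0^*)^6,\qquad \Bigl|\rho_0''(0)-\frac5{\rho_0^*}\,\frac{B-D}{5B-A}\Bigr|\le C(\rho_0^*)^3 .$$ -/

import Mathlib

open MeasureTheory Topology Asymptotics

noncomputable section

namespace QuinticNLS

/-! ### The Schrodinger operator on `L²(ℝ, ℂ)` and its discrete spectrum -/

/-- `u` lies in the domain `H²(ℝ)` of the operator `-∂ₓ² + V` on `L²(ℝ, ℂ)` and `w` is its
image.  The equation `-u'' + V u = w` is read in the sense of distributions; for bounded `V`
and `u, w ∈ L²` it forces `u ∈ H²`. -/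
def SchrodingerGraph (V : ℝ → ℝ) (u w : Lp ℂ 2 (volume : Measure ℝ)) : Prop :=
  ∀ φ : ℝ → ℝ, ContDiff ℝ (⊤ : ℕ∞) φ → HasCompactSupport φ →
    ∫ x, u x * ((-iteratedDeriv 2 φ x + V x * φ x : ℝ) : ℂ) = ∫ x, w x * (φ x : ℂ)

/-- The resolvent set of `-∂ₓ² + V`: those `z` for which `-∂ₓ² + V - z` is a bijection from the
domain onto `L²` (the inverse is then bounded, by the closed graph theorem). -/
def resolventSet (V : ℝ → ℝ) : Set ℂ :=
  {z | ∀ f : Lp ℂ 2 (volume : Measure ℝ), ∃! u : Lp ℂ 2 (volume : Measure ℝ),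
    SchrodingerGraph V u (f + z • u)}

/-- The discrete spectrum of `-∂ₓ² + V`: the isolated points of its spectrum that are
eigenvalues of finite multiplicity. -/
def discreteSpectrum (V : ℝ → ℝ) : Set ℂ :=
  {z | (∃ u : Lp ℂ 2 (volume : Measure ℝ), u ≠ 0 ∧ SchrodingerGraph V u (z • u)) ∧
    (∃ S : Submodule ℂ (Lp ℂ 2 (volume : Measure ℝ)), FiniteDimensional ℂ S ∧
      ∀ u, SchrodingerGraph V u (z • u) → u ∈ S) ∧
    (∃ d : ℝ, 0 < d ∧ ∀ w : ℂ, w ≠ z → dist w z < d → w ∈ resolventSet V)}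

/-! ### Hypotheses on the potential -/

/-- The discrete spectrum of `-∂ₓ² + V` is `{-ω₀, -ω₁}` with `-ω₀ < -ω₁`, and `0` is not a
resonance: a bounded solution of `u'' = V u` vanishes. -/
structure TwoBoundStates (V : ℝ → ℝ) (ω₀ ω₁ : ℝ) : Prop where
  lt : ω₁ < ω₀
  spec : discreteSpectrum V = {((-ω₀ : ℝ) : ℂ), ((-ω₁ : ℝ) : ℂ)}
  no_resonance : ∀ u : ℝ → ℝ, ContDiff ℝ 2 u → (∃ M : ℝ, ∀ x, |u x| ≤ M) →
    (∀ x, iteratedDeriv 2 u x = V x * u x) → u = 0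

/-- `V` is smooth and `⟨x⟩ⁿ V⁽ᵏ⁾` is bounded for all `n` and `k`, where `⟨x⟩ = √(1 + x²)`. -/
def SmoothDecaying (V : ℝ → ℝ) : Prop :=
  ContDiff ℝ (⊤ : ℕ∞) V ∧
    ∀ n k : ℕ, ∃ M : ℝ, ∀ x, Real.sqrt (1 + x ^ 2) ^ n * |iteratedDeriv k V x| ≤ M

/-- `ψ` is a real valued generator of `ker (-∂ₓ² + V + ω)` with `‖ψ‖_{L²} = 1`
(the continuous representative, which is a classical solution). -/
structure NormalizedGenerator (V : ℝ → ℝ) (ω : ℝ) (ψ : ℝ → ℝ) : Prop where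
  contDiff : ContDiff ℝ 2 ψ
  memLp : MemLp ψ 2 volume
  eqn : ∀ x, -iteratedDeriv 2 ψ x + V x * ψ x + ω * ψ x = 0
  norm_one : ∫ x, ψ x ^ 2 = 1
  generates : ∀ u : Lp ℂ 2 (volume : Measure ℝ),
    SchrodingerGraph V u (((-ω : ℝ) : ℂ) • u) → ∃ c : ℂ, ∀ᵐ x, u x = c * (ψ x : ℂ)

/-- The interaction coefficient `⟨ψ₀ⁱ, ψ₁ʲ⟩ = ∫ ψ₀ⁱ ψ₁ʲ dx`. -/
def coef (ψ₀ ψ₁ : ℝ → ℝ) (i j : ℕ) : ℝ := ∫ x, ψ₀ x ^ i * ψ₁ x ^ j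

/-- Both interaction quantities exceed `a₀`. -/
def InteractionBounds (a₀ : ℝ) (ψ₀ ψ₁ : ℝ → ℝ) : Prop :=
  a₀ < 5 * coef ψ₀ ψ₁ 4 2 - coef ψ₀ ψ₁ 6 0 ∧
    a₀ < 5 * coef ψ₀ ψ₁ 4 2 ^ 2 - coef ψ₀ ψ₁ 6 0 * coef ψ₀ ψ₁ 2 4

/-! ### The Lyapunov-Schmidt reduction -/

/-- A twice continuously differentiable function belonging to the Sobolev space `H²(ℝ)`. -/
structure IsH2 (u : ℝ → ℝ) : Prop where
  contDiff : ContDiff ℝ 2 u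
  memLp : MemLp u 2 volume
  memLp_deriv : MemLp (deriv u) 2 volume
  memLp_deriv2 : MemLp (iteratedDeriv 2 u) 2 volume

/-- The projection `P_c` onto the continuous spectral component, that is, onto the orthogonal
complement of the eigenfunctions `ψ₀` and `ψ₁`. -/
def contProj (ψ₀ ψ₁ f : ℝ → ℝ) : ℝ → ℝ := fun x =>
  f x - (∫ y, ψ₀ y * f y) * ψ₀ x - (∫ y, ψ₁ y * f y) * ψ₁ x

/-- The profile `ρ₀ ψ₀ + ρ₁ ψ₁ + ξ`. -/
def profile (ψ₀ ψ₁ : ℝ → ℝ) (ρ₀ ρ₁ : ℝ) (ξ : ℝ → ℝ) : ℝ → ℝ := fun x =>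
  ρ₀ * ψ₀ x + ρ₁ * ψ₁ x + ξ x

/-- `ξ ∈ H²` is orthogonal to `ψ₀` and `ψ₁`, has `H¹` norm less than `r`, and solves
`(-∂ₓ² + V + ω) ξ = P_c (ρ₀ ψ₀ + ρ₁ ψ₁ + ξ)⁵`.  The right-hand side is continuous, so an `H²`
solution is automatically of class `C²`. -/
structure SolvesContEq (V ψ₀ ψ₁ : ℝ → ℝ) (r ρ₀ ρ₁ ω : ℝ) (ξ : ℝ → ℝ) : Prop where
  isH2 : IsH2 ξ
  orth₀ : ∫ x, ψ₀ x * ξ x = 0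
  orth₁ : ∫ x, ψ₁ x * ξ x = 0
  small : (∫ x, ξ x ^ 2) + (∫ x, deriv ξ x ^ 2) < r ^ 2
  eqn : ∀ x, -iteratedDeriv 2 ξ x + V x * ξ x + ω * ξ x =
    contProj ψ₀ ψ₁ (fun y => profile ψ₀ ψ₁ ρ₀ ρ₁ ξ y ^ 5) x

/-- The parameters lie in the box `|ρ₀| < ε`, `|ρ₁| < ε`, `|ω - ω₀| < ε`. -/
def InBox (ε ω₀ ρ₀ ρ₁ ω : ℝ) : Prop := |ρ₀| < ε ∧ |ρ₁| < ε ∧ |ω - ω₀| < ε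

/-- For all parameters in the box, `η(ρ₀, ρ₁, ω)` is the unique solution, of `H¹` norm less than
`r`, of the continuous-spectrum equation of the Lyapunov-Schmidt system. -/
def IsReductionMap (V ψ₀ ψ₁ : ℝ → ℝ) (ω₀ ε r : ℝ) (η : ℝ → ℝ → ℝ → ℝ → ℝ) : Prop :=
  ∀ ρ₀ ρ₁ ω : ℝ, InBox ε ω₀ ρ₀ ρ₁ ω →
    SolvesContEq V ψ₀ ψ₁ r ρ₀ ρ₁ ω (η ρ₀ ρ₁ ω) ∧
    ∀ ξ : ℝ → ℝ, SolvesContEq V ψ₀ ψ₁ r ρ₀ ρ₁ ω ξ → ξ = η ρ₀ ρ₁ ω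

/-- `⟨ψ, (ρ₀ ψ₀ + ρ₁ ψ₁ + η(ρ₀, ρ₁, ω))⁵⟩`. -/
def quinticPairing (ψ ψ₀ ψ₁ : ℝ → ℝ) (η : ℝ → ℝ → ℝ → ℝ → ℝ) (ρ₀ ρ₁ ω : ℝ) : ℝ :=
  ∫ x, ψ x * profile ψ₀ ψ₁ ρ₀ ρ₁ (η ρ₀ ρ₁ ω) x ^ 5

/-- The first component `F` of the reduced system. -/
def redF (ψ₀ ψ₁ : ℝ → ℝ) (ω₀ : ℝ) (η : ℝ → ℝ → ℝ → ℝ → ℝ) (ρ₀ ρ₁ ω : ℝ) : ℝ :=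
  -ω₀ * ρ₀ + ω * ρ₀ - quinticPairing ψ₀ ψ₀ ψ₁ η ρ₀ ρ₁ ω

open Classical in
/-- The second component `G` of the reduced system, divided by `ρ₁`.  At `ρ₁ = 0` the quotient
`⟨ψ₁, (⋯)⁵⟩ / ρ₁` is understood as its limiting value `∂_{ρ₁} ⟨ψ₁, (⋯)⁵⟩` at `ρ₁ = 0`. -/
def redG (ψ₀ ψ₁ : ℝ → ℝ) (ω₁ : ℝ) (η : ℝ → ℝ → ℝ → ℝ → ℝ) (ρ₀ ρ₁ ω : ℝ) : ℝ :=
  -ω₁ + ω -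
    (if ρ₁ = 0 then deriv (fun s => quinticPairing ψ₁ ψ₀ ψ₁ η ρ₀ s ω) 0
      else 1 / ρ₁ * quinticPairing ψ₁ ψ₀ ψ₁ η ρ₀ ρ₁ ω)

/-- The Jacobian matrix `∂(F, G) / ∂(ρ₀, ω)` at `(ρ₀, ρ₁, ω)`. -/
def jacobian (F G : ℝ → ℝ → ℝ → ℝ) (ρ₀ ρ₁ ω : ℝ) : Matrix (Fin 2) (Fin 2) ℝ :=
  !![deriv (fun s => F s ρ₁ ω) ρ₀, deriv (fun s => F ρ₀ ρ₁ s) ω;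
     deriv (fun s => G s ρ₁ ω) ρ₀, deriv (fun s => G ρ₀ ρ₁ s) ω]

/-- `(ρ, ω)` is a bifurcation point on the branch `ρ₁ = 0` of even states:
`0 < ρ < ε`, `|ω - ω₀| < ε` and `F(ρ, 0, ω) = G(ρ, 0, ω) = 0`. -/
def IsBifurcationPoint (F G : ℝ → ℝ → ℝ → ℝ) (ω₀ ε ρ ω : ℝ) : Prop :=
  0 < ρ ∧ ρ < ε ∧ |ω - ω₀| < ε ∧ F ρ 0 ω = 0 ∧ G ρ 0 ω = 0

/-- `φ ∈ H²` solves `-φ'' + V φ + ω φ = φ⁵`, so that `e^{iωt} φ` is a standing wave. -/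
def IsBoundState (V : ℝ → ℝ) (ω : ℝ) (φ : ℝ → ℝ) : Prop :=
  IsH2 φ ∧ ∀ x, -iteratedDeriv 2 φ x + V x * φ x + ω * φ x = φ x ^ 5

/-- `R` and `Ω` are defined and smooth on `(-τ, τ)`, start at `(ρs, ωs)`, stay in the box, and
parametrize zeros `(R(s), s, Ω(s))` of `(F, G)`. -/
structure IsBranch (F G : ℝ → ℝ → ℝ → ℝ) (ω₀ ε ρs ωs τ : ℝ) (R Ω : ℝ → ℝ) : Prop where
  smooth_R : ContDiffOn ℝ (⊤ : ℕ∞) R (Set.Ioo (-τ) τ)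
  smooth_Ω : ContDiffOn ℝ (⊤ : ℕ∞) Ω (Set.Ioo (-τ) τ)
  R_zero : R 0 = ρs
  Ω_zero : Ω 0 = ωs
  inBox : ∀ s ∈ Set.Ioo (-τ) τ, InBox ε ω₀ (R s) s (Ω s)
  F_eq : ∀ s ∈ Set.Ioo (-τ) τ, F (R s) s (Ω s) = 0
  G_eq : ∀ s ∈ Set.Ioo (-τ) τ, G (R s) s (Ω s) = 0

end QuinticNLS

end

/-! Let `T = (1 + ∂)⁻¹` and `T* = (1 - ∂)⁻¹`, two explicit contractions of `L²` with `T T* = (1 -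
∂²)⁻¹`. Every `H¹` function is `u = T g` with `‖u‖_{H¹} = ‖g‖_{L²}`, and `(-∂² + V - z) u = f`
becomes `formOp z g = T* f` for the bounded operator `formOp z = 1 - (1 + z) T* T + T* V T`. The
potential term is compact, so the Fredholm alternative holds for `Re z < 0`. A negative value of the
quadratic form off the two eigenfunctions would create a further discrete eigenvalue; hence the form
is nonnegative there (`spectralPair_of_hyp`), and after adding two rank one terms the operator at
`-ω₀` is coercive with a constant depending only on `K` and `κ` (`SpectralPair.coercive`). The same
variational facts make `ψ₀` even and `ψ₁` odd (`parity`).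

For the reduction, `η` is sought as `T (ρ₀ x₁ + ρ₁ x₂)`. The fifth power splits into `ρ₀` and `ρ₁`
times expressions in `ρ₀²` and `ρ₁²` (`quintic_split`), so `(x₁, x₂)` solves a contraction problem
depending analytically on `σ = ρ₁²`, `s = ρ₀²`, `w = ω - ω₀`. Reflection symmetry then gives `F = ρ₀
f(σ, s, w)` and `G = g(σ, s, w)` with `f`, `g` analytic, which removes the singularity at `ρ₁ = 0`.
Up to small remainders, `f = w - (A s² + 10 B s σ + 5 D σ²)` and `g = w + (ω₀ - ω₁) - (5 B s² + 10 D
s σ + E σ²)`.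

At `σ = 0` the two equations amount to `(5B - A) s² ≈ ω₀ - ω₁`, which has one small positive root.
The Jacobian in `(s, w)` is about `2 s (5B - A)`, so the implicit function theorem yields a branch
`s = S(σ)`, `w = W(σ)` with `S'(0) ≈ 5 (B - D) / (5B - A)` and `W'(0) ≈ 10 s (5B² - AD) / (5B - A) >
0`. Since `σ = ρ₁²`, first derivatives in `ρ₁` vanish, and the second ones are `ω'' = 2 W'(0)` and
`ρ₀'' = S'(0) / ρ₀*`. All remainders have constants depending only on `a₀`, `K`, `κ`. -/

noncomputable section

/-! ### The operators `T = (1 + ∂)⁻¹` and `T* = (1 - ∂)⁻¹` on functions. -/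

namespace QuinticNLS
open Set Filter
open scoped ENNReal InnerProductSpace

variable {𝕜 : Type*} [RCLike 𝕜]

/-- The solution operator of `u' + u = g` that decays at `-∞`:
`x ↦ ∫_{y ≤ x} e^{y - x} g(y) dy`. -/
def expAvg (g : ℝ → 𝕜) (x : ℝ) : 𝕜 := ∫ y in Iic x, Real.exp (y - x) • g y

/-- The adjoint of `expAvg`: `x ↦ ∫_{y ≥ x} e^{x - y} g(y) dy`. -/
def expAvgAdj (g : ℝ → 𝕜) (x : ℝ) : 𝕜 := ∫ y in Ici x, Real.exp (x - y) • g y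

/-- Reflection exchanges `1 + ∂` and `1 - ∂`; facts about `expAvgAdj` are transported from `expAvg`
through this identity. -/
theorem expAvgAdj_eq (g : ℝ → 𝕜) (x : ℝ) :
    expAvgAdj g x = expAvg (fun y => g (-y)) (-x) := by
  unfold expAvgAdj expAvg
  have := integral_comp_neg_Iic (-x) (fun y => Real.exp (x - y) • g y)
  rw [neg_neg] at this
  rw [integral_Ici_eq_integral_Ioi, ← this]
  refine integral_congr_ae (ae_of_all _ fun y => ?_)
  simp only
  congr 2; ring

theorem integral_exp_Iic (x : ℝ) : ∫ y in Iic x, Real.exp (y - x) = 1 := by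
  simp_rw [Real.exp_sub]
  rw [integral_div, _root_.integral_exp_Iic x, div_self (Real.exp_ne_zero x)]

theorem integrableOn_exp_sub_Iic (x c : ℝ) : IntegrableOn (fun y => Real.exp (y - c)) (Iic x) := by
  simp_rw [Real.exp_sub]
  exact (integrableOn_exp_Iic x).div_const _

theorem memLp_exp_sub (x c : ℝ) :
    MemLp (fun y => Real.exp (y - c)) 2 (volume.restrict (Iic x)) := by
  rw [memLp_two_iff_integrable_sq (by fun_prop)]
  have : (fun y => Real.exp (y - c) ^ 2) = fun y => Real.exp (2 * y) / Real.exp (2 * c) := by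
    ext y; rw [← Real.exp_sub, ← Real.exp_nat_mul]; congr 1; push_cast; ring
  rw [this]
  exact (integrableOn_exp_mul_Iic (by norm_num) x).div_const _

theorem integrableOn_exp_smul {g : ℝ → 𝕜} (hg : MemLp g 2) (x c : ℝ) :
    IntegrableOn (fun y => Real.exp (y - c) • g y) (Iic x) :=
  memLp_one_iff_integrable.1 ((hg.restrict (Iic x)).smul (memLp_exp_sub x c))

/-- `e^{y-x} dy` is a probability measure on `(-∞, x]`, so this is Jensen's inequality for the
square, in the form of Hölder's inequality. -/
theorem enorm_expAvg_sq_le {g : ℝ → 𝕜} (hg : AEStronglyMeasurable g) (x : ℝ) :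
    ‖expAvg g x‖ₑ ^ 2 ≤ ∫⁻ y in Iic x, ENNReal.ofReal (Real.exp (y - x)) * ‖g y‖ₑ ^ 2 := by
  have h1 : ‖expAvg g x‖ₑ ≤ ∫⁻ y in Iic x, ENNReal.ofReal (Real.exp (y - x)) * ‖g y‖ₑ := by
    refine (enorm_integral_le_lintegral_enorm _).trans (le_of_eq ?_)
    refine lintegral_congr fun y => ?_
    rw [enorm_smul, Real.enorm_eq_ofReal (Real.exp_pos _).le]
  have hone : ∫⁻ y in Iic x, ENNReal.ofReal (Real.exp (y - x)) = 1 := by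
    rw [← ofReal_integral_eq_lintegral_ofReal (integrableOn_exp_sub_Iic x x)
      (ae_of_all _ fun y => (Real.exp_pos _).le), integral_exp_Iic, ENNReal.ofReal_one]
  have key := ENNReal.lintegral_mul_norm_pow_le (μ := volume.restrict (Iic x))
    (f := fun y => ENNReal.ofReal (Real.exp (y - x)))
    (g := fun y => ENNReal.ofReal (Real.exp (y - x)) * ‖g y‖ₑ ^ 2) (p := 1 / 2) (q := 1 / 2)
    (by fun_prop) (by have := hg.restrict (s := Iic x); fun_prop) (by norm_num) (by norm_num)
    (by norm_num)
  rw [hone, ENNReal.one_rpow, one_mul] at key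
  have h2 : ∀ y, ENNReal.ofReal (Real.exp (y - x)) ^ (1 / 2 : ℝ) *
      (ENNReal.ofReal (Real.exp (y - x)) * ‖g y‖ₑ ^ 2) ^ (1 / 2 : ℝ)
      = ENNReal.ofReal (Real.exp (y - x)) * ‖g y‖ₑ := by
    intro y
    rw [ENNReal.mul_rpow_of_nonneg _ _ (by norm_num), ← mul_assoc,
      ← ENNReal.rpow_add_of_nonneg _ _ (by norm_num) (by norm_num), ← ENNReal.rpow_natCast,
      ← ENNReal.rpow_mul]
    norm_num
  simp only [h2] at key
  calc ‖expAvg g x‖ₑ ^ 2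
      ≤ ((∫⁻ y in Iic x, ENNReal.ofReal (Real.exp (y - x)) * ‖g y‖ₑ ^ 2) ^ (1 / 2 : ℝ)) ^ 2 := by
        gcongr; exact h1.trans key
    _ = _ := by
        rw [← ENNReal.rpow_natCast, ← ENNReal.rpow_mul]; norm_num

/-- The weight is at most one, which turns the weighted bound into the Sobolev embedding of `H¹`
into bounded functions. -/
theorem norm_expAvg_le {g : ℝ → 𝕜} (hg : MemLp g 2) (x : ℝ) :
    ‖expAvg g x‖ ≤ (eLpNorm g 2 volume).toReal := by
  have h : ‖expAvg g x‖ₑ ^ 2 ≤ eLpNorm g 2 volume ^ 2 := by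
    refine (enorm_expAvg_sq_le hg.1 x).trans ?_
    have : eLpNorm g 2 volume ^ 2 = ∫⁻ y, ‖g y‖ₑ ^ 2 := by
      have := eLpNorm_nnreal_pow_eq_lintegral (f := g) (μ := volume) (p := 2) (by norm_num)
      simpa using this
    rw [this]
    refine (lintegral_mono_ae ?_).trans (setLIntegral_le_lintegral (Iic x) _)
    filter_upwards [ae_restrict_mem measurableSet_Iic] with y hy
    refine mul_le_of_le_one_left' ?_
    rw [ENNReal.ofReal_le_one, Real.exp_le_one_iff]
    exact sub_nonpos.2 hy
  have h' : ‖expAvg g x‖ₑ ≤ eLpNorm g 2 volume :=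
    (ENNReal.pow_le_pow_left_iff (by norm_num)).1 h
  rw [← toReal_enorm]
  exact ENNReal.toReal_mono hg.2.ne h'

/-- Schur's test: the kernel `e^{y-x}` on `y ≤ x` has mass one in each variable, so the Jensen bound
and Tonelli's theorem give a contraction. -/
theorem eLpNorm_expAvg_le {g : ℝ → 𝕜} (hg : MemLp g 2) :
    eLpNorm (expAvg g) 2 volume ≤ eLpNorm g 2 volume := by
  have e : ∀ f : ℝ → 𝕜, eLpNorm f 2 volume ^ 2 = ∫⁻ y, ‖f y‖ₑ ^ 2 := fun f => by
    have := eLpNorm_nnreal_pow_eq_lintegral (f := f) (μ := volume) (p := 2) (by norm_num)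
    simpa using this
  refine (ENNReal.pow_le_pow_left_iff (n := 2) (by norm_num)).1 ?_
  rw [e, e]
  have hgm : AEMeasurable (fun y => ‖g y‖ₑ ^ 2) := by have := hg.1; fun_prop
  calc ∫⁻ x, ‖expAvg g x‖ₑ ^ 2
      ≤ ∫⁻ x, ∫⁻ y, (Iic x).indicator (fun y => ENNReal.ofReal (Real.exp (y - x)) * ‖g y‖ₑ ^ 2) y := by
        refine lintegral_mono fun x => ?_
        rw [lintegral_indicator measurableSet_Iic]
        exact enorm_expAvg_sq_le hg.1 x
    _ = ∫⁻ x, ∫⁻ y, {p : ℝ × ℝ | p.2 ≤ p.1}.indicator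
          (fun p => ENNReal.ofReal (Real.exp (p.2 - p.1))) (x, y) * ‖g y‖ₑ ^ 2 := by
        refine lintegral_congr fun x => lintegral_congr fun y => ?_
        by_cases h : y ≤ x <;> simp [h]
    _ = ∫⁻ y, ∫⁻ x, {p : ℝ × ℝ | p.2 ≤ p.1}.indicator
          (fun p => ENNReal.ofReal (Real.exp (p.2 - p.1))) (x, y) * ‖g y‖ₑ ^ 2 := by
        refine lintegral_lintegral_swap ?_
        refine AEMeasurable.mul ?_ (hgm.comp_snd)
        refine Measurable.aemeasurable ?_
        exact Measurable.indicator (by fun_prop) (measurableSet_le measurable_snd measurable_fst)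
    _ = ∫⁻ y, ‖g y‖ₑ ^ 2 := by
        refine lintegral_congr fun y => ?_
        rw [lintegral_mul_const']
        · have : ∀ x, {p : ℝ × ℝ | p.2 ≤ p.1}.indicator
              (fun p => ENNReal.ofReal (Real.exp (p.2 - p.1))) (x, y)
              = (Ici y).indicator (fun x => ENNReal.ofReal (Real.exp (y - x))) x := by
            intro x; by_cases h : y ≤ x <;> simp [h]
          rw [lintegral_congr this, lintegral_indicator measurableSet_Ici, ← ofReal_integral_eq_lintegral_ofReal _
            (ae_of_all _ fun y => (Real.exp_pos _).le)]
          · have h1 : ∫ x in Ici y, Real.exp (y - x) = 1 := by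
              have := expAvgAdj_eq (fun _ => (1 : ℝ)) y
              simp only [expAvgAdj, expAvg, smul_eq_mul, mul_one] at this
              rw [this, integral_exp_Iic]
            rw [h1]; simp
          · simp_rw [sub_eq_add_neg y, Real.exp_add]
            exact ((integrableOn_Ici_iff_integrableOn_Ioi).2 (integrableOn_exp_neg_Ioi y)).const_mul _
        · simp

/-- With `e^{-x}` factored out, a primitive remains; continuity and the equation `u' = g - u` are
read off from it. -/
theorem expAvg_eq (g : ℝ → 𝕜) (x : ℝ) :
    expAvg g x = Real.exp (-x) • ∫ y in Iic x, Real.exp y • g y := by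
  unfold expAvg
  rw [← integral_smul]
  refine integral_congr_ae (ae_of_all _ fun y => ?_)
  simp only [smul_smul, ← Real.exp_add]
  congr 2; ring

theorem integrableOn_exp_smul' {g : ℝ → 𝕜} (hg : MemLp g 2) (x : ℝ) :
    IntegrableOn (fun y => Real.exp y • g y) (Iic x) := by
  simpa using integrableOn_exp_smul hg x 0

theorem intervalIntegrable_exp_smul {g : ℝ → 𝕜} (hg : MemLp g 2) (a b : ℝ) :
    IntervalIntegrable (fun y => Real.exp y • g y) volume a b :=
  (intervalIntegrable_iff).2 ((integrableOn_exp_smul' hg (max a b)).mono_set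
    (fun _ hy => (uIoc_subset_uIcc.trans (fun _ h => h.2) : uIoc a b ⊆ Iic (max a b)) hy))

theorem integral_Iic_eq_add {g : ℝ → 𝕜} (hg : MemLp g 2) (x : ℝ) :
    ∫ y in Iic x, Real.exp y • g y
      = (∫ y in Iic 0, Real.exp y • g y) + ∫ y in (0 : ℝ)..x, Real.exp y • g y := by
  rw [← intervalIntegral.integral_Iic_sub_Iic (integrableOn_exp_smul' hg 0)
    (integrableOn_exp_smul' hg x)]
  abel

theorem continuous_expAvg {g : ℝ → 𝕜} (hg : MemLp g 2) : Continuous (expAvg g) := by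
  have h : expAvg g = fun x => Real.exp (-x) • ((∫ y in Iic 0, Real.exp y • g y)
      + ∫ y in (0 : ℝ)..x, Real.exp y • g y) := by
    ext x; rw [expAvg_eq, integral_Iic_eq_add hg]
  rw [h]
  have := intervalIntegral.continuous_primitive (fun a b => intervalIntegrable_exp_smul hg a b) 0
  fun_prop

theorem hasDerivAt_expAvg {g : ℝ → 𝕜} (hg : MemLp g 2) (hc : Continuous g) (x : ℝ) :
    HasDerivAt (expAvg g) (g x - expAvg g x) x := by
  have h : expAvg g = fun x => Real.exp (-x) • ((∫ y in Iic 0, Real.exp y • g y)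
      + ∫ y in (0 : ℝ)..x, Real.exp y • g y) := by
    ext x; rw [expAvg_eq, integral_Iic_eq_add hg]
  have h1 : HasDerivAt (fun x => ∫ y in (0 : ℝ)..x, Real.exp y • g y) (Real.exp x • g x) x := by
    apply intervalIntegral.integral_hasDerivAt_right (intervalIntegrable_exp_smul hg 0 x)
    · exact (by fun_prop : Continuous fun y => Real.exp y • g y).stronglyMeasurableAtFilter _ _
    · fun_prop
  have h2 : HasDerivAt (fun x => Real.exp (-x)) (-Real.exp (-x)) x := by
    simpa using (hasDerivAt_neg x).exp
  rw [h]
  convert! h2.smul (h1.const_add (∫ y in Iic 0, Real.exp y • g y)) using 1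
  simp only [smul_smul, ← Real.exp_add]
  simp; ring

theorem memLp_expAvg {g : ℝ → 𝕜} (hg : MemLp g 2) : MemLp (expAvg g) 2 :=
  ⟨(continuous_expAvg hg).aestronglyMeasurable, (eLpNorm_expAvg_le hg).trans_lt hg.2⟩

theorem memLp_neg_iff {g : ℝ → 𝕜} (hg : MemLp g 2) : MemLp (fun y => g (-y)) 2 :=
  hg.comp_measurePreserving (Measure.measurePreserving_neg volume)

theorem memLp_expAvgAdj {g : ℝ → 𝕜} (hg : MemLp g 2) : MemLp (expAvgAdj g) 2 := by
  have : expAvgAdj g = fun x => expAvg (fun y => g (-y)) (-x) := funext (expAvgAdj_eq g)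
  rw [this]
  exact memLp_neg_iff (memLp_expAvg (memLp_neg_iff hg))

theorem continuous_expAvgAdj {g : ℝ → 𝕜} (hg : MemLp g 2) : Continuous (expAvgAdj g) := by
  have : expAvgAdj g = fun x => expAvg (fun y => g (-y)) (-x) := funext (expAvgAdj_eq g)
  rw [this]
  exact (continuous_expAvg (memLp_neg_iff hg)).comp continuous_neg

theorem hasDerivAt_expAvgAdj {g : ℝ → 𝕜} (hg : MemLp g 2) (hc : Continuous g) (x : ℝ) :
    HasDerivAt (expAvgAdj g) (expAvgAdj g x - g x) x := by
  have e : expAvgAdj g = (expAvg fun y => g (-y)) ∘ Neg.neg := funext (expAvgAdj_eq g)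
  have h := (hasDerivAt_expAvg (memLp_neg_iff hg) (by fun_prop) (-x)).scomp x (hasDerivAt_neg x)
  rw [expAvgAdj_eq, e]
  convert! h using 1
  simp

theorem expAvg_congr {g h : ℝ → 𝕜} (e : g =ᵐ[volume] h) : expAvg g = expAvg h := by
  ext x
  refine integral_congr_ae (ae_restrict_of_ae ?_)
  filter_upwards [e] with y hy
  rw [hy]

theorem expAvgAdj_congr {g h : ℝ → 𝕜} (e : g =ᵐ[volume] h) : expAvgAdj g = expAvgAdj h := by
  ext x
  refine integral_congr_ae (ae_restrict_of_ae ?_)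
  filter_upwards [e] with y hy
  rw [hy]

/-- `expAvg` inverts `u ↦ u + u'`. -/
theorem expAvg_add_deriv {u u' : ℝ → 𝕜} (hd : ∀ x, HasDerivAt u (u' x) x)
    (hu : MemLp u 2) (hu' : MemLp u' 2) : expAvg (fun x => u x + u' x) = u := by
  ext x
  have hder : ∀ y ∈ Iic x, HasDerivAt (fun y => Real.exp (y - x) • u y)
      (Real.exp (y - x) • (u y + u' y)) y := by
    intro y _
    have h2 : HasDerivAt (fun y => Real.exp (y - x)) (Real.exp (y - x)) y := by
      simpa using ((hasDerivAt_id y).sub_const x).exp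
    convert! h2.smul (hd y) using 1
    rw [smul_add]; abel
  have hi1 := integrableOn_exp_smul hu x x
  have hi2 := integrableOn_exp_smul (hu.add hu') x x
  -- The boundary term at `-∞` vanishes because `e^{y-x} u` and its derivative are both integrable
  -- on `(-∞, x]`.
  have := integral_Iic_of_hasDerivAt_of_tendsto' hder hi2
    (tendsto_zero_of_hasDerivAt_of_integrableOn_Iic hder hi2 hi1)
  simpa [expAvg] using this

theorem expAvgAdj_sub_deriv {u u' : ℝ → 𝕜} (hd : ∀ x, HasDerivAt u (u' x) x)
    (hu : MemLp u 2) (hu' : MemLp u' 2) : expAvgAdj (fun x => u x - u' x) = u := by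
  ext x
  rw [expAvgAdj_eq]
  have hd' : ∀ x, HasDerivAt (fun y => u (-y)) (-u' (-x)) x := fun x => by
    have := (hd (-x)).scomp x (hasDerivAt_neg x)
    rw [neg_one_smul] at this
    exact this
  have := congrFun (expAvg_add_deriv hd' (memLp_neg_iff hu) (memLp_neg_iff hu').neg) (-x)
  simpa [sub_eq_add_neg] using this

/-- The Fubini identity behind the adjointness of `expAvg` and `expAvgAdj`. -/
theorem integral_expAvg_mul {g h : ℝ → 𝕜} (hg : MemLp g 2) (hh : MemLp h 2) :
    ∫ x, expAvg g x * h x = ∫ y, g y * expAvgAdj h y := by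
  have hm : AEStronglyMeasurable (fun p : ℝ × ℝ => {p : ℝ × ℝ | p.2 ≤ p.1}.indicator
      (fun p => Real.exp (p.2 - p.1)) p • (g p.2 * h p.1)) (volume.prod volume) := by
    refine AEStronglyMeasurable.smul ?_ ?_
    · exact (Measurable.indicator (by fun_prop)
        (measurableSet_le measurable_snd measurable_fst)).aestronglyMeasurable
    · exact hg.1.comp_snd.mul hh.1.comp_fst
  have hx : ∀ x, ∀ y, {p : ℝ × ℝ | p.2 ≤ p.1}.indicator
      (fun p => Real.exp (p.2 - p.1)) (x, y) • (g y * h x)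
      = (Iic x).indicator (fun y => Real.exp (y - x) • g y) y * h x := by
    intro x y
    by_cases hxy : y ≤ x <;> simp [hxy]
  have hy : ∀ y, ∀ x, {p : ℝ × ℝ | p.2 ≤ p.1}.indicator
      (fun p => Real.exp (p.2 - p.1)) (x, y) • (g y * h x)
      = g y * (Ici y).indicator (fun x => Real.exp (y - x) • h x) x := by
    intro x y
    by_cases hxy : x ≤ y <;> simp [hxy]
  have hint : Integrable (fun p : ℝ × ℝ => {p : ℝ × ℝ | p.2 ≤ p.1}.indicator
      (fun p => Real.exp (p.2 - p.1)) p • (g p.2 * h p.1)) (volume.prod volume) := by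
    rw [integrable_prod_iff hm]
    constructor
    · refine ae_of_all _ fun x => ?_
      simp only [hx]
      exact ((integrable_indicator_iff measurableSet_Iic).2
        (integrableOn_exp_smul hg x x)).mul_const _
    -- Absolute integrability reduces to the product of `T|g|` and `|h|`, both in `L²`.
    · have : ∀ x, ∫ y, ‖{p : ℝ × ℝ | p.2 ≤ p.1}.indicator
          (fun p => Real.exp (p.2 - p.1)) (x, y) • (g y * h x)‖
          = expAvg (fun y => ‖g y‖) x * ‖h x‖ := by
        intro x
        simp only [hx, norm_mul, integral_mul_const]
        congr 1
        unfold expAvg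
        rw [← integral_indicator measurableSet_Iic]
        refine integral_congr_ae (ae_of_all _ fun y => ?_)
        simp only
        by_cases hxy : y ≤ x <;> simp [hxy, norm_smul]
      simp only [this]
      exact (memLp_expAvg hg.norm).integrable_mul hh.norm
  have := integral_integral_swap (f := fun x y => {p : ℝ × ℝ | p.2 ≤ p.1}.indicator
      (fun p => Real.exp (p.2 - p.1)) (x, y) • (g y * h x)) hint
  calc ∫ x, expAvg g x * h x = ∫ x, ∫ y, {p : ℝ × ℝ | p.2 ≤ p.1}.indicator
        (fun p => Real.exp (p.2 - p.1)) (x, y) • (g y * h x) := by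
        refine integral_congr_ae (ae_of_all _ fun x => ?_)
        simp only [hx, integral_mul_const]
        rw [integral_indicator measurableSet_Iic]; rfl
    _ = ∫ y, ∫ x, {p : ℝ × ℝ | p.2 ≤ p.1}.indicator
        (fun p => Real.exp (p.2 - p.1)) (x, y) • (g y * h x) := this
    _ = _ := by
        refine integral_congr_ae (ae_of_all _ fun y => ?_)
        simp only [hy, integral_const_mul]
        rw [integral_indicator measurableSet_Ici]; rfl

theorem expAvgAdj_conj (h : ℝ → 𝕜) (x : ℝ) :
    expAvgAdj (fun y => (starRingEnd 𝕜) (h y)) x = (starRingEnd 𝕜) (expAvgAdj h x) := by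
  unfold expAvgAdj
  rw [← integral_conj]
  refine integral_congr_ae (ae_of_all _ fun y => ?_)
  simp [RCLike.real_smul_eq_coe_mul]

end QuinticNLS

/-! ### `T`, `T*` and multiplication as bounded operators on `L²`; compactness of `V T`. -/

namespace QuinticNLS
open Set Filter
open scoped ENNReal InnerProductSpace BoundedContinuousFunction

variable {𝕜 : Type*} [RCLike 𝕜]

/-- The Hilbert space `L²(ℝ, 𝕜)`. -/
abbrev L2 (𝕜 : Type*) [RCLike 𝕜] := Lp 𝕜 2 (volume : Measure ℝ)

theorem expAvg_add {g h : ℝ → 𝕜} (hg : MemLp g 2) (hh : MemLp h 2) (x : ℝ) :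
    expAvg (g + h) x = expAvg g x + expAvg h x := by
  unfold expAvg
  rw [← integral_add (integrableOn_exp_smul hg x x) (integrableOn_exp_smul hh x x)]
  simp

theorem expAvg_smul (c : 𝕜) (g : ℝ → 𝕜) (x : ℝ) : expAvg (c • g) x = c • expAvg g x := by
  unfold expAvg
  rw [← integral_smul]
  refine integral_congr_ae (ae_of_all _ fun y => ?_)
  simp only [Pi.smul_apply]
  rw [smul_comm]

theorem expAvgAdj_add {g h : ℝ → 𝕜} (hg : MemLp g 2) (hh : MemLp h 2) (x : ℝ) :
    expAvgAdj (g + h) x = expAvgAdj g x + expAvgAdj h x := by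
  simp only [expAvgAdj_eq]
  exact expAvg_add (memLp_neg_iff hg) (memLp_neg_iff hh) _

theorem expAvgAdj_smul (c : 𝕜) (g : ℝ → 𝕜) (x : ℝ) :
    expAvgAdj (c • g) x = c • expAvgAdj g x := by
  simp only [expAvgAdj_eq]
  exact expAvg_smul c _ _

/-- `expAvg` as a map from `L²` to bounded continuous functions. -/
def sobolevEmb (𝕜 : Type*) [RCLike 𝕜] : L2 𝕜 →L[𝕜] (ℝ →ᵇ 𝕜) :=
  LinearMap.mkContinuous
    { toFun := fun g => BoundedContinuousFunction.ofNormedAddCommGroup (expAvg g)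
        (continuous_expAvg (Lp.memLp g)) ‖g‖ (fun x => norm_expAvg_le (Lp.memLp g) x)
      map_add' := fun g h => by
        ext x
        change expAvg (g + h : L2 𝕜) x = expAvg g x + expAvg h x
        rw [expAvg_congr (Lp.coeFn_add g h), expAvg_add (Lp.memLp g) (Lp.memLp h)]
      map_smul' := fun c g => by
        ext x
        change expAvg (c • g : L2 𝕜) x = c • expAvg g x
        rw [expAvg_congr (Lp.coeFn_smul c g), expAvg_smul] } 1
    (fun g => by
      rw [one_mul]
      exact (BoundedContinuousFunction.norm_le (norm_nonneg g)).2
        fun x => norm_expAvg_le (Lp.memLp g) x)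

theorem sobolevEmb_apply (g : L2 𝕜) (x : ℝ) : sobolevEmb 𝕜 g x = expAvg g x := rfl

theorem norm_sobolevEmb_le (g : L2 𝕜) : ‖sobolevEmb 𝕜 g‖ ≤ ‖g‖ :=
  (BoundedContinuousFunction.norm_le (norm_nonneg g)).2 fun x => norm_expAvg_le (Lp.memLp g) x

/-- `expAvg` as an operator on `L²`. -/
def expOp (𝕜 : Type*) [RCLike 𝕜] : L2 𝕜 →L[𝕜] L2 𝕜 :=
  LinearMap.mkContinuous
    { toFun := fun g => (memLp_expAvg (Lp.memLp g)).toLp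
      map_add' := fun g h => by
        rw [← MemLp.toLp_add]
        refine MemLp.toLp_congr _ _ (ae_of_all _ fun x => ?_)
        rw [expAvg_congr (Lp.coeFn_add g h), expAvg_add (Lp.memLp g) (Lp.memLp h)]; rfl
      map_smul' := fun c g => by
        rw [RingHom.id_apply, ← MemLp.toLp_const_smul]
        refine MemLp.toLp_congr _ _ (ae_of_all _ fun x => ?_)
        rw [expAvg_congr (Lp.coeFn_smul c g), expAvg_smul]; rfl } 1
    (fun g => by
      rw [one_mul]
      change ‖(memLp_expAvg (Lp.memLp g)).toLp‖ ≤ _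
      rw [Lp.norm_toLp]
      exact ENNReal.toReal_mono (Lp.memLp g).2.ne (eLpNorm_expAvg_le (Lp.memLp g)))

theorem coeFn_expOp (g : L2 𝕜) : expOp 𝕜 g =ᵐ[volume] expAvg g :=
  MemLp.coeFn_toLp (memLp_expAvg (Lp.memLp g))

theorem norm_expOp_le (g : L2 𝕜) : ‖expOp 𝕜 g‖ ≤ ‖g‖ := by
  have := LinearMap.mkContinuous_norm_le (C := 1) _ zero_le_one _ |> (expOp 𝕜).le_of_opNorm_le (x := g)
  simpa using this

theorem eLpNorm_expAvgAdj_le {g : ℝ → 𝕜} (hg : MemLp g 2) :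
    eLpNorm (expAvgAdj g) 2 volume ≤ eLpNorm g 2 volume := by
  have : expAvgAdj g = (expAvg (fun y => g (-y))) ∘ Neg.neg := funext (expAvgAdj_eq g)
  rw [this, eLpNorm_comp_measurePreserving (memLp_expAvg (memLp_neg_iff hg)).1
    (Measure.measurePreserving_neg volume)]
  refine (eLpNorm_expAvg_le (memLp_neg_iff hg)).trans (le_of_eq ?_)
  exact eLpNorm_comp_measurePreserving hg.1 (Measure.measurePreserving_neg volume)

/-- The adjoint of `expOp`. -/
def expOpAdj (𝕜 : Type*) [RCLike 𝕜] : L2 𝕜 →L[𝕜] L2 𝕜 :=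
  LinearMap.mkContinuous
    { toFun := fun g => (memLp_expAvgAdj (Lp.memLp g)).toLp
      map_add' := fun g h => by
        rw [← MemLp.toLp_add]
        refine MemLp.toLp_congr _ _ (ae_of_all _ fun x => ?_)
        rw [expAvgAdj_congr (Lp.coeFn_add g h), expAvgAdj_add (Lp.memLp g) (Lp.memLp h)]; rfl
      map_smul' := fun c g => by
        rw [RingHom.id_apply, ← MemLp.toLp_const_smul]
        refine MemLp.toLp_congr _ _ (ae_of_all _ fun x => ?_)
        rw [expAvgAdj_congr (Lp.coeFn_smul c g), expAvgAdj_smul]; rfl } 1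
    (fun g => by
      rw [one_mul]
      change ‖(memLp_expAvgAdj (Lp.memLp g)).toLp‖ ≤ _
      rw [Lp.norm_toLp]
      exact ENNReal.toReal_mono (Lp.memLp g).2.ne (eLpNorm_expAvgAdj_le (Lp.memLp g)))

theorem coeFn_expOpAdj (g : L2 𝕜) : expOpAdj 𝕜 g =ᵐ[volume] expAvgAdj g :=
  MemLp.coeFn_toLp (memLp_expAvgAdj (Lp.memLp g))

theorem expOpAdj_toLp {g : ℝ → 𝕜} (hg : MemLp g 2) :
    expOpAdj 𝕜 hg.toLp = (memLp_expAvgAdj hg).toLp :=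
  Lp.ext ((coeFn_expOpAdj _).trans (by
    rw [expAvgAdj_congr hg.coeFn_toLp]; exact (MemLp.coeFn_toLp _).symm))

theorem norm_expOpAdj_le (g : L2 𝕜) : ‖expOpAdj 𝕜 g‖ ≤ ‖g‖ := by
  have := LinearMap.mkContinuous_norm_le (C := 1) _ zero_le_one _ |>
    (expOpAdj 𝕜).le_of_opNorm_le (x := g)
  simpa using this

theorem inner_expOp (g h : L2 𝕜) : ⟪expOp 𝕜 g, h⟫_𝕜 = ⟪g, expOpAdj 𝕜 h⟫_𝕜 := by
  rw [L2.inner_def, L2.inner_def]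
  have h1 : ∫ x, ⟪expOp 𝕜 g x, h x⟫_𝕜 = (starRingEnd 𝕜) (∫ x, expAvg g x * (starRingEnd 𝕜) (h x)) := by
    rw [← integral_conj]
    refine integral_congr_ae ?_
    filter_upwards [coeFn_expOp g] with x hx
    simp [hx, RCLike.inner_apply, mul_comm]
  have h2 : ∫ x, ⟪g x, expOpAdj 𝕜 h x⟫_𝕜
      = (starRingEnd 𝕜) (∫ x, g x * expAvgAdj (fun y => (starRingEnd 𝕜) (h y)) x) := by
    rw [← integral_conj]
    refine integral_congr_ae ?_
    filter_upwards [coeFn_expOpAdj h] with x hx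
    simp [hx, RCLike.inner_apply, expAvgAdj_conj, mul_comm]
  rw [h1, h2, integral_expAvg_mul (Lp.memLp g)]
  exact (Lp.memLp h).star

theorem inner_expOpAdj (g h : L2 𝕜) : ⟪expOpAdj 𝕜 g, h⟫_𝕜 = ⟪g, expOp 𝕜 h⟫_𝕜 := by
  rw [← inner_conj_symm, ← inner_expOp, inner_conj_symm]

theorem memLp_bcf_smul (m : ℝ →ᵇ ℝ) (g : L2 𝕜) : MemLp (fun x => m x • g x) 2 := by
  refine (Lp.memLp g).of_le_mul (c := ‖m‖)
    (m.continuous.aestronglyMeasurable.smul (Lp.memLp g).1) (ae_of_all _ fun x => ?_)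
  rw [norm_smul]
  exact mul_le_mul_of_nonneg_right (m.norm_coe_le_norm x) (norm_nonneg _)

/-- Multiplication by a real bounded continuous function. -/
def mulOp (𝕜 : Type*) [RCLike 𝕜] (m : ℝ →ᵇ ℝ) : L2 𝕜 →L[𝕜] L2 𝕜 :=
  LinearMap.mkContinuous
    { toFun := fun g => (memLp_bcf_smul m g).toLp
      map_add' := fun g h => by
        rw [← MemLp.toLp_add]
        refine MemLp.toLp_congr _ _ ?_
        filter_upwards [Lp.coeFn_add g h] with x hx
        rw [hx, Pi.add_apply, smul_add, Pi.add_apply]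
      map_smul' := fun c g => by
        rw [RingHom.id_apply, ← MemLp.toLp_const_smul]
        refine MemLp.toLp_congr _ _ ?_
        filter_upwards [Lp.coeFn_smul c g] with x hx
        simp only [hx, Pi.smul_apply]
        rw [smul_comm] } ‖m‖
    (fun g => by
      refine Lp.norm_le_mul_norm_of_ae_le_mul ?_
      filter_upwards [MemLp.coeFn_toLp (memLp_bcf_smul m g)] with x hx
      refine (congrArg norm hx).trans_le ?_
      rw [norm_smul]
      exact mul_le_mul_of_nonneg_right (m.norm_coe_le_norm x) (norm_nonneg _))

theorem coeFn_mulOp (m : ℝ →ᵇ ℝ) (g : L2 𝕜) : mulOp 𝕜 m g =ᵐ[volume] fun x => m x • g x :=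
  MemLp.coeFn_toLp (memLp_bcf_smul m g)

theorem norm_mulOp_le (m : ℝ →ᵇ ℝ) : ‖mulOp 𝕜 m‖ ≤ ‖m‖ := by
  refine ContinuousLinearMap.opNorm_le_bound _ (norm_nonneg _) fun g => ?_
  refine Lp.norm_le_mul_norm_of_ae_le_mul ?_
  filter_upwards [coeFn_mulOp m g] with x hx
  rw [hx, norm_smul]
  exact mul_le_mul_of_nonneg_right (m.norm_coe_le_norm x) (norm_nonneg _)

theorem inner_mulOp (m : ℝ →ᵇ ℝ) (g h : L2 𝕜) : ⟪mulOp 𝕜 m g, h⟫_𝕜 = ⟪g, mulOp 𝕜 m h⟫_𝕜 := by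
  rw [L2.inner_def, L2.inner_def]
  refine integral_congr_ae ?_
  filter_upwards [coeFn_mulOp m g, coeFn_mulOp m h] with x h1 h2
  simp only [h1, h2, RCLike.real_smul_eq_coe_mul, RCLike.inner_apply, map_mul, RCLike.conj_ofReal]
  ring

/-- Multiplication by real bounded continuous functions on `L²(ℝ, ℝ)`, as a bilinear map. -/
def mulL : (ℝ →ᵇ ℝ) →L[ℝ] L2 ℝ →L[ℝ] L2 ℝ :=
  LinearMap.mkContinuous
    { toFun := mulOp ℝ
      map_add' := fun m n => by
        ext1 g
        refine Lp.ext ?_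
        rw [add_apply]
        filter_upwards [coeFn_mulOp (m + n) g, coeFn_mulOp m g, coeFn_mulOp n g,
          Lp.coeFn_add (mulOp ℝ m g) (mulOp ℝ n g)] with x h1 h2 h3 h4
        rw [h1, h4, Pi.add_apply, h2, h3]
        simp [add_mul]
      map_smul' := fun c m => by
        ext1 g
        refine Lp.ext ?_
        rw [smul_apply]
        filter_upwards [coeFn_mulOp (c • m) g, coeFn_mulOp m g,
          Lp.coeFn_smul c (mulOp ℝ m g)] with x h1 h2 h4
        simp only [RingHom.id_apply]
        rw [h1, h4, Pi.smul_apply, h2]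
        simp [mul_assoc] } 1
    (fun m => by rw [one_mul]; exact norm_mulOp_le m)

theorem mulL_apply (m : ℝ →ᵇ ℝ) : mulL m = mulOp ℝ m := rfl

/-! ### Compactness -/

theorem norm_setIntegral_Ioc_le {f : ℝ → 𝕜} (hf : MemLp f 2) {a b : ℝ} :
    ‖∫ y in Ioc a b, f y‖ ≤ (eLpNorm f 2 volume).toReal * Real.sqrt (b - a) := by
  have h1 : ‖∫ y in Ioc a b, f y‖ₑ ≤ eLpNorm f 2 volume * ENNReal.ofReal (b - a) ^ (1 / 2 : ℝ) := by
    calc ‖∫ y in Ioc a b, f y‖ₑ ≤ ∫⁻ y in Ioc a b, ‖f y‖ₑ := enorm_integral_le_lintegral_enorm _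
      _ = eLpNorm f 1 (volume.restrict (Ioc a b)) := eLpNorm_one_eq_lintegral_enorm.symm
      _ ≤ eLpNorm f 2 (volume.restrict (Ioc a b)) *
          (volume.restrict (Ioc a b)) univ ^ (1 / (1 : ℝ≥0∞).toReal - 1 / (2 : ℝ≥0∞).toReal) :=
        eLpNorm_le_eLpNorm_mul_rpow_measure_univ (by norm_num) hf.1.restrict
      _ ≤ _ := by
        gcongr
        · exact Measure.restrict_le_self
        · simp; norm_num
  rw [← toReal_enorm]
  refine (ENNReal.toReal_mono (ENNReal.mul_ne_top hf.2.ne ?_) h1).trans (le_of_eq ?_)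
  · exact ENNReal.rpow_ne_top_of_nonneg (by norm_num) ENNReal.ofReal_ne_top
  · rw [ENNReal.toReal_mul, ← ENNReal.toReal_rpow, ENNReal.toReal_ofReal', ← Real.sqrt_eq_rpow]
    congr 1
    rcases le_total 0 (b - a) with h | h
    · rw [max_eq_left h]
    · rw [max_eq_right h, Real.sqrt_zero, Real.sqrt_eq_zero_of_nonpos h]

/-- Hölder continuity of `H¹` functions. Splitting the integral at `y`, the older part is damped by
`e^{y-x}` and the part on `(y, x]` is estimated by Cauchy-Schwarz. The bound depends on `g` only
through its norm, so point evaluations vary continuously in operator norm. -/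
theorem norm_expAvg_sub_le {g : ℝ → 𝕜} (hg : MemLp g 2) {x y : ℝ} (hxy : y ≤ x) :
    ‖expAvg g x - expAvg g y‖
      ≤ (eLpNorm g 2 volume).toReal * ((1 - Real.exp (y - x)) + Real.sqrt (x - y)) := by
  have h1 : expAvg g x = Real.exp (y - x) • expAvg g y
      + ∫ t in Ioc y x, Real.exp (t - x) • g t := by
    have e : Real.exp (y - x) • expAvg g y = ∫ t in Iic y, Real.exp (t - x) • g t := by
      unfold expAvg
      rw [← integral_smul]
      refine integral_congr_ae (ae_of_all _ fun t => ?_)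
      simp only [smul_smul, ← Real.exp_add]
      congr 2; ring
    rw [e, ← setIntegral_union (Iic_disjoint_Ioc le_rfl) measurableSet_Ioc
      (integrableOn_exp_smul hg y x)
      ((integrableOn_exp_smul hg x x).mono_set Ioc_subset_Iic_self), Iic_union_Ioc_eq_Iic hxy]
    rfl
  have hm : MemLp ((Iic x).indicator fun t => Real.exp (t - x) • g t) 2 ∧
      eLpNorm ((Iic x).indicator fun t => Real.exp (t - x) • g t) 2 volume
        ≤ eLpNorm g 2 volume := by
    have hb : ∀ t, ‖(Iic x).indicator (fun t => Real.exp (t - x) • g t) t‖ ≤ ‖g t‖ := by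
      intro t
      by_cases ht : t ≤ x
      · simp only [indicator, mem_Iic, ht, if_true, norm_smul, Real.norm_eq_abs, Real.abs_exp]
        exact mul_le_of_le_one_left (norm_nonneg _) (Real.exp_le_one_iff.2 (sub_nonpos.2 ht))
      · simp [indicator, ht]
    have hms : AEStronglyMeasurable ((Iic x).indicator fun t => Real.exp (t - x) • g t) volume := by
      have := hg.1
      exact AEStronglyMeasurable.indicator (by fun_prop) measurableSet_Iic
    exact ⟨hg.of_le hms (ae_of_all _ hb), eLpNorm_mono hb⟩
  have h2 : ‖∫ t in Ioc y x, Real.exp (t - x) • g t‖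
      ≤ (eLpNorm g 2 volume).toReal * Real.sqrt (x - y) := by
    have e : ∫ t in Ioc y x, Real.exp (t - x) • g t
        = ∫ t in Ioc y x, (Iic x).indicator (fun t => Real.exp (t - x) • g t) t :=
      setIntegral_congr_fun measurableSet_Ioc fun t ht => by simp [ht.2]
    rw [e]
    refine (norm_setIntegral_Ioc_le hm.1).trans ?_
    gcongr
    · exact hg.2.ne
    · exact hm.2
  have h3 : Real.exp (y - x) ≤ 1 := Real.exp_le_one_iff.2 (sub_nonpos.2 hxy)
  calc ‖expAvg g x - expAvg g y‖
      = ‖(Real.exp (y - x) - 1) • expAvg g y + ∫ t in Ioc y x, Real.exp (t - x) • g t‖ := by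
        rw [h1, sub_smul, one_smul]; congr 1; abel
    _ ≤ ‖(Real.exp (y - x) - 1) • expAvg g y‖ + ‖∫ t in Ioc y x, Real.exp (t - x) • g t‖ :=
        norm_add_le _ _
    _ ≤ (1 - Real.exp (y - x)) * (eLpNorm g 2 volume).toReal
          + (eLpNorm g 2 volume).toReal * Real.sqrt (x - y) := by
        rw [norm_smul, Real.norm_eq_abs, abs_of_nonpos (by linarith), neg_sub]
        gcongr
        exact norm_expAvg_le hg y
    _ = _ := by ring

/-- Evaluation of `expAvg` at a point, as a functional on `L²`. -/
def evalFunctional (𝕜 : Type*) [RCLike 𝕜] (x : ℝ) : L2 𝕜 →L[𝕜] 𝕜 :=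
  (BoundedContinuousFunction.evalCLM 𝕜 x).comp (sobolevEmb 𝕜)

theorem evalFunctional_apply (x : ℝ) (g : L2 𝕜) : evalFunctional 𝕜 x g = expAvg g x := rfl

theorem norm_evalFunctional_le (x : ℝ) : ‖evalFunctional 𝕜 x‖ ≤ 1 :=
  ContinuousLinearMap.opNorm_le_bound _ zero_le_one fun g => by
    rw [one_mul]; exact norm_expAvg_le (Lp.memLp g) x

/-- Norm continuity provides the measurability needed to regard `x ↦ m(x) ev_x` as an `L²` field of
functionals. -/
theorem continuous_evalFunctional : Continuous (evalFunctional 𝕜) := by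
  have hle : ∀ x y, y ≤ x → ‖evalFunctional 𝕜 x - evalFunctional 𝕜 y‖
      ≤ (1 - Real.exp (-|x - y|)) + Real.sqrt |x - y| := by
    intro x y hxy
    have h3 : Real.exp (y - x) ≤ 1 := Real.exp_le_one_iff.2 (sub_nonpos.2 hxy)
    rw [abs_of_nonneg (sub_nonneg.2 hxy), neg_sub]
    refine ContinuousLinearMap.opNorm_le_bound _
      (add_nonneg (by linarith) (Real.sqrt_nonneg _)) fun g => ?_
    rw [mul_comm]
    exact norm_expAvg_sub_le (Lp.memLp g) hxy
  have hle' : ∀ x y, ‖evalFunctional 𝕜 x - evalFunctional 𝕜 y‖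
      ≤ (1 - Real.exp (-|x - y|)) + Real.sqrt |x - y| := by
    intro x y
    rcases le_total y x with h | h
    · exact hle x y h
    · rw [norm_sub_rev, abs_sub_comm]; exact hle y x h
  rw [continuous_iff_continuousAt]
  intro y
  rw [ContinuousAt, tendsto_iff_norm_sub_tendsto_zero]
  refine squeeze_zero (fun _ => norm_nonneg _) (fun x => hle' x y) ?_
  have : Continuous fun x : ℝ => (1 - Real.exp (-|x - y|)) + Real.sqrt |x - y| := by fun_prop
  simpa using this.tendsto y

section
variable {E : Type*} [NormedAddCommGroup E] [NormedSpace 𝕜 E]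

/-- The operator `v ↦ (x ↦ Φ(x) v)` attached to a square integrable field of functionals. -/
def fieldOp : Lp (E →L[𝕜] 𝕜) 2 (volume : Measure ℝ) →L[𝕜] E →L[𝕜] L2 𝕜 :=
  LinearMap.mkContinuous₂
    (LinearMap.mk₂ 𝕜 (fun Φ v => (ContinuousLinearMap.apply 𝕜 𝕜 v).compLp Φ)
      (fun Φ Ψ v => (ContinuousLinearMap.compLpL 2 volume (ContinuousLinearMap.apply 𝕜 𝕜 v)).map_add Φ Ψ)
      (fun c Φ v => (ContinuousLinearMap.compLpL 2 volume (ContinuousLinearMap.apply 𝕜 𝕜 v)).map_smul c Φ)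
      (fun Φ v w => by rw [map_add, ContinuousLinearMap.add_compLp])
      (fun c Φ v => by rw [map_smul, ContinuousLinearMap.smul_compLp])) 1
    (fun Φ v => by
      rw [one_mul]
      refine (ContinuousLinearMap.norm_compLp_le _ _).trans ?_
      rw [mul_comm]
      refine mul_le_mul_of_nonneg_left ?_ (norm_nonneg _)
      exact ContinuousLinearMap.opNorm_le_bound _ (norm_nonneg v) fun f => by
        rw [mul_comm]; exact f.le_opNorm v)

theorem coeFn_fieldOp (Φ : Lp (E →L[𝕜] 𝕜) 2 (volume : Measure ℝ)) (v : E) :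
    fieldOp Φ v =ᵐ[volume] fun x => Φ x v :=
  ContinuousLinearMap.coeFn_compLp _ _

/-- A Hilbert-Schmidt argument: indicator fields give rank one operators, simple fields are dense,
and compact operators are closed under norm limits. -/
theorem isCompactOperator_fieldOp (Φ : Lp (E →L[𝕜] 𝕜) 2 (volume : Measure ℝ)) :
    IsCompactOperator (fieldOp Φ) := by
  refine Lp.induction (ENNReal.ofNat_ne_top) (motive := fun Φ => IsCompactOperator (fieldOp Φ))
    ?_ ?_ ?_ Φ
  · intro c s hs hμs
    have : fieldOp ((Lp.simpleFunc.indicatorConst 2 hs hμs.ne c :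
        Lp.simpleFunc (E →L[𝕜] 𝕜) 2 volume) : Lp (E →L[𝕜] 𝕜) 2 (volume : Measure ℝ))
        = (ContinuousLinearMap.toSpanSingleton 𝕜
            (indicatorConstLp 2 hs hμs.ne (1 : 𝕜))).comp c := by
      ext1 v
      refine Lp.ext ?_
      rw [Lp.simpleFunc.coe_indicatorConst]
      filter_upwards [coeFn_fieldOp (indicatorConstLp 2 hs hμs.ne c) v,
        indicatorConstLp_coeFn (p := 2) (hs := hs) (hμs := hμs.ne) (c := c),
        indicatorConstLp_coeFn (p := 2) (hs := hs) (hμs := hμs.ne) (c := (1 : 𝕜)),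
        Lp.coeFn_smul (c v) (indicatorConstLp 2 hs hμs.ne (1 : 𝕜))] with x h1 h2 h3 h4
      rw [h1, h2]
      simp only [ContinuousLinearMap.comp_apply, ContinuousLinearMap.toSpanSingleton_apply]
      rw [h4, Pi.smul_apply, h3]
      by_cases hx : x ∈ s <;> simp [hx]
    rw [this]
    exact (isCompactOperator_of_locallyCompactSpace_rng
      (ContinuousLinearMap.toSpanSingleton 𝕜 (indicatorConstLp 2 hs hμs.ne (1 : 𝕜)))).comp_clm c
  · intro f g hf hg _ h1 h2
    rw [map_add]
    exact h1.add h2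
  · exact isClosed_setOfPred_isCompactOperator.preimage
      (fieldOp : Lp (E →L[𝕜] 𝕜) 2 (volume : Measure ℝ) →L[𝕜] E →L[𝕜] L2 𝕜).continuous

end

/-- `m T` is the operator of the field `x ↦ m(x) ev_x`, whose norm is at most `|m(x)|` and hence
square integrable. -/
theorem isCompactOperator_mulOp_comp_expOp (m : ℝ →ᵇ ℝ) (hm : MemLp m 2) :
    IsCompactOperator ((mulOp 𝕜 m).comp (expOp 𝕜)) := by
  have hΦ : MemLp (fun x => (m x : 𝕜) • evalFunctional 𝕜 x) 2 := by
    refine hm.of_le (by have := continuous_evalFunctional (𝕜 := 𝕜); have := m.continuous; exact (by fun_prop : Continuous _).aestronglyMeasurable)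
      (ae_of_all _ fun x => ?_)
    rw [norm_smul, RCLike.norm_ofReal]
    exact mul_le_of_le_one_right (abs_nonneg _) (norm_evalFunctional_le x)
  have : (mulOp 𝕜 m).comp (expOp 𝕜) = fieldOp hΦ.toLp := by
    ext1 g
    refine Lp.ext ?_
    filter_upwards [coeFn_fieldOp hΦ.toLp g, hΦ.coeFn_toLp, coeFn_mulOp m (expOp 𝕜 g),
      coeFn_expOp g] with x h1 h2 h3 h4
    rw [h1, h2, ContinuousLinearMap.comp_apply, h3, h4]
    simp [evalFunctional_apply, RCLike.real_smul_eq_coe_mul]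
  rw [this]
  exact isCompactOperator_fieldOp _

end QuinticNLS

namespace QuinticNLS
open Set Filter
open scoped ENNReal InnerProductSpace BoundedContinuousFunction ContDiff

variable {𝕜 : Type*} [RCLike 𝕜]

/-! ### The weak form of `-u'' + u = h` -/

theorem contDiff_two_of_infty {f : ℝ → ℝ} (h : ContDiff ℝ ∞ f) : ContDiff ℝ 2 f :=
  mod_cast contDiff_infty.1 h 2

/-- Bootstrapping: each use of `u' = a u + f` gains one derivative. -/
theorem contDiff_of_hasDerivAt_linear {u f : ℝ → ℝ} {a : ℝ} (hf : ContDiff ℝ ∞ f)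
    (hd : ∀ x, HasDerivAt u (a * u x + f x) x) : ContDiff ℝ ∞ u := by
  rw [contDiff_infty]
  intro n
  induction n with
  | zero =>
    rw [Nat.cast_zero, contDiff_zero]
    exact continuous_iff_continuousAt.2 fun x => (hd x).continuousAt
  | succ n ih =>
    have : ((n + 1 : ℕ) : ℕ∞ω) = (n : ℕ∞ω) + 1 := by push_cast; rfl
    rw [this, contDiff_succ_iff_deriv]
    refine ⟨fun x => (hd x).differentiableAt, by simp, ?_⟩
    have e : deriv u = fun x => a * u x + f x := funext fun x => (hd x).deriv
    rw [e]
    have := contDiff_infty.1 hf n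
    fun_prop

theorem iteratedDeriv_two_eq {u u' u'' : ℝ → ℝ} (h1 : ∀ x, HasDerivAt u (u' x) x)
    (h2 : ∀ x, HasDerivAt u' (u'' x) x) : iteratedDeriv 2 u = u'' := by
  have e1 : deriv u = u' := funext fun x => (h1 x).deriv
  have e2 : deriv u' = u'' := funext fun x => (h2 x).deriv
  rw [iteratedDeriv_succ, iteratedDeriv_one, e1, e2]

theorem hasDerivAt_deriv_of_contDiff_two {u : ℝ → ℝ} (hu : ContDiff ℝ 2 u) :
    (∀ x, HasDerivAt u (deriv u x) x) ∧ (∀ x, HasDerivAt (deriv u) (iteratedDeriv 2 u x) x) ∧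
      Continuous (deriv u) ∧ Continuous (iteratedDeriv 2 u) := by
  have h0 : Differentiable ℝ u := hu.differentiable (by norm_num)
  have h1 : ContDiff ℝ 1 (deriv u) := by
    have : ContDiff ℝ (1 + 1) u := by convert! hu using 1
    exact (contDiff_succ_iff_deriv.1 this).2.2
  have h2 : Differentiable ℝ (deriv u) := h1.differentiable (by norm_num)
  refine ⟨fun x => (h0 x).hasDerivAt, fun x => ?_, h1.continuous,
    hu.continuous_iteratedDeriv 2 le_rfl⟩
  rw [iteratedDeriv_succ, iteratedDeriv_one]
  exact (h2 x).hasDerivAt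

theorem memLp_of_hasCompactSupport {φ : ℝ → ℝ} (hc : Continuous φ) (hs : HasCompactSupport φ) :
    MemLp φ 2 := hc.memLp_of_hasCompactSupport hs

theorem iteratedDeriv_two_hasCompactSupport {φ : ℝ → ℝ} (hs : HasCompactSupport φ) :
    HasCompactSupport (iteratedDeriv 2 φ) := by
  rw [iteratedDeriv_succ, iteratedDeriv_one]
  exact hs.deriv.deriv

/-- A square integrable distributional solution of `d - d'' = 0` vanishes. -/
theorem ae_eq_zero_of_weak {d : ℝ → 𝕜} (hd : MemLp d 2)
    (h : ∀ φ : ℝ → ℝ, ContDiff ℝ ∞ φ → HasCompactSupport φ →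
      ∫ x, d x * ((φ x - iteratedDeriv 2 φ x : ℝ) : 𝕜) = 0) : d =ᵐ[volume] 0 := by
  refine ae_eq_zero_of_integral_contDiff_smul_eq_zero (hd.locallyIntegrable (by norm_num)) ?_
  intro χ hχ hχs
  have hχL : MemLp χ 2 := memLp_of_hasCompactSupport hχ.continuous hχs
  -- For a given test function `χ`, the function `φ = T T* χ` solves `φ - φ'' = χ` but need not have
  -- compact support. The hypothesis is applied to `b(c x) φ(x)` with `c → 0`; every commutator term
  -- carries a factor `c` and disappears in the limit.
  set ζ := expAvgAdj χ with hζ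
  have hζL : MemLp ζ 2 := memLp_expAvgAdj hχL
  have hζd : ∀ x, HasDerivAt ζ (ζ x - χ x) x := hasDerivAt_expAvgAdj hχL hχ.continuous
  have hζc : ContDiff ℝ ∞ ζ := contDiff_of_hasDerivAt_linear (a := 1) hχ.neg (fun x => by
    simpa [sub_eq_add_neg] using hζd x)
  set φ := expAvg ζ with hφ
  have hφL : MemLp φ 2 := memLp_expAvg hζL
  have hφd : ∀ x, HasDerivAt φ (ζ x - φ x) x := hasDerivAt_expAvg hζL hζc.continuous
  have hφc : ContDiff ℝ ∞ φ := contDiff_of_hasDerivAt_linear (a := -1) hζc (fun x => by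
    convert! hφd x using 1; ring)
  let b : ContDiffBump (0 : ℝ) := ⟨1, 2, one_pos, one_lt_two⟩
  have hb : ContDiff ℝ ∞ b := b.contDiff
  have hbd := hasDerivAt_deriv_of_contDiff_two (contDiff_two_of_infty hb)
  obtain ⟨M1, hM1⟩ := b.hasCompactSupport.deriv.exists_bound_of_continuous hbd.2.2.1
  obtain ⟨M2, hM2⟩ :=
    (iteratedDeriv_two_hasCompactSupport b.hasCompactSupport).exists_bound_of_continuous hbd.2.2.2
  have hM1' : 0 ≤ M1 := (norm_nonneg _).trans (hM1 0)
  have hM2' : 0 ≤ M2 := (norm_nonneg _).trans (hM2 0)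
  -- the cutoffs
  let c : ℕ → ℝ := fun n => ((n : ℝ) + 1)⁻¹
  have hc0 : ∀ n, 0 < c n := fun n => by positivity
  have hc1 : ∀ n, c n ≤ 1 := fun n => inv_le_one_of_one_le₀ (by simp)
  have hct : Tendsto c atTop (𝓝 0) := by
    simpa [c, one_div] using tendsto_one_div_add_atTop_nhds_zero_nat (𝕜 := ℝ)
  have hθ1 : ∀ n x, HasDerivAt (fun x => b (c n * x)) (c n * deriv b (c n * x)) x := fun n x => by
    have := (hbd.1 (c n * x)).comp x ((hasDerivAt_id x).const_mul (c n))
    simpa [Function.comp_def, mul_comm] using this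
  have hθ2 : ∀ n x, HasDerivAt (fun x => c n * deriv b (c n * x))
      (c n * (c n * iteratedDeriv 2 b (c n * x))) x := fun n x => by
    have := (hbd.2.1 (c n * x)).comp x ((hasDerivAt_id x).const_mul (c n))
    have := this.const_mul (c n)
    simpa [Function.comp_def, mul_comm] using this
  have hD2 : ∀ n, iteratedDeriv 2 (fun x => b (c n * x) * φ x) = fun x =>
      c n * (c n * iteratedDeriv 2 b (c n * x)) * φ x
        + 2 * (c n * deriv b (c n * x)) * (ζ x - φ x) + b (c n * x) * (φ x - χ x) := fun n => by
    refine iteratedDeriv_two_eq (fun x => (hθ1 n x).mul (hφd x)) (fun x => ?_)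
    convert! ((hθ2 n x).mul (hφd x)).add ((hθ1 n x).mul ((hζd x).sub (hφd x))) using 1
    rw [Pi.sub_apply]
    ring
  have hzero : ∀ n, ∫ x, d x * ((b (c n * x) * χ x
      - (c n * (c n * iteratedDeriv 2 b (c n * x)) * φ x
        + 2 * (c n * deriv b (c n * x)) * (ζ x - φ x)) : ℝ) : 𝕜) = 0 := fun n => by
    rw [← h (fun x => b (c n * x) * φ x) (by fun_prop) ?_]
    · refine integral_congr_ae (ae_of_all _ fun x => ?_)
      simp only [hD2]
      congr 2; ring
    · have h1 : HasCompactSupport (fun x => b (c n * x)) :=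
        b.hasCompactSupport.comp_homeomorph (Homeomorph.mulLeft₀ (c n) (hc0 n).ne')
      exact h1.mul_right
  have hlim : Tendsto (fun n => ∫ x, d x * ((b (c n * x) * χ x
      - (c n * (c n * iteratedDeriv 2 b (c n * x)) * φ x
        + 2 * (c n * deriv b (c n * x)) * (ζ x - φ x)) : ℝ) : 𝕜)) atTop
      (𝓝 (∫ x, d x * (χ x : 𝕜))) := by
    refine tendsto_integral_of_dominated_convergence
      (fun x => ‖d x‖ * (|χ x| + (M2 * |φ x| + 2 * M1 * |ζ x - φ x|))) (fun n => ?_) ?_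
      (fun n => ae_of_all _ fun x => ?_) (ae_of_all _ fun x => ?_)
    · refine hd.1.mul (Continuous.aestronglyMeasurable ?_)
      have := hζc.continuous; have := hφc.continuous; have := hχ.continuous
      have := hbd.2.2.1; have := hbd.2.2.2; have := hb.continuous
      exact RCLike.continuous_ofReal.comp (by fun_prop)
    · have h2 : MemLp (fun x => |χ x| + (M2 * |φ x| + 2 * M1 * |ζ x - φ x|)) 2 :=
        hχL.norm.add ((hφL.norm.const_mul M2).add ((hζL.sub hφL).norm.const_mul (2 * M1)))
      exact hd.norm.integrable_mul h2
    · rw [norm_mul, RCLike.norm_ofReal]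
      refine mul_le_mul_of_nonneg_left ?_ (norm_nonneg _)
      have e1 : |b (c n * x) * χ x| ≤ |χ x| := by
        rw [abs_mul, abs_of_nonneg b.nonneg]
        exact mul_le_of_le_one_left (abs_nonneg _) b.le_one
      have e2 : |c n * (c n * iteratedDeriv 2 b (c n * x)) * φ x| ≤ M2 * |φ x| := by
        rw [abs_mul, abs_mul, abs_mul, abs_of_pos (hc0 n)]
        refine mul_le_mul_of_nonneg_right ?_ (abs_nonneg _)
        have := hM2 (c n * x)
        rw [Real.norm_eq_abs] at this
        calc c n * (c n * |iteratedDeriv 2 b (c n * x)|) ≤ 1 * (1 * M2) := by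
              gcongr <;> exact hc1 n
          _ = M2 := by ring
      have e3 : |2 * (c n * deriv b (c n * x)) * (ζ x - φ x)| ≤ 2 * M1 * |ζ x - φ x| := by
        rw [abs_mul, abs_mul, abs_mul, abs_of_pos (hc0 n), abs_two]
        refine mul_le_mul_of_nonneg_right ?_ (abs_nonneg _)
        have := hM1 (c n * x)
        rw [Real.norm_eq_abs] at this
        calc 2 * (c n * |deriv b (c n * x)|) ≤ 2 * (1 * M1) := by
              gcongr
              exact hc1 n
          _ = 2 * M1 := by ring
      refine (abs_sub _ _).trans ?_
      exact add_le_add e1 ((abs_add_le _ _).trans (add_le_add e2 e3))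
    · refine Tendsto.const_mul _ ?_
      refine (RCLike.continuous_ofReal.tendsto _).comp ?_
      have hcx : Tendsto (fun n => c n * x) atTop (𝓝 0) := by simpa using hct.mul_const x
      have t0 : Tendsto (fun n => b (c n * x)) atTop (𝓝 1) := by
        have := (hb.continuous.tendsto 0).comp hcx
        have e : b 0 = 1 := b.one_of_mem_closedBall (by simp [b])
        rwa [e] at this
      have t1 := hct.mul ((hbd.2.2.1.tendsto 0).comp hcx)
      have t2 := hct.mul (hct.mul ((hbd.2.2.2.tendsto 0).comp hcx))
      have := (t0.mul_const (χ x)).sub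
        ((t2.mul_const (φ x)).add ((t1.const_mul 2).mul_const (ζ x - φ x)))
      simpa [Function.comp_def] using this
  have := tendsto_nhds_unique hlim (by simp only [hzero]; exact tendsto_const_nhds)
  rw [← this]
  refine integral_congr_ae (ae_of_all _ fun x => ?_)
  simp [RCLike.real_smul_eq_coe_mul, mul_comm]

theorem hasDerivAt_ofReal_comp {u : ℝ → ℝ} {u' x : ℝ} (h : HasDerivAt u u' x) :
    HasDerivAt (fun x => (u x : 𝕜)) (u' : 𝕜) x :=
  (RCLike.ofRealCLM (K := 𝕜)).hasFDerivAt.comp_hasDerivAt x h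

/-- `TT*h` is a weak solution of `-u'' + u = h`. -/
theorem weak_of_eq (h : L2 𝕜) {φ : ℝ → ℝ} (hφ : ContDiff ℝ ∞ φ) (hs : HasCompactSupport φ) :
    ∫ x, expAvg (expAvgAdj h) x * ((φ x - iteratedDeriv 2 φ x : ℝ) : 𝕜)
      = ∫ x, h x * (φ x : 𝕜) := by
  obtain ⟨d1, d2, c1, c2⟩ := hasDerivAt_deriv_of_contDiff_two (u := φ)
    (contDiff_two_of_infty hφ)
  have L0 : MemLp (fun x => (φ x : 𝕜)) 2 := (memLp_of_hasCompactSupport hφ.continuous hs).ofReal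
  have L1 : MemLp (fun x => ((deriv φ x : ℝ) : 𝕜)) 2 := (memLp_of_hasCompactSupport c1 hs.deriv).ofReal
  have L2' : MemLp (fun x : ℝ => ((iteratedDeriv 2 φ x : ℝ) : 𝕜)) 2 :=
    (memLp_of_hasCompactSupport c2 (iteratedDeriv_two_hasCompactSupport hs)).ofReal
  have e1 : (fun x => ((φ x - iteratedDeriv 2 φ x : ℝ) : 𝕜)) = fun x =>
      ((φ x : 𝕜) + ((deriv φ x : ℝ) : 𝕜)) - (((deriv φ x : ℝ) : 𝕜) + ((iteratedDeriv 2 φ x : ℝ) : 𝕜)) := by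
    ext x; push_cast; ring
  have e2 := expAvgAdj_sub_deriv (fun x => (hasDerivAt_ofReal_comp (𝕜 := 𝕜) (d1 x)).add
    (hasDerivAt_ofReal_comp (d2 x))) (L0.add L1) (L1.add L2')
  have e3 := expAvg_add_deriv (fun x => hasDerivAt_ofReal_comp (𝕜 := 𝕜) (d1 x)) L0 L1
  have hh := Lp.memLp h
  have L3 : MemLp (fun x => ((φ x - iteratedDeriv 2 φ x : ℝ) : 𝕜)) 2 := by
    rw [e1]; exact (L0.add L1).sub (L1.add L2')
  rw [integral_expAvg_mul (memLp_expAvgAdj hh) L3, e1]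
  have e4 : expAvgAdj (fun x => ((φ x : 𝕜) + ((deriv φ x : ℝ) : 𝕜))
      - (((deriv φ x : ℝ) : 𝕜) + ((iteratedDeriv 2 φ x : ℝ) : 𝕜))) = fun x => (φ x : 𝕜) + ((deriv φ x : ℝ) : 𝕜) := e2
  rw [e4]
  have := integral_expAvg_mul (L0.add L1) hh
  have e5 : expAvg ((fun x => (φ x : 𝕜)) + fun x => ((deriv φ x : ℝ) : 𝕜)) = fun x => (φ x : 𝕜) := e3
  rw [e5] at this
  simp only [Pi.add_apply] at this
  rw [integral_congr_ae (ae_of_all _ fun x => mul_comm _ _), ← this]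
  exact integral_congr_ae (ae_of_all _ fun x => mul_comm _ _)

/-- Identifies the distributional inverse of `1 - ∂²` on `L²` with `T T*`: uniqueness comes from the
absence of square integrable solutions of `d - d'' = 0`, existence from adjointness. -/
theorem weak_iff (u h : L2 𝕜) :
    (∀ φ : ℝ → ℝ, ContDiff ℝ ∞ φ → HasCompactSupport φ →
      ∫ x, u x * ((φ x - iteratedDeriv 2 φ x : ℝ) : 𝕜) = ∫ x, h x * (φ x : 𝕜)) ↔
    u = expOp 𝕜 (expOpAdj 𝕜 h) := by
  have e : expOp 𝕜 (expOpAdj 𝕜 h) =ᵐ[volume] expAvg (expAvgAdj h) := by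
    refine (coeFn_expOp _).trans ?_
    rw [expAvg_congr (coeFn_expOpAdj h)]
  constructor
  · intro H
    refine Lp.ext (EventuallyEq.trans ?_ e.symm)
    have hL : MemLp (expAvg (expAvgAdj h)) 2 := memLp_expAvg (memLp_expAvgAdj (Lp.memLp h))
    have := ae_eq_zero_of_weak ((Lp.memLp u).sub hL) (fun φ hφ hs => by
      have c2 := (hasDerivAt_deriv_of_contDiff_two (u := φ)
        (contDiff_two_of_infty hφ)).2.2.2
      have L3 : MemLp (fun x => ((φ x - iteratedDeriv 2 φ x : ℝ) : 𝕜)) 2 :=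
        ((memLp_of_hasCompactSupport hφ.continuous hs).sub
        (memLp_of_hasCompactSupport c2 (iteratedDeriv_two_hasCompactSupport hs))).ofReal
      simp only [Pi.sub_apply, sub_mul]
      have i1 := (Lp.memLp u).integrable_mul L3
      have i2 := hL.integrable_mul L3
      simp only [Pi.mul_def] at i1 i2
      rw [integral_sub i1 i2, H φ hφ hs,
        weak_of_eq h hφ hs, sub_self])
    filter_upwards [this] with x hx
    simpa [sub_eq_zero] using hx
  · rintro rfl φ hφ hs
    rw [← weak_of_eq h hφ hs]
    refine integral_congr_ae ?_
    filter_upwards [e] with x hx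
    rw [hx]

/-- The graph of `-∂ₓ² + V` in terms of bounded operators. -/
theorem schrodingerGraph_iff (v : ℝ →ᵇ ℝ) (u w : L2 ℂ) :
    SchrodingerGraph v u w ↔ u = expOp ℂ (expOpAdj ℂ (w - mulOp ℂ v u + u)) := by
  rw [← weak_iff]
  refine forall_congr' fun φ => forall_congr' fun hφ => forall_congr' fun hs => ?_
  have c2 := (hasDerivAt_deriv_of_contDiff_two (u := φ)
    (contDiff_two_of_infty hφ)).2.2.2
  have L0 : MemLp (fun x => (φ x : ℂ)) 2 := (memLp_of_hasCompactSupport hφ.continuous hs).ofReal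
  have L2' : MemLp (fun x : ℝ => ((iteratedDeriv 2 φ x : ℝ) : ℂ)) 2 :=
    (memLp_of_hasCompactSupport c2 (iteratedDeriv_two_hasCompactSupport hs)).ofReal
  have i1 := (Lp.memLp u).integrable_mul L0
  have i2 := (Lp.memLp u).integrable_mul L2'
  have i3 := (Lp.memLp (mulOp ℂ v u)).integrable_mul L0
  have i4 := (Lp.memLp w).integrable_mul L0
  simp only [Pi.mul_def] at i1 i2 i3 i4
  have e1 : ∫ x, u x * ((-iteratedDeriv 2 φ x + v x * φ x : ℝ) : ℂ)
      = (∫ x, mulOp ℂ v u x * (φ x : ℂ)) - ∫ x, u x * ((iteratedDeriv 2 φ x : ℝ) : ℂ) := by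
    rw [← integral_sub i3 i2]
    refine integral_congr_ae ?_
    filter_upwards [coeFn_mulOp v u] with x hx
    rw [hx]
    push_cast
    rw [Complex.real_smul]
    ring
  have e2 : ∫ x, u x * ((φ x - iteratedDeriv 2 φ x : ℝ) : ℂ)
      = (∫ x, u x * (φ x : ℂ)) - ∫ x, u x * ((iteratedDeriv 2 φ x : ℝ) : ℂ) := by
    rw [← integral_sub i1 i2]
    refine integral_congr_ae (ae_of_all _ fun x => ?_)
    push_cast
    ring
  have e3 : ∫ x, (w - mulOp ℂ v u + u : L2 ℂ) x * (φ x : ℂ) = (∫ x, w x * (φ x : ℂ))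
      - (∫ x, mulOp ℂ v u x * (φ x : ℂ)) + ∫ x, u x * (φ x : ℂ) := by
    have i5 : Integrable fun x => w x * (φ x : ℂ) - mulOp ℂ v u x * (φ x : ℂ) := i4.sub i3
    rw [← integral_sub i4 i3, ← integral_add i5 i1]
    refine integral_congr_ae ?_
    filter_upwards [Lp.coeFn_add (w - mulOp ℂ v u) u, Lp.coeFn_sub w (mulOp ℂ v u)] with x h1 h2
    rw [h1, Pi.add_apply, h2, Pi.sub_apply]
    ring
  change ∫ x, u x * ((-iteratedDeriv 2 φ x + v x * φ x : ℝ) : ℂ) = _ ↔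
    ∫ x, u x * ((φ x - iteratedDeriv 2 φ x : ℝ) : ℂ) = ∫ x, (w - mulOp ℂ v u + u : L2 ℂ) x * (φ x : ℂ)
  rw [e1, e2, e3]
  constructor
  · intro h; rw [← h]; ring
  · intro h; linear_combination h

/-! ### Regularity of the solutions of `-u'' + u = f` -/

/-- A square integrable `C²` function `u` with `u - u''` square integrable is `TT*(u - u'')`. -/
theorem expAvg_expAvgAdj_of_contDiff {u : ℝ → ℝ} (hu : ContDiff ℝ 2 u) (hL : MemLp u 2)
    (hL2 : MemLp (fun x => u x - iteratedDeriv 2 u x) 2) :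
    u = expAvg (expAvgAdj fun x => u x - iteratedDeriv 2 u x) := by
  obtain ⟨d1, d2, c1, c2⟩ := hasDerivAt_deriv_of_contDiff_two hu
  have hw : hL.toLp = expOp ℝ (expOpAdj ℝ hL2.toLp) := by
    rw [← weak_iff]
    intro φ hφ hs
    obtain ⟨p1, p2, q1, q2⟩ := hasDerivAt_deriv_of_contDiff_two (u := φ)
      (contDiff_two_of_infty hφ)
    have hs2 := iteratedDeriv_two_hasCompactSupport hs
    have cu := hu.continuous
    have cφ := hφ.continuous
    have hint : ∀ f g : ℝ → ℝ, Continuous f → Continuous g → HasCompactSupport g →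
        Integrable (fun x => f x * g x) := fun f g hf hg hgs =>
      (hf.mul hg).integrable_of_hasCompactSupport hgs.mul_left
    have I1 := integral_mul_deriv_eq_deriv_mul_of_integrable (u := u) (v := deriv φ)
      (fun x _ => d1 x) (fun x _ => p2 x) (hint _ _ cu q2 hs2) (hint _ _ c1 q1 hs.deriv)
      (hint _ _ cu q1 hs.deriv)
    have I2 := integral_mul_deriv_eq_deriv_mul_of_integrable (u := deriv u) (v := φ)
      (fun x _ => d2 x) (fun x _ => p1 x) (hint _ _ c1 q1 hs.deriv) (hint _ _ c2 cφ hs)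
      (hint _ _ c1 cφ hs)
    calc ∫ x, hL.toLp u x * ((φ x - iteratedDeriv 2 φ x : ℝ) : ℝ)
        = ∫ x, (u x * φ x - u x * iteratedDeriv 2 φ x) := by
          refine integral_congr_ae ?_
          filter_upwards [hL.coeFn_toLp] with x hx
          rw [hx, mul_sub]
      _ = ∫ x, (u x * φ x - iteratedDeriv 2 u x * φ x) := by
          rw [integral_sub (hint _ _ cu cφ hs) (hint _ _ cu q2 hs2),
            integral_sub (hint _ _ cu cφ hs) (hint _ _ c2 cφ hs), I1, I2, neg_neg]
      _ = _ := by
          refine integral_congr_ae ?_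
          filter_upwards [hL2.coeFn_toLp] with x hx
          rw [hx, sub_mul]; rfl
  have hae : u =ᵐ[volume] expAvg (expAvgAdj fun x => u x - iteratedDeriv 2 u x) := by
    have h1 := hL.coeFn_toLp
    rw [hw] at h1
    refine h1.symm.trans ((coeFn_expOp _).trans ?_)
    rw [expAvg_congr (coeFn_expOpAdj _), expAvgAdj_congr hL2.coeFn_toLp]
  exact (Continuous.ae_eq_iff_eq volume hu.continuous
    (continuous_expAvg (memLp_expAvgAdj hL2))).1 hae

/-- The function `TT*f` for a continuous `f ∈ L²` is a classical `H²` solution of `-u'' + u = f`. -/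
theorem regularity {f : ℝ → ℝ} (hc : Continuous f) (hf : MemLp f 2) :
    IsH2 (expAvg (expAvgAdj f)) ∧
      (∀ x, iteratedDeriv 2 (expAvg (expAvgAdj f)) x = expAvg (expAvgAdj f) x - f x) ∧
      deriv (expAvg (expAvgAdj f)) = fun x => expAvgAdj f x - expAvg (expAvgAdj f) x := by
  set k := expAvgAdj f with hk
  have hkL : MemLp k 2 := memLp_expAvgAdj hf
  have hkc : Continuous k := continuous_expAvgAdj hf
  have hkd : ∀ x, HasDerivAt k (k x - f x) x := hasDerivAt_expAvgAdj hf hc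
  set u := expAvg k with hu
  have huL : MemLp u 2 := memLp_expAvg hkL
  have huc : Continuous u := continuous_expAvg hkL
  have hud : ∀ x, HasDerivAt u (k x - u x) x := hasDerivAt_expAvg hkL hkc
  have hud2 : ∀ x, HasDerivAt (fun x => k x - u x) (u x - f x) x := fun x => by
    convert! (hkd x).sub (hud x) using 1; ring
  have e1 : deriv u = fun x => k x - u x := funext fun x => (hud x).deriv
  have e2 : iteratedDeriv 2 u = fun x => u x - f x := iteratedDeriv_two_eq hud hud2
  refine ⟨⟨?_, huL, ?_, ?_⟩, fun x => by rw [e2], e1⟩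
  · have : ContDiff ℝ (1 + 1) u := by
      rw [contDiff_succ_iff_deriv]
      refine ⟨fun x => (hud x).differentiableAt, by simp, ?_⟩
      rw [e1, contDiff_one_iff_deriv]
      refine ⟨fun x => (hud2 x).differentiableAt, ?_⟩
      have : deriv (fun x => k x - u x) = fun x => u x - f x := funext fun x => (hud2 x).deriv
      rw [this]; fun_prop
    convert! this using 1
  · rw [e1]; exact hkL.sub huL
  · rw [e2]; exact huL.sub hf

/-- `∫ u² + ∫ u'² = ∫ (u + u')²` for `H¹` functions. -/
theorem integral_sq_add_deriv {u u' : ℝ → ℝ} (hd : ∀ x, HasDerivAt u (u' x) x)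
    (hu : MemLp u 2) (hu' : MemLp u' 2) :
    (∫ x, u x ^ 2) + ∫ x, u' x ^ 2 = ∫ x, (u x + u' x) ^ 2 := by
  have hprod : Integrable fun x => u x * u' x := hu.integrable_mul hu'
  have h0 : ∫ x, 2 * (u x * u' x) = 0 := by
    refine integral_eq_zero_of_hasDerivAt_of_integrable (f := fun x => u x ^ 2) (fun x => ?_)
      (hprod.const_mul 2) hu.integrable_sq
    convert! (hd x).pow 2 using 1
    simp; ring
  have e : (fun x => (u x + u' x) ^ 2) = fun x => u x ^ 2 + u' x ^ 2 + 2 * (u x * u' x) := by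
    ext x; ring
  have h2 : Integrable fun x => u x ^ 2 + u' x ^ 2 := hu.integrable_sq.add hu'.integrable_sq
  rw [e, integral_add h2 (hprod.const_mul 2), h0, add_zero,
    integral_add hu.integrable_sq hu'.integrable_sq]

end QuinticNLS

/-! ### Lax-Milgram and the Fredholm alternative; the bounded form of the Schrödinger operator. -/

namespace QuinticNLS
open Set Filter
open scoped ENNReal InnerProductSpace BoundedContinuousFunction ContDiff

section Hilbert
variable {𝕜 H : Type*} [RCLike 𝕜] [NormedAddCommGroup H] [InnerProductSpace 𝕜 H]

theorem norm_le_of_coercive {A : H →L[𝕜] H} {c : ℝ}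
    (h : ∀ g, c * ‖g‖ ^ 2 ≤ RCLike.re ⟪A g, g⟫_𝕜) (g : H) : c * ‖g‖ ≤ ‖A g‖ := by
  by_cases hg : g = 0
  · simp [hg]
  have h1 : 0 < ‖g‖ := norm_pos_iff.2 hg
  have h2 := (h g).trans ((RCLike.re_le_norm _).trans (norm_inner_le_norm _ _))
  nlinarith

variable [CompleteSpace H]

/-- Lax-Milgram for a coercive operator. -/
theorem bijective_of_coercive {A : H →L[𝕜] H} {c : ℝ} (hc : 0 < c)
    (h : ∀ g, c * ‖g‖ ^ 2 ≤ RCLike.re ⟪A g, g⟫_𝕜) : Function.Bijective A := by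
  have hb := norm_le_of_coercive h
  have hanti : AntilipschitzWith (c⁻¹).toNNReal A := by
    refine ContinuousLinearMap.antilipschitz_of_bound A fun g => ?_
    rw [Real.coe_toNNReal _ (inv_pos.2 hc).le, ← div_eq_inv_mul, le_div_iff₀ hc, mul_comm]
    exact hb g
  refine ⟨hanti.injective, ?_⟩
  have hcl : IsClosed (A.range : Set H) := hanti.isClosed_range A.uniformContinuous
  have := hcl.completeSpace_coe
  have htop : A.range = ⊤ := by
    -- The range is closed by the lower bound. A vector `w` orthogonal to it satisfies `⟪A w, w⟫ =
    -- 0`, so coercivity makes it zero.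
    rw [← A.range.orthogonal_orthogonal, Submodule.eq_top_iff']
    intro v w hw
    have h0 : ⟪A w, w⟫_𝕜 = 0 := hw _ ⟨w, rfl⟩
    have h1 := h w
    rw [h0] at h1
    have : ‖w‖ = 0 := by
      have : ‖w‖ ^ 2 ≤ 0 := by
        by_contra hcon
        push Not at hcon
        have := mul_pos hc hcon
        simp at h1
        linarith
      exact pow_eq_zero_iff (two_ne_zero) |>.1 (le_antisymm this (sq_nonneg _))
    rw [norm_eq_zero.1 this, inner_zero_left]
  exact LinearMap.range_eq_top.1 htop

/-- A bijective bounded operator as a continuous equivalence. -/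
def equivOfBijective (A : H →L[𝕜] H) (h : Function.Bijective A) : H ≃L[𝕜] H :=
  ContinuousLinearEquiv.ofBijective A (LinearMap.ker_eq_bot.2 h.1) (LinearMap.range_eq_top.2 h.2)

/-- The Fredholm alternative for a compact perturbation of an invertible operator. -/
theorem bijective_add_compact {D C : H →L[𝕜] H} (hD : Function.Bijective D)
    (hC : IsCompactOperator C) (hinj : ∀ g, D g + C g = 0 → g = 0) :
    Function.Bijective (D + C) := by
  let e := equivOfBijective D hD
  let K : H →L[𝕜] H := (e.symm : H →L[𝕜] H).comp C
  have hK : IsCompactOperator K := hC.clm_comp (e.symm : H →L[𝕜] H)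
  have hDK : ∀ g, D (K g) = C g := fun g => e.apply_symm_apply (C g)
  -- `D + C = D (1 + K)` with `K = D⁻¹ C` compact, so injectivity excludes `-1` as an eigenvalue of
  -- `K`.
  rcases IsCompactOperator.hasEigenvalue_or_mem_resolventSet (T := K) (μ := (-1 : 𝕜)) hK
    (neg_ne_zero.2 one_ne_zero) with h | h
  · obtain ⟨g, hg⟩ := h.exists_hasEigenvector
    have h1 : K g = (-1 : 𝕜) • g := hg.apply_eq_smul
    refine absurd (hinj g ?_) hg.2
    rw [← hDK, h1]
    simp
  · rw [spectrum.mem_resolventSet_iff, ContinuousLinearMap.isUnit_iff_bijective] at h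
    have h2 : ⇑(D + C) = (fun g => -g) ∘ D ∘ ⇑(algebraMap 𝕜 (H →L[𝕜] H) (-1) - K) := by
      ext g
      simp [hDK]
      abel
    rw [h2]
    exact (Equiv.neg H).bijective.comp (hD.comp h)

/-- The kernel of a compact perturbation of an invertible operator is finite dimensional. -/
theorem finiteDimensional_ker_add_compact {D C : H →L[𝕜] H} (hD : Function.Bijective D)
    (hC : IsCompactOperator C) : FiniteDimensional 𝕜 ((D + C).ker) := by
  let e := equivOfBijective D hD
  let K : H →L[𝕜] H := (e.symm : H →L[𝕜] H).comp C
  have hK : IsCompactOperator K := hC.clm_comp (e.symm : H →L[𝕜] H)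
  -- On the kernel `-K` is the identity, which is therefore compact there; by Riesz the kernel is
  -- finite dimensional.
  have hker : ∀ g ∈ (D + C).ker, K g = -g := fun g hg => by
    have h1 : D g + C g = 0 := hg
    apply hD.1
    have : D (K g) = C g := e.apply_symm_apply (C g)
    rw [this, map_neg]
    exact eq_neg_of_add_eq_zero_right h1
  have hmap : ∀ g ∈ (D + C).ker,
      (-K : H →L[𝕜] H).toLinearMap g ∈ (D + C).ker := fun g hg => by
    have : (-K : H →L[𝕜] H).toLinearMap g = g := by simp [hker g hg]
    rw [this]; exact hg
  have hK' : IsCompactOperator (-K : H →L[𝕜] H).toLinearMap := hK.neg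
  have hcl : IsClosed ((D + C).ker : Set H) := (D + C).isClosed_ker
  have := hK'.restrict hmap hcl
  refine FiniteDimensional.of_isCompactOperator_id (𝕜 := 𝕜) ?_
  convert! this using 1
  ext g
  simp [hker g.1 g.2]

end Hilbert

/-! ### The operators `B(z) = 1 + T*(V - 1 - z)T` -/

section
variable {𝕜 : Type*} [RCLike 𝕜]

/-- `T*VT`. -/
def potOp (𝕜 : Type*) [RCLike 𝕜] (v : ℝ →ᵇ ℝ) : L2 𝕜 →L[𝕜] L2 𝕜 :=
  (expOpAdj 𝕜).comp ((mulOp 𝕜 v).comp (expOp 𝕜))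

/-- `1 - (1 + z) T*T`. -/
def freeOp (𝕜 : Type*) [RCLike 𝕜] (z : 𝕜) : L2 𝕜 →L[𝕜] L2 𝕜 :=
  ContinuousLinearMap.id 𝕜 _ - (1 + z) • (expOpAdj 𝕜).comp (expOp 𝕜)

/-- `1 + T*(V - 1 - z)T`, which is `-∂ₓ² + V - z` conjugated by `T`. -/
def formOp (𝕜 : Type*) [RCLike 𝕜] (v : ℝ →ᵇ ℝ) (z : 𝕜) : L2 𝕜 →L[𝕜] L2 𝕜 :=
  freeOp 𝕜 z + potOp 𝕜 v

theorem formOp_apply (v : ℝ →ᵇ ℝ) (z : 𝕜) (g : L2 𝕜) :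
    formOp 𝕜 v z g = g - (1 + z) • expOpAdj 𝕜 (expOp 𝕜 g)
      + expOpAdj 𝕜 (mulOp 𝕜 v (expOp 𝕜 g)) := rfl

/-- The second form exhibits `g` as `T*` of an `L²` function, so that `T g` lies in the range of `T
T*`, that is, in `H²`. -/
theorem formOp_eq_iff (v : ℝ →ᵇ ℝ) (z : 𝕜) (g f : L2 𝕜) :
    formOp 𝕜 v z g = expOpAdj 𝕜 f ↔
      g = expOpAdj 𝕜 (f + z • expOp 𝕜 g - mulOp 𝕜 v (expOp 𝕜 g) + expOp 𝕜 g) := by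
  rw [formOp_apply, map_add, map_sub, map_add, map_smul, add_smul, one_smul]
  constructor <;> intro h
  · rw [← h]; abel
  · nth_rewrite 1 [h]; abel

theorem formOp_sub (v : ℝ →ᵇ ℝ) (z w : 𝕜) (g : L2 𝕜) :
    formOp 𝕜 v z g - formOp 𝕜 v w g = (w - z) • expOpAdj 𝕜 (expOp 𝕜 g) := by
  rw [formOp_apply, formOp_apply]; module

theorem inner_formOp_real (v : ℝ →ᵇ ℝ) (μ : ℝ) (g h : L2 𝕜) :
    ⟪formOp 𝕜 v (μ : 𝕜) g, h⟫_𝕜 = ⟪g, formOp 𝕜 v (μ : 𝕜) h⟫_𝕜 := by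
  simp only [formOp_apply, inner_add_left, inner_sub_left, inner_add_right, inner_sub_right,
    inner_smul_left, inner_smul_right, inner_expOpAdj, inner_mulOp, map_add, map_one,
    RCLike.conj_ofReal, ← inner_expOp]

theorem isCompactOperator_potOp (v : ℝ →ᵇ ℝ) (hv : MemLp v 2) :
    IsCompactOperator (potOp 𝕜 v) :=
  (isCompactOperator_mulOp_comp_expOp v hv).clm_comp (expOpAdj 𝕜)

theorem eq_zero_of_formOp_eq_zero {v : ℝ →ᵇ ℝ} {z : 𝕜} {g : L2 𝕜} (h : formOp 𝕜 v z g = 0)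
    (hT : expOp 𝕜 g = 0) : g = 0 := by
  simpa [formOp_apply, hT] using h

theorem re_inner_freeOp (z : 𝕜) (g : L2 𝕜) :
    RCLike.re ⟪freeOp 𝕜 z g, g⟫_𝕜 = ‖g‖ ^ 2 - (1 + RCLike.re z) * ‖expOp 𝕜 g‖ ^ 2 := by
  have : freeOp 𝕜 z g = g - (1 + z) • expOpAdj 𝕜 (expOp 𝕜 g) := rfl
  rw [this, inner_sub_left, inner_smul_left, inner_expOpAdj, map_sub,
    inner_self_eq_norm_sq_to_K, inner_self_eq_norm_sq_to_K]
  norm_cast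
  rw [RCLike.re_mul_ofReal]
  simp

/-- The form is `‖g‖² - (1 + Re z) ‖T g‖²`. For `Re z ≤ -1` the last term helps; otherwise `‖T‖ ≤ 1`
absorbs it and leaves `-Re z`. -/
theorem bijective_freeOp {z : 𝕜} (hz : RCLike.re z < 0) : Function.Bijective (freeOp 𝕜 z) := by
  refine bijective_of_coercive (c := min 1 (-RCLike.re z)) (lt_min one_pos (by linarith))
    fun g => ?_
  rw [re_inner_freeOp]
  have h1 : ‖expOp 𝕜 g‖ ^ 2 ≤ ‖g‖ ^ 2 := pow_le_pow_left₀ (norm_nonneg _) (norm_expOp_le g) 2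
  have h2 := sq_nonneg ‖expOp 𝕜 g‖
  rcases le_total 1 (-RCLike.re z) with h | h
  · rw [min_eq_left h]; nlinarith
  · rw [min_eq_right h]; nlinarith

end

/-- The resolvent is `T (formOp z)⁻¹ T*`. -/
theorem mem_resolventSet_of_bijective {v : ℝ →ᵇ ℝ} {z : ℂ}
    (h : Function.Bijective (formOp ℂ v z)) : z ∈ resolventSet v := by
  intro f
  obtain ⟨g, hg⟩ := h.2 (expOpAdj ℂ f)
  have key : ∀ u : L2 ℂ, SchrodingerGraph v u (f + z • u) → u = expOp ℂ g := by
    intro u hu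
    rw [schrodingerGraph_iff] at hu
    have h1 : formOp ℂ v z (expOpAdj ℂ (f + z • u - mulOp ℂ v u + u)) = expOpAdj ℂ f := by
      rw [formOp_eq_iff, ← hu]
    rw [hu, h.1 (h1.trans hg.symm)]
  refine ⟨expOp ℂ g, ?_, key⟩
  change SchrodingerGraph v (expOp ℂ g) (f + z • expOp ℂ g)
  rw [schrodingerGraph_iff, ← (formOp_eq_iff v z g f).1 hg]

/-- A negative eigenvalue of `-∂ₓ² + V` belongs to the discrete spectrum. -/
theorem mem_discreteSpectrum {v : ℝ →ᵇ ℝ} (hv : MemLp v 2) {μ : ℝ} (hμ : μ < 0)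
    {g : L2 ℂ} (hg : g ≠ 0) (hB : formOp ℂ v (μ : ℂ) g = 0) :
    (μ : ℂ) ∈ discreteSpectrum v := by
  have hC := isCompactOperator_potOp (𝕜 := ℂ) v hv
  have hgr : ∀ u : L2 ℂ, SchrodingerGraph v u ((μ : ℂ) • u) ↔
      ∃ k : L2 ℂ, formOp ℂ v μ k = 0 ∧ u = expOp ℂ k := by
    intro u
    rw [schrodingerGraph_iff]
    constructor
    · intro hu
      refine ⟨expOpAdj ℂ ((μ : ℂ) • u - mulOp ℂ v u + u), ?_, hu⟩
      have : formOp ℂ v μ (expOpAdj ℂ ((μ : ℂ) • u - mulOp ℂ v u + u)) = expOpAdj ℂ 0 := by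
        rw [formOp_eq_iff, ← hu, zero_add]
      rwa [map_zero] at this
    · rintro ⟨k, hk, rfl⟩
      have : formOp ℂ v μ k = expOpAdj ℂ 0 := by rw [hk, map_zero]
      rw [formOp_eq_iff, zero_add] at this
      rw [← this]
  have hD : Function.Bijective (freeOp ℂ (μ : ℂ)) := bijective_freeOp (by simpa using hμ)
  refine ⟨⟨expOp ℂ g, fun h0 => hg (eq_zero_of_formOp_eq_zero hB h0), (hgr _).2 ⟨g, hB, rfl⟩⟩,
    ⟨(formOp ℂ v μ).ker.map (expOp ℂ).toLinearMap, ?_, fun u hu => ?_⟩, ?_⟩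
  · have : FiniteDimensional ℂ (formOp ℂ v μ).ker := finiteDimensional_ker_add_compact hD hC
    exact Module.Finite.map _ _
  · obtain ⟨k, hk, rfl⟩ := (hgr u).1 hu
    exact ⟨k, hk, rfl⟩
  -- If `μ` were not isolated, points `w n → μ` outside the resolvent set would carry unit vectors
  -- `k n` in the kernel of `formOp (w n)`. Compactness gives a unit limit `l` in the kernel at `μ`,
  -- while symmetry makes `T l` orthogonal to every `T (k n)`, hence to itself.
  by_contra hcon
  push Not at hcon
  -- The cap `-μ` keeps `Re (w n) < 0`, where the free part is invertible; `1/(n+1)` forces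
  -- convergence.
  have hpos : ∀ n : ℕ, 0 < min (-μ) (1 / ((n : ℝ) + 1)) := fun n =>
    lt_min (by linarith) (by positivity)
  choose w hwne hwd hwr using fun n : ℕ => hcon _ (hpos n)
  have hwre : ∀ n, (w n).re < 0 := fun n => by
    have h1 := (Complex.abs_re_le_norm (w n - μ)).trans_lt
      ((dist_eq_norm (w n) (μ : ℂ) ▸ hwd n).trans_le (min_le_left _ _))
    rw [Complex.sub_re, Complex.ofReal_re] at h1
    have := (abs_lt.1 h1).2
    linarith
  have hwt : Tendsto w atTop (𝓝 (μ : ℂ)) := by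
    rw [tendsto_iff_dist_tendsto_zero]
    exact squeeze_zero (fun _ => dist_nonneg) (fun n => (hwd n).le.trans (min_le_right _ _))
      tendsto_one_div_add_atTop_nhds_zero_nat
  have hex : ∀ n, ∃ k : L2 ℂ, ‖k‖ = 1 ∧ formOp ℂ v (w n) k = 0 := fun n => by
    by_contra hno
    push Not at hno
    refine hwr n (mem_resolventSet_of_bijective ?_)
    refine bijective_add_compact (bijective_freeOp (hwre n)) hC fun k hk => ?_
    by_contra hk0
    refine hno ((‖k‖⁻¹ : ℂ) • k) ?_ ?_
    · rw [norm_smul, norm_inv, Complex.norm_real, norm_norm, inv_mul_cancel₀ (norm_ne_zero_iff.2 hk0)]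
    · rw [map_smul]
      have : formOp ℂ v (w n) k = 0 := hk
      rw [this, smul_zero]
  choose k hk1 hk2 using hex
  obtain ⟨K, hK, hKs⟩ := hC.image_closedBall_subset_compact
    (f := (potOp ℂ v : L2 ℂ →ₗ[ℂ] L2 ℂ)) 1
  obtain ⟨c, -, φ, hφ, hφc⟩ := hK.tendsto_subseq
    (fun n => hKs ⟨k n, by simp [hk1 n], rfl⟩)
  let e := equivOfBijective _ hD
  have hDk : ∀ n, freeOp ℂ (μ : ℂ) (k n) =
      (w n - μ) • expOpAdj ℂ (expOp ℂ (k n)) - potOp ℂ v (k n) := fun n => by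
    have h1 := formOp_sub v (μ : ℂ) (w n) (k n)
    rw [hk2 n, sub_zero] at h1
    rw [← h1]
    exact (add_sub_cancel_right _ _).symm
  have hzero : Tendsto (fun n => (w n - (μ : ℂ)) • expOpAdj ℂ (expOp ℂ (k n))) atTop (𝓝 0) := by
    rw [tendsto_zero_iff_norm_tendsto_zero]
    refine squeeze_zero (fun _ => norm_nonneg _) (g := fun n => ‖w n - μ‖) (fun n => ?_) ?_
    · rw [norm_smul]
      refine mul_le_of_le_one_right (norm_nonneg _) ?_
      exact (norm_expOpAdj_le _).trans ((norm_expOp_le _).trans (hk1 n).le)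
    · exact tendsto_iff_norm_sub_tendsto_zero.1 hwt
  have hlim : Tendsto (fun n => k (φ n)) atTop (𝓝 (e.symm (0 - c))) := by
    have h1 : Tendsto (fun n => freeOp ℂ (μ : ℂ) (k (φ n))) atTop (𝓝 (0 - c)) := by
      simp only [hDk]
      exact (hzero.comp hφ.tendsto_atTop).sub hφc
    have h2 := (e.symm.continuous.tendsto (0 - c)).comp h1
    refine h2.congr fun n => ?_
    exact e.symm_apply_apply (k (φ n))
  set l := e.symm (0 - c) with hl
  have hl1 : ‖l‖ = 1 := tendsto_nhds_unique hlim.norm (by simp [hk1])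
  have hBl : formOp ℂ v μ l = 0 := by
    have h1 : Tendsto (fun n => formOp ℂ v μ (k (φ n))) atTop (𝓝 (formOp ℂ v μ l)) :=
      ((formOp ℂ v μ).continuous.tendsto l).comp hlim
    refine tendsto_nhds_unique h1 ?_
    refine (hzero.comp hφ.tendsto_atTop).congr fun n => ?_
    have h2 := formOp_sub v (μ : ℂ) (w (φ n)) (k (φ n))
    rw [hk2, sub_zero] at h2
    exact h2.symm
  -- Only `μ` has to be real here: the form at `μ` is symmetric, and `w n` enters through `formOp μ
  -- (k n) = (w n - μ) T* T (k n)`.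
  have horth : ∀ n, ⟪expOp ℂ l, expOp ℂ (k (φ n))⟫_ℂ = 0 := fun n => by
    have h1 := inner_formOp_real v μ l (k (φ n))
    have h2 := formOp_sub v (μ : ℂ) (w (φ n)) (k (φ n))
    rw [hk2, sub_zero] at h2
    have h3 : formOp ℂ v ((μ : ℝ) : ℂ) l = 0 := hBl
    erw [h3, h2] at h1
    rw [inner_zero_left, inner_smul_right, ← inner_expOp] at h1
    exact (mul_eq_zero.1 h1.symm).resolve_left (sub_ne_zero.2 (hwne _))
  have h0 : ⟪expOp ℂ l, expOp ℂ l⟫_ℂ = 0 := by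
    have h1 : Tendsto (fun n => ⟪expOp ℂ l, expOp ℂ (k (φ n))⟫_ℂ) atTop
        (𝓝 ⟪expOp ℂ l, expOp ℂ l⟫_ℂ) :=
      tendsto_const_nhds.inner (((expOp ℂ).continuous.tendsto l).comp hlim)
    simp only [horth] at h1
    exact tendsto_nhds_unique h1 tendsto_const_nhds
  have := eq_zero_of_formOp_eq_zero hBl (inner_self_eq_zero.1 h0)
  rw [this, norm_zero] at hl1
  exact zero_ne_one hl1

end QuinticNLS

namespace QuinticNLS
open Set Filter
open scoped ENNReal InnerProductSpace BoundedContinuousFunction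

/-! ### Complexification -/

/-- The inclusion `L²(ℝ, ℝ) → L²(ℝ, ℂ)`. -/
def toComplexL2 (g : L2 ℝ) : L2 ℂ := (Lp.memLp g).ofReal.toLp (fun x => (g x : ℂ))

theorem coeFn_toComplexL2 (g : L2 ℝ) : toComplexL2 g =ᵐ[volume] fun x => (g x : ℂ) :=
  MemLp.coeFn_toLp _

theorem expAvg_ofReal (g : ℝ → ℝ) (x : ℝ) :
    expAvg (fun y => (g y : ℂ)) x = ((expAvg g x : ℝ) : ℂ) := by
  unfold expAvg
  have := integral_ofReal (𝕜 := ℂ) (μ := volume.restrict (Iic x))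
    (f := fun y => Real.exp (y - x) • g y)
  refine Eq.trans (integral_congr_ae (ae_of_all _ fun y => ?_)) this
  simp

theorem expAvgAdj_ofReal (g : ℝ → ℝ) (x : ℝ) :
    expAvgAdj (fun y => (g y : ℂ)) x = ((expAvgAdj g x : ℝ) : ℂ) := by
  rw [expAvgAdj_eq, expAvgAdj_eq, expAvg_ofReal]

theorem toComplexL2_expOp (g : L2 ℝ) : expOp ℂ (toComplexL2 g) = toComplexL2 (expOp ℝ g) := by
  refine Lp.ext ?_
  filter_upwards [coeFn_expOp (toComplexL2 g), coeFn_toComplexL2 (expOp ℝ g),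
    coeFn_expOp g] with x h1 h2 h3
  rw [h1, h2, h3, expAvg_congr (coeFn_toComplexL2 g), expAvg_ofReal]

theorem toComplexL2_expOpAdj (g : L2 ℝ) :
    expOpAdj ℂ (toComplexL2 g) = toComplexL2 (expOpAdj ℝ g) := by
  refine Lp.ext ?_
  filter_upwards [coeFn_expOpAdj (toComplexL2 g), coeFn_toComplexL2 (expOpAdj ℝ g),
    coeFn_expOpAdj g] with x h1 h2 h3
  rw [h1, h2, h3, expAvgAdj_congr (coeFn_toComplexL2 g), expAvgAdj_ofReal]

theorem toComplexL2_mulOp (v : ℝ →ᵇ ℝ) (g : L2 ℝ) :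
    mulOp ℂ v (toComplexL2 g) = toComplexL2 (mulOp ℝ v g) := by
  refine Lp.ext ?_
  filter_upwards [coeFn_mulOp v (toComplexL2 g), coeFn_toComplexL2 (mulOp ℝ v g),
    coeFn_mulOp v g, coeFn_toComplexL2 g] with x h1 h2 h3 h4
  rw [h1, h2, h3, h4]
  simp

theorem toComplexL2_formOp (v : ℝ →ᵇ ℝ) (μ : ℝ) (g : L2 ℝ) :
    formOp ℂ v (μ : ℂ) (toComplexL2 g) = toComplexL2 (formOp ℝ v μ g) := by
  rw [formOp_apply, formOp_apply, toComplexL2_expOp, toComplexL2_expOpAdj, toComplexL2_mulOp,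
    toComplexL2_expOpAdj]
  refine Lp.ext ?_
  set a := expOpAdj ℝ (expOp ℝ g)
  set b := expOpAdj ℝ (mulOp ℝ v (expOp ℝ g))
  filter_upwards [Lp.coeFn_add (toComplexL2 g - (1 + (μ : ℂ)) • toComplexL2 a) (toComplexL2 b),
    Lp.coeFn_sub (toComplexL2 g) ((1 + (μ : ℂ)) • toComplexL2 a),
    Lp.coeFn_smul (1 + (μ : ℂ)) (toComplexL2 a), coeFn_toComplexL2 (g - (1 + μ) • a + b),
    Lp.coeFn_add (g - (1 + μ) • a) b, Lp.coeFn_sub g ((1 + μ) • a), Lp.coeFn_smul (1 + μ) a,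
    coeFn_toComplexL2 g, coeFn_toComplexL2 a, coeFn_toComplexL2 b] with x h1 h2 h3 h4 h5 h6 h7 h8 h9 h10
  rw [h1, Pi.add_apply, h2, Pi.sub_apply, h3, Pi.smul_apply, h4, h5, Pi.add_apply, h6,
    Pi.sub_apply, h7, Pi.smul_apply, h8, h9, h10]
  simp

theorem schrodingerGraph_of_formOp_eq_zero {v : ℝ →ᵇ ℝ} {z : ℂ} {k : L2 ℂ}
    (h : formOp ℂ v z k = 0) : SchrodingerGraph v (expOp ℂ k) (z • expOp ℂ k) := by
  have : formOp ℂ v z k = expOpAdj ℂ 0 := by rw [h, map_zero]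
  rw [formOp_eq_iff, zero_add] at this
  rw [schrodingerGraph_iff, ← this]

/-! ### Bound states in terms of bounded operators -/

/-- The preimage under `T` of a classical solution in `L²`. -/
theorem exists_preimage_of_source {v : ℝ →ᵇ ℝ} {ω : ℝ} {ψ f : ℝ → ℝ} (hC : ContDiff ℝ 2 ψ)
    (hL : MemLp ψ 2) (hfc : Continuous f) (hf : MemLp f 2)
    (heq : ∀ x, -iteratedDeriv 2 ψ x + v x * ψ x + ω * ψ x = f x) :
    ∃ g : L2 ℝ, expAvg g = ψ ∧ formOp ℝ v (-ω) g = expOpAdj ℝ hf.toLp ∧ IsH2 ψ ∧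
      expOp ℝ g = hL.toLp ∧ (∫ x, ψ x ^ 2) + ∫ x, deriv ψ x ^ 2 = ‖g‖ ^ 2 := by
  have e2 : ∀ x, iteratedDeriv 2 ψ x = (v x + ω) * ψ x - f x := fun x => by
    have := heq x; linarith
  have ef : (fun x => ψ x - iteratedDeriv 2 ψ x)
      = fun x => ψ x - (v x * ψ x + ω * ψ x) + f x := by
    ext x; rw [e2]; ring
  have hvψ : MemLp (fun x => v x * ψ x) 2 := by
    refine hL.of_le_mul (c := ‖v‖) (v.continuous.aestronglyMeasurable.mul hL.1)
      (ae_of_all _ fun x => ?_)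
    rw [norm_mul]
    exact mul_le_mul_of_nonneg_right (v.norm_coe_le_norm x) (norm_nonneg _)
  have hfL : MemLp (fun x => ψ x - iteratedDeriv 2 ψ x) 2 := by
    rw [ef]; exact (hL.sub (hvψ.add (hL.const_mul ω))).add hf
  have hfc : Continuous fun x => ψ x - iteratedDeriv 2 ψ x := by
    have := hC.continuous; have := v.continuous
    rw [ef]; fun_prop
  have hrep := expAvg_expAvgAdj_of_contDiff hC hL hfL
  obtain ⟨hreg, -, hder⟩ := regularity hfc hfL
  rw [← hrep] at hreg hder
  set g : L2 ℝ := (memLp_expAvgAdj hfL).toLp with hg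
  have hψ : expAvg g = ψ := by
    rw [expAvg_congr (MemLp.coeFn_toLp _), ← hrep]
  have hT : expOp ℝ g = hL.toLp := by
    refine Lp.ext ((coeFn_expOp _).trans ?_)
    rw [hψ]; exact hL.coeFn_toLp.symm
  refine ⟨g, hψ, ?_, hreg, hT, ?_⟩
  · rw [formOp_eq_iff, hT, hg, ← expOpAdj_toLp hfL]
    congr 1
    refine Lp.ext ?_
    set p : L2 ℝ := hL.toLp
    set F : L2 ℝ := hf.toLp
    filter_upwards [hfL.coeFn_toLp, hL.coeFn_toLp, hf.coeFn_toLp,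
      Lp.coeFn_add (F + (-ω) • p - mulOp ℝ v p) p, Lp.coeFn_sub (F + (-ω) • p) (mulOp ℝ v p),
      Lp.coeFn_add F ((-ω) • p), Lp.coeFn_smul (-ω) p, coeFn_mulOp v p]
      with x h1 h2 h7 h3 h4 h8 h5 h6
    rw [h1, h3, Pi.add_apply, h4, Pi.sub_apply, h8, Pi.add_apply, h7, h5, Pi.smul_apply, h6, h2, e2]
    simp only [smul_eq_mul]; ring
  · rw [integral_sq_add_deriv (fun x => (hC.differentiable (by simp) x).hasDerivAt) hL
      hreg.memLp_deriv, ← real_inner_self_eq_norm_sq, L2.inner_def]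
    refine integral_congr_ae ?_
    filter_upwards [(memLp_expAvgAdj hfL).coeFn_toLp] with x hx
    rw [hx, hder]; simp [sq]

/-- The preimage under `T` of a bound state. -/
theorem exists_preimage {v : ℝ →ᵇ ℝ} {ω : ℝ} {ψ : ℝ → ℝ} (hC : ContDiff ℝ 2 ψ)
    (hL : MemLp ψ 2) (heq : ∀ x, -iteratedDeriv 2 ψ x + v x * ψ x + ω * ψ x = 0) :
    ∃ g : L2 ℝ, expAvg g = ψ ∧ formOp ℝ v (-ω) g = 0 ∧ IsH2 ψ ∧ expOp ℝ g = hL.toLp := by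
  obtain ⟨g, h1, h2, h3, h4, -⟩ := exists_preimage_of_source (f := 0) hC hL continuous_const
    MemLp.zero heq
  exact ⟨g, h1, by rw [h2, MemLp.toLp_zero, map_zero], h3, h4⟩

/-- Solutions of the equation for the preimage are classical solutions in `H²`. -/
theorem solves_of_formOp {v : ℝ →ᵇ ℝ} {ω : ℝ} {g : L2 ℝ} {f : ℝ → ℝ} (hfc : Continuous f)
    (hf : MemLp f 2) (h : formOp ℝ v (-ω) g = expOpAdj ℝ hf.toLp) :
    IsH2 (expAvg g) ∧
      (∀ x, -iteratedDeriv 2 (expAvg g) x + v x * expAvg g x + ω * expAvg g x = f x) ∧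
      (∫ x, expAvg g x ^ 2) + ∫ x, deriv (expAvg g) x ^ 2 = ‖g‖ ^ 2 := by
  set u := expAvg g with hu
  have huL : MemLp u 2 := memLp_expAvg (Lp.memLp g)
  have huc : Continuous u := continuous_expAvg (Lp.memLp g)
  set m : ℝ → ℝ := fun x => u x - (v x * u x + ω * u x) + f x with hm
  have hvu : MemLp (fun x => v x * u x) 2 := by
    refine huL.of_le_mul (c := ‖v‖) (v.continuous.aestronglyMeasurable.mul huL.1)
      (ae_of_all _ fun x => ?_)
    rw [norm_mul]
    exact mul_le_mul_of_nonneg_right (v.norm_coe_le_norm x) (norm_nonneg _)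
  have hmL : MemLp m 2 := (huL.sub (hvu.add (huL.const_mul ω))).add hf
  have hmc : Continuous m := by have := v.continuous; fun_prop
  rw [formOp_eq_iff] at h
  -- The equation writes `g` as `T* m` with `m` continuous and square integrable, so `u = T T* m` is
  -- a classical solution.
  have hg : g = expOpAdj ℝ hmL.toLp := by
    rw [h]
    congr 1
    refine Lp.ext ?_
    set p : L2 ℝ := expOp ℝ g with hp
    set F : L2 ℝ := hf.toLp
    filter_upwards [hmL.coeFn_toLp, coeFn_expOp g, hf.coeFn_toLp,
      Lp.coeFn_add (F + (-ω) • p - mulOp ℝ v p) p, Lp.coeFn_sub (F + (-ω) • p) (mulOp ℝ v p),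
      Lp.coeFn_add F ((-ω) • p), Lp.coeFn_smul (-ω) p, coeFn_mulOp v p]
      with x h1 h2 h7 h3 h4 h8 h5 h6
    rw [h1, h3, Pi.add_apply, h4, Pi.sub_apply, h8, Pi.add_apply, h7, h5, Pi.smul_apply, h6, hp, h2]
    simp only [hm, hu, smul_eq_mul]; ring
  have hgae : g =ᵐ[volume] expAvgAdj m := by
    rw [hg]
    refine (coeFn_expOpAdj _).trans ?_
    rw [expAvgAdj_congr hmL.coeFn_toLp]
  have hrep : u = expAvg (expAvgAdj m) := expAvg_congr hgae
  obtain ⟨r1, r2, r3⟩ := regularity hmc hmL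
  rw [← hrep] at r1 r2 r3
  refine ⟨r1, fun x => ?_, ?_⟩
  · rw [r2]; simp only [hm]; ring
  · rw [integral_sq_add_deriv (fun x => (r1.contDiff.differentiable (by simp) x).hasDerivAt) huL
      r1.memLp_deriv, ← real_inner_self_eq_norm_sq, L2.inner_def]
    refine integral_congr_ae ?_
    filter_upwards [hgae] with x hx
    rw [hx, r3]; simp [sq]

theorem NormalizedGenerator.norm_toLp {V : ℝ → ℝ} {ω : ℝ} {ψ : ℝ → ℝ}
    (h : NormalizedGenerator V ω ψ) : ‖(h.memLp.toLp : L2 ℝ)‖ = 1 := by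
  have h1 : ‖(h.memLp.toLp : L2 ℝ)‖ ^ 2 = 1 := by
    rw [← real_inner_self_eq_norm_sq, L2.inner_def, ← h.norm_one]
    refine integral_congr_ae ?_
    filter_upwards [h.memLp.coeFn_toLp] with x hx
    rw [hx]; simp [sq]
  exact (pow_eq_one_iff_of_nonneg (norm_nonneg _) two_ne_zero).1 h1

/-! ### The quadratic form on the complement of the two bound states. -/

/-- The spectral content of the hypotheses: two normalized bound states, and nonnegativity of the
quadratic form on the complement. -/
structure SpectralPair (v : ℝ →ᵇ ℝ) (ω₀ ω₁ : ℝ) (g₀ g₁ : L2 ℝ) : Prop where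
  lt : ω₁ < ω₀
  pos : 0 < ω₁
  eq₀ : formOp ℝ v (-ω₀) g₀ = 0
  eq₁ : formOp ℝ v (-ω₁) g₁ = 0
  norm₀ : ‖expOp ℝ g₀‖ = 1
  norm₁ : ‖expOp ℝ g₁‖ = 1
  nonneg : ∀ g, ⟪expOp ℝ g₀, expOp ℝ g⟫_ℝ = 0 → ⟪expOp ℝ g₁, expOp ℝ g⟫_ℝ = 0 →
    0 ≤ ⟪formOp ℝ v 0 g, g⟫_ℝ

theorem inner_formOp_symm (v : ℝ →ᵇ ℝ) (μ : ℝ) (g h : L2 ℝ) :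
    ⟪formOp ℝ v μ g, h⟫_ℝ = ⟪g, formOp ℝ v μ h⟫_ℝ := inner_formOp_real v μ g h

theorem formOp_of_eq_zero {v : ℝ →ᵇ ℝ} {z : ℝ} {g : L2 ℝ} (h : formOp ℝ v z g = 0) (w : ℝ) :
    formOp ℝ v w g = (z - w) • expOpAdj ℝ (expOp ℝ g) := by
  have := formOp_sub v w z g
  rwa [h, sub_zero] at this

theorem inner_formOp_eigen {v : ℝ →ᵇ ℝ} {z : ℝ} {g : L2 ℝ} (h : formOp ℝ v z g = 0) (w : ℝ)
    (k : L2 ℝ) : ⟪formOp ℝ v w k, g⟫_ℝ = (z - w) * ⟪expOp ℝ g, expOp ℝ k⟫_ℝ := by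
  rw [inner_formOp_symm, formOp_of_eq_zero h, inner_smul_right, ← inner_expOp, real_inner_comm]

theorem inner_eigen_eq_zero {v : ℝ →ᵇ ℝ} {z w : ℝ} (hzw : z ≠ w) {g k : L2 ℝ}
    (hg : formOp ℝ v z g = 0) (hk : formOp ℝ v w k = 0) : ⟪expOp ℝ g, expOp ℝ k⟫_ℝ = 0 := by
  have := inner_formOp_eigen hg w k
  rw [hk, inner_zero_left] at this
  exact (mul_eq_zero.1 this.symm).resolve_left (sub_ne_zero.2 hzw)

theorem inner_formOp_self (v : ℝ →ᵇ ℝ) (z : ℝ) (g : L2 ℝ) :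
    ⟪formOp ℝ v z g, g⟫_ℝ = ⟪formOp ℝ v 0 g, g⟫_ℝ - z * ‖expOp ℝ g‖ ^ 2 := by
  have h := formOp_sub v z 0 g
  have : formOp ℝ v z g = formOp ℝ v 0 g + (0 - z) • expOpAdj ℝ (expOp ℝ g) := by
    rw [← h]; abel
  rw [this, inner_add_left, inner_smul_left, inner_expOpAdj, real_inner_self_eq_norm_sq]
  simp; ring

theorem formOp_zero_lower (v : ℝ →ᵇ ℝ) (g : L2 ℝ) :
    ‖g‖ ^ 2 - (‖v‖ + 1) * ‖expOp ℝ g‖ ^ 2 ≤ ⟪formOp ℝ v 0 g, g⟫_ℝ := by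
  rw [formOp_apply, inner_add_left, inner_sub_left, inner_smul_left, inner_expOpAdj,
    inner_expOpAdj, real_inner_self_eq_norm_sq, real_inner_self_eq_norm_sq]
  have h1 : |⟪mulOp ℝ v (expOp ℝ g), expOp ℝ g⟫_ℝ| ≤ ‖v‖ * ‖expOp ℝ g‖ ^ 2 := by
    refine (abs_real_inner_le_norm _ _).trans ?_
    rw [sq, ← mul_assoc]
    exact mul_le_mul_of_nonneg_right (((mulOp ℝ v).le_opNorm _).trans
      (mul_le_mul_of_nonneg_right (norm_mulOp_le v) (norm_nonneg _))) (norm_nonneg _)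
  have := (abs_le.1 h1).1
  simp only [add_zero, conj_trivial, one_mul]
  linarith

/-- The rank one operator `g ↦ ⟨Ψ, Tg⟩ T*Ψ`. -/
def rankOne (ψ : L2 ℝ) : L2 ℝ →L[ℝ] L2 ℝ :=
  (innerSL ℝ (expOpAdj ℝ ψ)).smulRight (expOpAdj ℝ ψ)

theorem rankOne_apply (ψ g : L2 ℝ) : rankOne ψ g = ⟪ψ, expOp ℝ g⟫_ℝ • expOpAdj ℝ ψ := by
  simp [rankOne, inner_expOpAdj]

theorem inner_rankOne (ψ g h : L2 ℝ) :
    ⟪rankOne ψ g, h⟫_ℝ = ⟪ψ, expOp ℝ g⟫_ℝ * ⟪ψ, expOp ℝ h⟫_ℝ := by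
  rw [rankOne_apply, inner_smul_left, inner_expOpAdj]; simp

theorem isCompactOperator_rankOne (ψ : L2 ℝ) : IsCompactOperator (rankOne ψ) := by
  have : rankOne ψ = (ContinuousLinearMap.toSpanSingleton ℝ (expOpAdj ℝ ψ)).comp
      (innerSL ℝ (expOpAdj ℝ ψ)) := by
    ext1 g; simp [rankOne]
  rw [this]
  exact (isCompactOperator_of_locallyCompactSpace_rng
    (ContinuousLinearMap.toSpanSingleton ℝ (expOpAdj ℝ ψ))).comp_clm _

/-- A bijective nonnegative symmetric operator is coercive. -/
theorem exists_coercive_of_bijective {H : Type*} [NormedAddCommGroup H] [InnerProductSpace ℝ H]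
    [CompleteSpace H] {A : H →L[ℝ] H} (hs : ∀ g h, ⟪A g, h⟫_ℝ = ⟪g, A h⟫_ℝ)
    (hp : ∀ g, 0 ≤ ⟪A g, g⟫_ℝ) (hb : Function.Bijective A) :
    ∃ c > 0, ∀ g, c * ‖g‖ ^ 2 ≤ ⟪A g, g⟫_ℝ := by
  let e := equivOfBijective A hb
  set M := ‖(e.symm : H →L[ℝ] H)‖ + 1 with hM
  have hM0 : 0 < M := by positivity
  have hinv : ∀ g, ‖g‖ ≤ M * ‖A g‖ := fun g => by
    have h1 := (e.symm : H →L[ℝ] H).le_opNorm (A g)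
    have h2 : (e.symm : H →L[ℝ] H) (A g) = g := e.symm_apply_apply g
    rw [h2] at h1
    refine h1.trans (mul_le_mul_of_nonneg_right (by linarith) (norm_nonneg _))
  set t := (‖A‖ + 1)⁻¹ with ht
  have ht0 : 0 < t := by positivity
  have htA : t * ‖A‖ ≤ 1 := by
    rw [ht, inv_mul_le_one₀ (by positivity)]; linarith
  refine ⟨t / M ^ 2, by positivity, fun g => ?_⟩
  -- Positivity at `g - t A g` reads `⟪A g, g⟫ - 2 t ‖A g‖² + t² ⟪A² g, A g⟫ ≥ 0`. Since `t ‖A‖ ≤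
  -- 1`, this yields `⟪A g, g⟫ ≥ t ‖A g‖²`.
  have h1 := hp (g - t • A g)
  rw [map_sub, map_smul, inner_sub_left, inner_sub_right, inner_sub_right, inner_smul_left,
    inner_smul_left, inner_smul_right, inner_smul_right, hs (A g) g] at h1
  simp only [conj_trivial, real_inner_self_eq_norm_sq] at h1
  have h2 : ⟪A (A g), A g⟫_ℝ ≤ ‖A‖ * ‖A g‖ ^ 2 := by
    refine (real_inner_le_norm _ _).trans ?_
    rw [sq, ← mul_assoc]
    exact mul_le_mul_of_nonneg_right (A.le_opNorm _) (norm_nonneg _)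
  have h3 : t * (t * ⟪A (A g), A g⟫_ℝ) ≤ t * ‖A g‖ ^ 2 := by
    refine mul_le_mul_of_nonneg_left ?_ ht0.le
    calc t * ⟪A (A g), A g⟫_ℝ ≤ t * (‖A‖ * ‖A g‖ ^ 2) := mul_le_mul_of_nonneg_left h2 ht0.le
      _ = (t * ‖A‖) * ‖A g‖ ^ 2 := by ring
      _ ≤ ‖A g‖ ^ 2 := mul_le_of_le_one_left (sq_nonneg _) htA
  have h4 : ‖g‖ ^ 2 ≤ M ^ 2 * ‖A g‖ ^ 2 := by
    rw [← mul_pow]; exact pow_le_pow_left₀ (norm_nonneg _) (hinv g) 2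
  have h5 : t / M ^ 2 * ‖g‖ ^ 2 ≤ t * ‖A g‖ ^ 2 := by
    rw [div_mul_eq_mul_div, div_le_iff₀ (by positivity)]
    calc t * ‖g‖ ^ 2 ≤ t * (M ^ 2 * ‖A g‖ ^ 2) := mul_le_mul_of_nonneg_left h4 ht0.le
      _ = _ := by ring
  linarith

/-- If the quadratic form takes a negative value on the complement of two bound states, there is
a further bound state in this complement. -/
theorem exists_eigen_of_neg {v : ℝ →ᵇ ℝ} (hv : MemLp v 2) {ω₀ ω₁ : ℝ} (hlt : ω₁ < ω₀)
    (hpos : 0 < ω₀) {g₀ g₁ : L2 ℝ} (eq₀ : formOp ℝ v (-ω₀) g₀ = 0) (eq₁ : formOp ℝ v (-ω₁) g₁ = 0)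
    (norm₀ : ‖expOp ℝ g₀‖ = 1) (norm₁ : ‖expOp ℝ g₁‖ = 1) {k : L2 ℝ}
    (hk₀ : ⟪expOp ℝ g₀, expOp ℝ k⟫_ℝ = 0) (hk₁ : ⟪expOp ℝ g₁, expOp ℝ k⟫_ℝ = 0)
    (hneg : ⟪formOp ℝ v 0 k, k⟫_ℝ < 0) :
    ∃ μ < 0, ∃ g : L2 ℝ, g ≠ 0 ∧ formOp ℝ v μ g = 0 ∧ ⟪expOp ℝ g₀, expOp ℝ g⟫_ℝ = 0 ∧
      ⟪expOp ℝ g₁, expOp ℝ g⟫_ℝ = 0 := by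
  set ψ₀ := expOp ℝ g₀
  set ψ₁ := expOp ℝ g₁
  -- The penalty `ω₀` lifts the eigenvalues `-ω₀` and `-ω₁` to `0` and `ω₀ - ω₁`, so negative
  -- spectrum of the penalised operator can come only from the complement.
  let A : ℝ → L2 ℝ →L[ℝ] L2 ℝ := fun z =>
    freeOp ℝ z + (potOp ℝ v + ω₀ • (rankOne ψ₀ + rankOne ψ₁))
  have hA : ∀ z g, A z g = formOp ℝ v z g + ω₀ • (rankOne ψ₀ g + rankOne ψ₁ g) := fun z g => by
    change freeOp ℝ z g + (potOp ℝ v g + ω₀ • (rankOne ψ₀ g + rankOne ψ₁ g))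
      = (freeOp ℝ z g + potOp ℝ v g) + _
    rw [add_assoc]
  have hAi : ∀ z g h, ⟪A z g, h⟫_ℝ = ⟪formOp ℝ v z g, h⟫_ℝ +
      ω₀ * (⟪ψ₀, expOp ℝ g⟫_ℝ * ⟪ψ₀, expOp ℝ h⟫_ℝ + ⟪ψ₁, expOp ℝ g⟫_ℝ * ⟪ψ₁, expOp ℝ h⟫_ℝ) :=
    fun z g h => by
      rw [hA, inner_add_left, inner_smul_left, inner_add_left, inner_rankOne, inner_rankOne]
      simp
  have hAq : ∀ z w g, ⟪A z g, g⟫_ℝ = ⟪A w g, g⟫_ℝ + (w - z) * ‖expOp ℝ g‖ ^ 2 := fun z w g => by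
    rw [hAi, hAi, inner_formOp_self, inner_formOp_self v w]; ring
  have hk0 : 0 < ‖expOp ℝ k‖ ^ 2 := by
    by_contra hcon
    have h0 : ‖expOp ℝ k‖ ^ 2 = 0 := le_antisymm (not_lt.1 hcon) (sq_nonneg _)
    have := formOp_zero_lower v k
    rw [h0] at this
    nlinarith [sq_nonneg ‖k‖]
  -- The supremum of `Λ` is the bottom of the penalised form. `Λ` contains `-(‖v‖ + 1)` and is
  -- bounded above by the Rayleigh quotient of `k`, which is negative.
  set Λ : Set ℝ := {z | ∀ g, 0 ≤ ⟪A z g, g⟫_ℝ} with hΛ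
  have hne : (-(‖v‖ + 1)) ∈ Λ := fun g => by
    rw [hAi, inner_formOp_self]
    have := formOp_zero_lower v g
    have h1 : 0 ≤ ω₀ * (⟪ψ₀, expOp ℝ g⟫_ℝ * ⟪ψ₀, expOp ℝ g⟫_ℝ
      + ⟪ψ₁, expOp ℝ g⟫_ℝ * ⟪ψ₁, expOp ℝ g⟫_ℝ) :=
      mul_nonneg hpos.le (add_nonneg (mul_self_nonneg _) (mul_self_nonneg _))
    nlinarith [sq_nonneg ‖g‖]
  have hub : ∀ z ∈ Λ, z ≤ ⟪formOp ℝ v 0 k, k⟫_ℝ / ‖expOp ℝ k‖ ^ 2 := fun z hz => by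
    have := hz k
    rw [hAi, inner_formOp_self, hk₀, hk₁] at this
    rw [le_div_iff₀ hk0]
    linarith
  set μ := sSup Λ with hμ
  have hbdd : BddAbove Λ := ⟨_, hub⟩
  have hμneg : μ < 0 :=
    (csSup_le ⟨_, hne⟩ hub).trans_lt (div_neg_of_neg_of_pos hneg hk0)
  have hμΛ : μ ∈ Λ := fun g => by
    by_contra hcon
    push Not at hcon
    have hp : 0 < -⟪A μ g, g⟫_ℝ / (‖expOp ℝ g‖ ^ 2 + 1) := by
      apply div_pos (by linarith) (by positivity)
    obtain ⟨z, hz, hzμ⟩ := exists_lt_of_lt_csSup ⟨_, hne⟩ (sub_lt_self μ hp)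
    have h1 := hz g
    rw [hAq z μ g] at h1
    have h2 : μ - z < -⟪A μ g, g⟫_ℝ / (‖expOp ℝ g‖ ^ 2 + 1) := by linarith
    rw [lt_div_iff₀ (by positivity)] at h2
    have h3 : 0 ≤ μ - z := sub_nonneg.2 (le_csSup hbdd hz)
    nlinarith
  have hsymm : ∀ g h, ⟪A μ g, h⟫_ℝ = ⟪g, A μ h⟫_ℝ := fun g h => by
    rw [real_inner_comm (A μ h) g, hAi μ g h, hAi μ h g, inner_formOp_symm v μ h g,
      real_inner_comm (formOp ℝ v μ g) h]; ring
  -- If `A μ` were injective it would be bijective by the Fredholm alternative, hence coercive, and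
  -- `Λ` would extend beyond its supremum `μ`.
  have hnotinj : ∃ g, g ≠ 0 ∧ A μ g = 0 := by
    by_contra hno
    push Not at hno
    have hbij : Function.Bijective (A μ) := by
      refine bijective_add_compact (bijective_freeOp (by simpa using hμneg))
        ((isCompactOperator_potOp v hv).add
          (((isCompactOperator_rankOne ψ₀).add (isCompactOperator_rankOne ψ₁)).smul ω₀))
        fun g hg => ?_
      by_contra hg0
      exact hno g hg0 hg
    obtain ⟨c, hc, hco⟩ := exists_coercive_of_bijective hsymm hμΛ hbij
    have : μ + c ∈ Λ := fun g => by
      rw [hAq (μ + c) μ g]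
      have h1 := hco g
      have h2 : ‖expOp ℝ g‖ ^ 2 ≤ ‖g‖ ^ 2 := pow_le_pow_left₀ (norm_nonneg _) (norm_expOp_le g) 2
      nlinarith
    have := le_csSup hbdd this
    linarith
  obtain ⟨g, hg0, hg⟩ := hnotinj
  have h01 : ⟪ψ₀, ψ₁⟫_ℝ = 0 := inner_eigen_eq_zero (by simpa using hlt.ne') eq₀ eq₁
  have h10 : ⟪ψ₁, ψ₀⟫_ℝ = 0 := by rw [real_inner_comm]; exact h01
  -- Pairing `A μ g = 0` with `g₀` leaves the coefficient `-ω₀ - μ + ω₀ = -μ ≠ 0`; with `g₁` it is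
  -- `ω₀ - ω₁ - μ`, also positive.
  have o0 : ⟪ψ₀, expOp ℝ g⟫_ℝ = 0 := by
    have h := hAi μ g g₀
    rw [hg, inner_zero_left, inner_formOp_eigen eq₀] at h
    change 0 = _ + ω₀ * (_ * ⟪ψ₀, ψ₀⟫_ℝ + _ * ⟪ψ₁, ψ₀⟫_ℝ) at h
    rw [h10, real_inner_self_eq_norm_sq, norm₀] at h
    have h' : (-μ) * ⟪ψ₀, expOp ℝ g⟫_ℝ = 0 := by linear_combination -h
    exact (mul_eq_zero.1 h').resolve_left (by linarith)
  have o1 : ⟪ψ₁, expOp ℝ g⟫_ℝ = 0 := by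
    have h := hAi μ g g₁
    rw [hg, inner_zero_left, inner_formOp_eigen eq₁] at h
    change 0 = _ + ω₀ * (_ * ⟪ψ₀, ψ₁⟫_ℝ + _ * ⟪ψ₁, ψ₁⟫_ℝ) at h
    rw [h01, real_inner_self_eq_norm_sq, norm₁] at h
    have h' : (ω₀ - ω₁ - μ) * ⟪ψ₁, expOp ℝ g⟫_ℝ = 0 := by linear_combination -h
    exact (mul_eq_zero.1 h').resolve_left (by linarith)
  refine ⟨μ, hμneg, g, hg0, ?_, o0, o1⟩
  have := hA μ g
  rw [hg, rankOne_apply, rankOne_apply, o0, o1] at this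
  simpa using this.symm

theorem NormalizedGenerator.ae_eq_of_eigen {v : ℝ →ᵇ ℝ} {ω : ℝ} {ψ : ℝ → ℝ}
    (h : NormalizedGenerator v ω ψ) {g : L2 ℝ} (hg : formOp ℝ v (-ω) g = 0) :
    ∃ c : ℝ, expOp ℝ g =ᵐ[volume] fun x => c * ψ x := by
  have hc : formOp ℂ v ((-ω : ℝ) : ℂ) (toComplexL2 g) = 0 := by
    rw [toComplexL2_formOp, hg]
    refine Lp.ext ((coeFn_toComplexL2 0).trans ?_)
    filter_upwards [Lp.coeFn_zero ℝ 2 volume, Lp.coeFn_zero ℂ 2 volume] with x h1 h2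
    rw [h1, h2]; simp
  obtain ⟨c, hcψ⟩ := h.generates _ (schrodingerGraph_of_formOp_eq_zero hc)
  refine ⟨c.re, ?_⟩
  rw [toComplexL2_expOp] at hcψ
  filter_upwards [hcψ, coeFn_toComplexL2 (expOp ℝ g)] with x h1 h2
  rw [h2] at h1
  simpa using congrArg Complex.re h1

theorem NormalizedGenerator.eq_zero_of_eigen {v : ℝ →ᵇ ℝ} {ω : ℝ} {ψ : ℝ → ℝ}
    (h : NormalizedGenerator v ω ψ) {g₀ g : L2 ℝ} (hψ : expAvg g₀ = ψ)
    (hg : formOp ℝ v (-ω) g = 0) (ho : ⟪expOp ℝ g₀, expOp ℝ g⟫_ℝ = 0) : g = 0 := by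
  obtain ⟨c, hre⟩ := h.ae_eq_of_eigen hg
  have hc0 : c = 0 := by
    rw [L2.inner_def] at ho
    rw [← ho, ← mul_one c, ← h.norm_one, ← integral_const_mul]
    refine integral_congr_ae ?_
    filter_upwards [hre, coeFn_expOp g₀] with x h1 h2
    rw [h1, h2, hψ]
    simp; ring
  refine eq_zero_of_formOp_eq_zero hg (Lp.ext (hre.trans ?_))
  filter_upwards [Lp.coeFn_zero ℝ 2 volume] with x h1
  rw [hc0, h1]; simp

/-- The hypotheses on the discrete spectrum provide a `SpectralPair`. -/
theorem spectralPair_of_hyp {v : ℝ →ᵇ ℝ} (hv : MemLp v 2) {ω₀ ω₁ : ℝ} {ψ₀ ψ₁ : ℝ → ℝ}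
    (hT : TwoBoundStates v ω₀ ω₁) (h₀ : NormalizedGenerator v ω₀ ψ₀)
    (h₁ : NormalizedGenerator v ω₁ ψ₁) (hpos : 0 < ω₁) {g₀ g₁ : L2 ℝ}
    (e₀ : expAvg g₀ = ψ₀) (e₁ : expAvg g₁ = ψ₁) (eq₀ : formOp ℝ v (-ω₀) g₀ = 0)
    (eq₁ : formOp ℝ v (-ω₁) g₁ = 0) (n₀ : ‖expOp ℝ g₀‖ = 1) (n₁ : ‖expOp ℝ g₁‖ = 1) :
    SpectralPair v ω₀ ω₁ g₀ g₁ := by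
  refine ⟨hT.lt, hpos, eq₀, eq₁, n₀, n₁, fun k hk₀ hk₁ => ?_⟩
  by_contra hneg
  push Not at hneg
  obtain ⟨μ, hμ, g, hg0, hg, ho₀, ho₁⟩ :=
    exists_eigen_of_neg hv hT.lt (hpos.trans hT.lt) eq₀ eq₁ n₀ n₁ hk₀ hk₁ hneg
  have hgc : toComplexL2 g ≠ 0 := fun h => hg0 (by
    refine Lp.ext ?_
    have h' := coeFn_toComplexL2 g
    rw [h] at h'
    filter_upwards [h', Lp.coeFn_zero ℝ 2 volume, Lp.coeFn_zero ℂ 2 volume] with x h1 h2 h3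
    rw [h2]; rw [h3] at h1
    have := h1.symm
    simpa using this)
  have hB : formOp ℂ v (μ : ℂ) (toComplexL2 g) = 0 := by
    rw [toComplexL2_formOp, hg]
    refine Lp.ext ((coeFn_toComplexL2 0).trans ?_)
    filter_upwards [Lp.coeFn_zero ℝ 2 volume, Lp.coeFn_zero ℂ 2 volume] with x h1 h2
    rw [h1, h2]; simp
  -- The new eigenvalue has to be `-ω₀` or `-ω₁`. These are simple, while the new eigenvector is
  -- orthogonal to both generators.
  have hmem := mem_discreteSpectrum hv hμ hgc hB
  rw [hT.spec] at hmem
  rcases hmem with h | h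
  · have : μ = -ω₀ := by exact_mod_cast h
    exact hg0 (h₀.eq_zero_of_eigen e₀ (this ▸ hg) ho₀)
  · have : μ = -ω₁ := by exact_mod_cast Set.mem_singleton_iff.1 h
    exact hg0 (h₁.eq_zero_of_eigen e₁ (this ▸ hg) ho₁)

/-! ### Uniform coercivity. -/

namespace SpectralPair
variable {v : ℝ →ᵇ ℝ} {ω₀ ω₁ : ℝ} {g₀ g₁ : L2 ℝ}

theorem orth (S : SpectralPair v ω₀ ω₁ g₀ g₁) : ⟪expOp ℝ g₀, expOp ℝ g₁⟫_ℝ = 0 :=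
  inner_eigen_eq_zero (by simpa using S.lt.ne') S.eq₀ S.eq₁

/-- Nonnegativity applied to `g` minus its components along `g₀` and `g₁`; the form has no cross
terms in this decomposition. -/
theorem quad_lower (S : SpectralPair v ω₀ ω₁ g₀ g₁) (g : L2 ℝ) :
    -(ω₀ * ⟪expOp ℝ g₀, expOp ℝ g⟫_ℝ ^ 2 + ω₁ * ⟪expOp ℝ g₁, expOp ℝ g⟫_ℝ ^ 2)
      ≤ ⟪formOp ℝ v 0 g, g⟫_ℝ := by
  set c₀ := ⟪expOp ℝ g₀, expOp ℝ g⟫_ℝ with hc₀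
  set c₁ := ⟪expOp ℝ g₁, expOp ℝ g⟫_ℝ with hc₁
  have h01 := S.orth
  have h10 : ⟪expOp ℝ g₁, expOp ℝ g₀⟫_ℝ = 0 := by rw [real_inner_comm]; exact h01
  have h00 : ⟪expOp ℝ g₀, expOp ℝ g₀⟫_ℝ = 1 := by rw [real_inner_self_eq_norm_sq, S.norm₀]; norm_num
  have h11 : ⟪expOp ℝ g₁, expOp ℝ g₁⟫_ℝ = 1 := by rw [real_inner_self_eq_norm_sq, S.norm₁]; norm_num
  have hw := S.nonneg (g - c₀ • g₀ - c₁ • g₁)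
    (by simp only [map_sub, map_smul, inner_sub_right, inner_smul_right, h00, h01, ← hc₀]; ring)
    (by simp only [map_sub, map_smul, inner_sub_right, inner_smul_right, h11, h10, ← hc₁]; ring)
  have k0 : ∀ k, ⟪formOp ℝ v 0 k, g₀⟫_ℝ = -ω₀ * ⟪expOp ℝ g₀, expOp ℝ k⟫_ℝ := fun k => by
    rw [inner_formOp_eigen S.eq₀, sub_zero]
  have k1 : ∀ k, ⟪formOp ℝ v 0 k, g₁⟫_ℝ = -ω₁ * ⟪expOp ℝ g₁, expOp ℝ k⟫_ℝ := fun k => by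
    rw [inner_formOp_eigen S.eq₁, sub_zero]
  have s0 : ⟪formOp ℝ v 0 g₀, g⟫_ℝ = ⟪formOp ℝ v 0 g, g₀⟫_ℝ := by
    rw [inner_formOp_symm, real_inner_comm]
  have s1 : ⟪formOp ℝ v 0 g₁, g⟫_ℝ = ⟪formOp ℝ v 0 g, g₁⟫_ℝ := by
    rw [inner_formOp_symm, real_inner_comm]
  simp only [map_sub, map_smul, inner_sub_left, inner_sub_right, inner_smul_left, inner_smul_right,
    s0, s1, k0, k1, h00, h01, h10, h11, ← hc₀, ← hc₁, conj_trivial] at hw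
  nlinarith

theorem bessel (S : SpectralPair v ω₀ ω₁ g₀ g₁) (u : L2 ℝ) :
    ⟪expOp ℝ g₀, u⟫_ℝ ^ 2 + ⟪expOp ℝ g₁, u⟫_ℝ ^ 2 ≤ ‖u‖ ^ 2 := by
  set c₀ := ⟪expOp ℝ g₀, u⟫_ℝ with hc₀
  set c₁ := ⟪expOp ℝ g₁, u⟫_ℝ with hc₁
  have h01 := S.orth
  have h10 : ⟪expOp ℝ g₁, expOp ℝ g₀⟫_ℝ = 0 := by rw [real_inner_comm]; exact h01
  have h00 : ⟪expOp ℝ g₀, expOp ℝ g₀⟫_ℝ = 1 := by rw [real_inner_self_eq_norm_sq, S.norm₀]; norm_num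
  have h11 : ⟪expOp ℝ g₁, expOp ℝ g₁⟫_ℝ = 1 := by rw [real_inner_self_eq_norm_sq, S.norm₁]; norm_num
  have s0 : ⟪u, expOp ℝ g₀⟫_ℝ = c₀ := real_inner_comm _ _
  have s1 : ⟪u, expOp ℝ g₁⟫_ℝ = c₁ := real_inner_comm _ _
  have h := real_inner_self_nonneg (x := u - c₀ • expOp ℝ g₀ - c₁ • expOp ℝ g₁)
  simp only [inner_sub_left, inner_sub_right, inner_smul_left, inner_smul_right, h00, h01, h10,
    h11, s0, s1, ← hc₀, ← hc₁, conj_trivial, real_inner_self_eq_norm_sq] at h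
  nlinarith

/-- The form at an eigenvector is `-ω < 0`, so its lower bound controls `‖g‖`. This bounds the
eigenfunctions in `H¹` in terms of `‖v‖` alone, as uniform constants require. -/
theorem norm_sq_le (S : SpectralPair v ω₀ ω₁ g₀ g₁) :
    ‖g₀‖ ^ 2 ≤ ‖v‖ + 1 ∧ ‖g₁‖ ^ 2 ≤ ‖v‖ + 1 := by
  have key : ∀ ω > 0, ∀ g : L2 ℝ, formOp ℝ v (-ω) g = 0 → ‖expOp ℝ g‖ = 1 →
      ‖g‖ ^ 2 ≤ ‖v‖ + 1 := fun ω hω g hg hn => by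
    have h1 := inner_formOp_self v (-ω) g
    have h2 := formOp_zero_lower v g
    rw [hg, inner_zero_left, hn] at h1
    rw [hn] at h2
    linarith
  exact ⟨key _ (S.pos.trans S.lt) _ S.eq₀ S.norm₀, key _ S.pos _ S.eq₁ S.norm₁⟩

/-- The coercive operator `B(-ω₀) + Σ T*Ψⱼ ⊗ T*Ψⱼ`. -/
def _root_.QuinticNLS.augOp (v : ℝ →ᵇ ℝ) (ω₀ : ℝ) (g₀ g₁ : L2 ℝ) : L2 ℝ →L[ℝ] L2 ℝ :=
  formOp ℝ v (-ω₀) + (rankOne (expOp ℝ g₀) + rankOne (expOp ℝ g₁))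

/-- Uniform coercivity. -/
theorem coercive (S : SpectralPair v ω₀ ω₁ g₀ g₁) {K κ : ℝ} (hK : ‖v‖ ≤ K) (hκ : 0 < κ)
    (hω : κ ≤ ω₁) (g : L2 ℝ) :
    min 1 κ / (min 1 κ + K + 1) * ‖g‖ ^ 2 ≤ ⟪augOp v ω₀ g₀ g₁ g, g⟫_ℝ := by
  set m := min 1 κ with hm
  have hm0 : 0 < m := lt_min one_pos hκ
  have hm1 : m ≤ 1 := min_le_left _ _
  have hmκ : m ≤ κ := min_le_right _ _
  have hK0 : 0 ≤ K := (norm_nonneg _).trans hK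
  have e : ⟪augOp v ω₀ g₀ g₁ g, g⟫_ℝ = ⟪formOp ℝ v 0 g, g⟫_ℝ + ω₀ * ‖expOp ℝ g‖ ^ 2
      + ⟪expOp ℝ g₀, expOp ℝ g⟫_ℝ ^ 2 + ⟪expOp ℝ g₁, expOp ℝ g⟫_ℝ ^ 2 := by
    have : augOp v ω₀ g₀ g₁ g = formOp ℝ v (-ω₀) g
      + (rankOne (expOp ℝ g₀) g + rankOne (expOp ℝ g₁) g) := rfl
    rw [this, inner_add_left, inner_add_left, inner_rankOne, inner_rankOne, inner_formOp_self]
    ring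
  have h1 := S.quad_lower g
  have h2 := S.bessel (expOp ℝ g)
  have h3 := formOp_zero_lower v g
  set q := ⟪formOp ℝ v 0 g, g⟫_ℝ
  set u2 := ‖expOp ℝ g‖ ^ 2
  have hu2 : 0 ≤ u2 := sq_nonneg _
  set a := ⟪expOp ℝ g₀, expOp ℝ g⟫_ℝ ^ 2
  set b := ⟪expOp ℝ g₁, expOp ℝ g⟫_ℝ ^ 2
  have ha : 0 ≤ a := sq_nonneg _
  have hb : 0 ≤ b := sq_nonneg _
  have hlt := S.lt
  rw [e, div_mul_eq_mul_div, div_le_iff₀ (by positivity)]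
  -- Bessel's inequality times `ω₀ - m` handles the complement; the rank one terms pay for the
  -- components along the two bound states.
  have t1 : m * u2 ≤ q + ω₀ * u2 + a + b := by
    nlinarith [mul_nonneg (sub_nonneg.2 h2) (by linarith : 0 ≤ ω₀ - m),
      mul_nonneg hb (by linarith : 0 ≤ ω₀ - ω₁), mul_nonneg ha (sub_nonneg.2 hm1),
      mul_nonneg hb (sub_nonneg.2 hm1)]
  have t2 : ‖g‖ ^ 2 ≤ q + ω₀ * u2 + a + b + (K + 1) * u2 := by
    nlinarith [mul_nonneg hu2 (sub_nonneg.2 hK), mul_nonneg hu2 (by linarith [S.pos] : 0 ≤ ω₀)]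
  -- `K + 1` times `t1` plus `m` times `t2` eliminates `‖T g‖²`; the constant `m / (m + K + 1)`
  -- arises here.
  nlinarith [mul_le_mul_of_nonneg_left t1 (by linarith : 0 ≤ K + 1),
    mul_le_mul_of_nonneg_left t2 hm0.le]

end SpectralPair

end QuinticNLS

namespace QuinticNLS
open Set Filter
open scoped ENNReal InnerProductSpace BoundedContinuousFunction

/-! ### Parity of the bound states -/

/-- Uniqueness for the first-order system of `(ψ, ψ')`, which is globally Lipschitz because `v` is
bounded. -/
theorem eq_zero_of_initial {v : ℝ →ᵇ ℝ} {ω a : ℝ} {ψ : ℝ → ℝ} (hC : ContDiff ℝ 2 ψ)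
    (heq : ∀ x, -iteratedDeriv 2 ψ x + v x * ψ x + ω * ψ x = 0) (h0 : ψ a = 0)
    (h1 : deriv ψ a = 0) : ψ = 0 := by
  obtain ⟨d1, d2, -, -⟩ := hasDerivAt_deriv_of_contDiff_two hC
  have key := ODE_solution_unique_univ (t₀ := a) (s := fun _ => univ)
    (v := fun t (p : ℝ × ℝ) => (p.2, (v t + ω) * p.1))
    (K := (1 + ‖v‖ + |ω|).toNNReal) (f := fun t => (ψ t, deriv ψ t)) (g := fun _ => (0, 0))
    (fun t => by
      refine LipschitzOnWith.of_dist_le_mul fun p _ q _ => ?_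
      have hK : ((1 + ‖v‖ + |ω|).toNNReal : ℝ) = 1 + ‖v‖ + |ω| :=
        Real.coe_toNNReal _ (by positivity)
      rw [hK, dist_eq_norm, dist_eq_norm]
      have hp1 : ‖(p - q).1‖ ≤ ‖p - q‖ := norm_fst_le _
      have hp2 : ‖(p - q).2‖ ≤ ‖p - q‖ := norm_snd_le _
      have hv : |v t + ω| ≤ ‖v‖ + |ω| :=
        (abs_add_le _ _).trans (add_le_add (v.norm_coe_le_norm t) le_rfl)
      refine norm_prod_le_iff.2 ⟨?_, ?_⟩
      · refine hp2.trans ?_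
        have := norm_nonneg (p - q); nlinarith [norm_nonneg v, abs_nonneg ω]
      · have : ((p.2, (v t + ω) * p.1) - (q.2, (v t + ω) * q.1) : ℝ × ℝ).2
            = (v t + ω) * (p - q).1 := by simp; ring
        rw [this, norm_mul, Real.norm_eq_abs]
        exact mul_le_mul (hv.trans (by linarith)) hp1 (norm_nonneg _) (by positivity))
    (fun t => ⟨by
      have := heq t
      have h2 : iteratedDeriv 2 ψ t = (v t + ω) * ψ t := by linarith
      have := (d1 t).prodMk (d2 t)
      rw [h2] at this; exact this, mem_univ _⟩)
    (fun t => ⟨by simp only [mul_zero]; exact hasDerivAt_const t (0 : ℝ × ℝ), mem_univ _⟩)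
    (by simp [h0, h1])
  funext x
  exact congrArg Prod.fst (congrFun key x)

theorem integral_eq_zero_of_odd {f : ℝ → ℝ} (hf : ∀ x, f (-x) = -f x) : ∫ x, f x = 0 := by
  have h := integral_neg_eq_self f volume
  simp only [hf, integral_neg] at h
  linarith

theorem inner_eq_zero_of_mul_eq_zero {f h : L2 ℝ} (H : ∀ᵐ x, f x * h x = 0) : ⟪f, h⟫_ℝ = 0 := by
  rw [L2.inner_def, ← integral_zero ℝ ℝ (μ := volume)]
  refine integral_congr_ae ?_
  filter_upwards [H] with x hx
  simpa [mul_comm] using hx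

/-- The part of `g` on `(-∞, a]` contributes `e^{a-x} (T g)(a) = 0` for `x > a`. Thus cutting at a
zero of `T g` commutes with `T` and stays within `H¹`. -/
theorem expAvg_indicator_Ioi {g : ℝ → ℝ} (hg : MemLp g 2) {a : ℝ} (ha : expAvg g a = 0) (x : ℝ) :
    expAvg ((Ioi a).indicator g) x = (Ioi a).indicator (expAvg g) x := by
  have e1 : expAvg ((Ioi a).indicator g) x
      = ∫ y in Iic x ∩ Ioi a, Real.exp (y - x) • g y := by
    unfold expAvg
    rw [← setIntegral_indicator measurableSet_Ioi]
    refine integral_congr_ae (ae_of_all _ fun y => ?_)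
    by_cases hy : y ∈ Ioi a <;> simp [hy]
  rw [e1]
  by_cases hx : x ∈ Ioi a
  · rw [indicator_of_mem hx]
    have h1 : Iic x = (Iic x ∩ Ioi a) ∪ Iic a := by
      ext y; simp only [mem_union, mem_inter_iff, mem_Iic, mem_Ioi]
      constructor
      · intro h; by_cases h2 : y ≤ a
        · exact Or.inr h2
        · exact Or.inl ⟨h, not_le.1 h2⟩
      · rintro (h | h)
        · exact h.1
        · exact h.trans (le_of_lt hx)
    have h2 : expAvg g x = (∫ y in Iic x ∩ Ioi a, Real.exp (y - x) • g y)
        + ∫ y in Iic a, Real.exp (y - x) • g y := by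
      have hi := integrableOn_exp_smul hg x x
      conv_lhs => rw [expAvg, h1]
      rw [h1] at hi
      refine setIntegral_union ?_ measurableSet_Iic (hi.mono_set subset_union_left)
        (hi.mono_set subset_union_right)
      rw [disjoint_left]
      rintro y ⟨-, hy⟩ hy2
      exact not_lt.2 (mem_Iic.1 hy2) (mem_Ioi.1 hy)
    have h3 : ∫ y in Iic a, Real.exp (y - x) • g y = Real.exp (a - x) * expAvg g a := by
      unfold expAvg
      rw [← integral_const_mul]
      refine integral_congr_ae (ae_of_all _ fun y => ?_)
      have : Real.exp (y - x) = Real.exp (a - x) * Real.exp (y - a) := by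
        rw [← Real.exp_add]; ring_nf
      simp only [this, smul_eq_mul]; ring
    rw [h2, h3, ha]; simp
  · rw [indicator_of_notMem hx]
    have : Iic x ∩ Ioi a = ∅ := by
      ext y; simp only [mem_inter_iff, mem_Iic, mem_Ioi, mem_empty_iff_false, iff_false]
      rintro ⟨h1, h2⟩; exact hx (lt_of_lt_of_le h2 h1)
    rw [this]; simp

/-- Restriction of an `L²` function to `(a, ∞)`. -/
def cutRight (a : ℝ) (g : L2 ℝ) : L2 ℝ := ((Lp.memLp g).indicator (measurableSet_Ioi (a := a))).toLp

theorem coeFn_cutRight (a : ℝ) (g : L2 ℝ) : cutRight a g =ᵐ[volume] (Ioi a).indicator g :=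
  MemLp.coeFn_toLp _

theorem coeFn_expOp_cutRight {a : ℝ} {g : L2 ℝ} (ha : expAvg g a = 0) :
    expOp ℝ (cutRight a g) =ᵐ[volume] (Ioi a).indicator (expAvg g) := by
  refine (coeFn_expOp _).trans (ae_of_all _ fun x => ?_)
  rw [expAvg_congr (coeFn_cutRight a g), expAvg_indicator_Ioi (Lp.memLp g) ha]

theorem coeFn_sub_cutRight (b : ℝ) (g : L2 ℝ) :
    (g - cutRight b g : L2 ℝ) =ᵐ[volume] (Iic b).indicator g := by
  filter_upwards [Lp.coeFn_sub g (cutRight b g), coeFn_cutRight b g] with x h1 h2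
  rw [h1, Pi.sub_apply, h2]
  by_cases hx : x ≤ b
  · simp [hx, not_lt.2 hx]
  · simp [hx, not_le.1 hx]

theorem coeFn_expOp_sub_cutRight {b : ℝ} {g : L2 ℝ} (hb : expAvg g b = 0) :
    expOp ℝ (g - cutRight b g) =ᵐ[volume] (Iic b).indicator (expAvg g) := by
  rw [map_sub]
  filter_upwards [Lp.coeFn_sub (expOp ℝ g) (expOp ℝ (cutRight b g)), coeFn_expOp_cutRight hb,
    coeFn_expOp g] with x h1 h2 h3
  rw [h1, Pi.sub_apply, h2, h3]
  by_cases hx : x ≤ b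
  · simp [hx, not_lt.2 hx]
  · simp [hx, not_le.1 hx]

theorem indicator_Ioi_mul_indicator_Iic {a b : ℝ} (hab : b ≤ a) (f h : ℝ → ℝ) (x : ℝ) :
    (Ioi a).indicator f x * (Iic b).indicator h x = 0 := by
  by_cases hx : a < x
  · have : ¬ x ≤ b := not_le.2 (lt_of_le_of_lt hab hx)
    simp [this]
  · simp [hx]

/-- Locality of the form: cut at zeros, the two pieces and their images under `T` have disjoint
supports. -/
theorem inner_formOp_cutRight (v : ℝ →ᵇ ℝ) (z : ℝ) {a b : ℝ} (hab : b ≤ a) {g : L2 ℝ}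
    (ha : expAvg g a = 0) (hb : expAvg g b = 0) :
    ⟪formOp ℝ v z (cutRight a g), g - cutRight b g⟫_ℝ = 0 := by
  rw [formOp_apply, inner_add_left, inner_sub_left, inner_smul_left, inner_expOpAdj,
    inner_expOpAdj, inner_eq_zero_of_mul_eq_zero, inner_eq_zero_of_mul_eq_zero,
    inner_eq_zero_of_mul_eq_zero]
  · simp
  · filter_upwards [coeFn_mulOp v (expOp ℝ (cutRight a g)), coeFn_expOp_cutRight ha,
      coeFn_expOp_sub_cutRight hb] with x h1 h2 h3
    rw [h1, h2, h3, smul_eq_mul, mul_assoc, indicator_Ioi_mul_indicator_Iic hab, mul_zero]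
  · filter_upwards [coeFn_expOp_cutRight ha, coeFn_expOp_sub_cutRight hb] with x h2 h3
    rw [h2, h3, indicator_Ioi_mul_indicator_Iic hab]
  · filter_upwards [coeFn_cutRight a g, coeFn_sub_cutRight b g] with x h2 h3
    rw [h2, h3, indicator_Ioi_mul_indicator_Iic hab]

/-- Flipping the sign of an eigenfunction across its zeros does not change the Rayleigh quotient. -/
theorem exists_flip {v : ℝ →ᵇ ℝ} {ω : ℝ} {a b : ℝ} (hab : b ≤ a) {g : L2 ℝ}
    (hg : formOp ℝ v (-ω) g = 0) (ha : expAvg g a = 0) (hb : expAvg g b = 0) :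
    ∃ h : L2 ℝ, ⟪formOp ℝ v 0 h, h⟫_ℝ = -ω * ‖expOp ℝ h‖ ^ 2 ∧
      expOp ℝ h =ᵐ[volume]
        fun x => (Ioi a).indicator (expAvg g) x - (Iic b).indicator (expAvg g) x := by
  -- `T p` and `T q` are the restrictions of the eigenfunction to `(a, ∞)` and `(-∞, b]`. Locality
  -- and `formOp (-ω) g = 0` make the form at `-ω` vanish on `p`, on `q` and between them, whatever
  -- their relative sign.
  set p := cutRight a g
  set q := g - cutRight b g
  refine ⟨p - q, ?_, ?_⟩
  · have hpg : ⟪formOp ℝ v (-ω) p, g⟫_ℝ = 0 := by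
      rw [inner_formOp_symm, hg, inner_zero_right]
    have hgq : ⟪formOp ℝ v (-ω) g, q⟫_ℝ = 0 := by rw [hg, inner_zero_left]
    have h1 : ⟪formOp ℝ v (-ω) p, q⟫_ℝ = 0 := inner_formOp_cutRight v _ hab ha hb
    have h2 : ⟪formOp ℝ v (-ω) p, p⟫_ℝ = 0 := by
      have := inner_formOp_cutRight v (-ω) le_rfl ha ha
      rw [inner_sub_right] at this
      linarith
    have h3 : ⟪formOp ℝ v (-ω) q, q⟫_ℝ = 0 := by
      have := inner_formOp_cutRight v (-ω) le_rfl hb hb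
      have e : formOp ℝ v (-ω) q = formOp ℝ v (-ω) g - formOp ℝ v (-ω) (cutRight b g) :=
        map_sub _ _ _
      rw [e, inner_sub_left, hgq, this, sub_zero]
    have h4 : ⟪formOp ℝ v (-ω) q, p⟫_ℝ = 0 := by
      rw [inner_formOp_symm, real_inner_comm]; exact h1
    have h5 := inner_formOp_self v (-ω) (p - q)
    have h6 : ⟪formOp ℝ v (-ω) (p - q), p - q⟫_ℝ = 0 := by
      rw [map_sub (formOp ℝ v (-ω)) p q, inner_sub_left, inner_sub_right _ p q,
        inner_sub_right _ p q, h1, h2, h3, h4]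
      norm_num
    linarith
  · rw [map_sub]
    filter_upwards [Lp.coeFn_sub (expOp ℝ p) (expOp ℝ q), coeFn_expOp_cutRight ha,
      coeFn_expOp_sub_cutRight hb] with x h1 h2 h3
    rw [h1, Pi.sub_apply, h2, h3]

theorem inner_expOp_eq_integral {g : L2 ℝ} {ψ : ℝ → ℝ} (hψ : expAvg g = ψ) {u : L2 ℝ} {f : ℝ → ℝ}
    (hu : u =ᵐ[volume] f) : ⟪expOp ℝ g, u⟫_ℝ = ∫ x, ψ x * f x := by
  rw [L2.inner_def]
  refine integral_congr_ae ?_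
  filter_upwards [coeFn_expOp g, hu] with x h1 h2
  rw [h1, h2, hψ]; simp [mul_comm]

theorem norm_sq_eq_integral {u : L2 ℝ} {f : ℝ → ℝ} (hu : u =ᵐ[volume] f) :
    ‖u‖ ^ 2 = ∫ x, f x ^ 2 := by
  rw [← real_inner_self_eq_norm_sq, L2.inner_def]
  refine integral_congr_ae ?_
  filter_upwards [hu] with x h2
  rw [h2]; simp [sq]

/-- The reflected eigenfunction solves the same equation, hence equals `c ψ` by simplicity, and
reflecting twice gives `c² = 1`. -/
theorem NormalizedGenerator.even_or_odd {v : ℝ →ᵇ ℝ} {ω : ℝ} {ψ : ℝ → ℝ}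
    (h : NormalizedGenerator v ω ψ) (hv : Function.Even v) :
    Function.Even ψ ∨ Function.Odd ψ := by
  have hd2 : ∀ x, iteratedDeriv 2 (fun x => ψ (-x)) x = iteratedDeriv 2 ψ (-x) := fun x => by
    rw [iteratedDeriv_comp_neg]; simp
  obtain ⟨g, hg, hf, -, -⟩ := exists_preimage (v := v) (ω := ω) (ψ := fun x => ψ (-x))
    (h.contDiff.comp contDiff_neg) (memLp_neg_iff h.memLp) (fun x => by
      rw [hd2, ← hv x]; exact h.eqn (-x))
  obtain ⟨c, hc⟩ := h.ae_eq_of_eigen hf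
  have hE : (fun x => ψ (-x)) = fun x => c * ψ x := by
    refine (Continuous.ae_eq_iff_eq volume ?_ ?_).1 ?_
    · have := h.contDiff.continuous; fun_prop
    · have := h.contDiff.continuous; fun_prop
    · rw [← hg]; exact (coeFn_expOp g).symm.trans hc
  have hE' : ∀ x, ψ (-x) = c * ψ x := fun x => congrFun hE x
  have hcc : (c - 1) * (c + 1) = 0 := by
    by_contra hne
    have : ∀ x, ψ x = 0 := fun x => by
      have h1 := hE' (-x)
      rw [neg_neg, hE'] at h1
      have : (c - 1) * (c + 1) * ψ x = 0 := by linarith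
      exact (mul_eq_zero.1 this).resolve_left hne
    have h2 := h.norm_one
    simp [this] at h2
  rcases mul_eq_zero.1 hcc with h1 | h1
  · left; intro x; rw [hE', sub_eq_zero.1 h1, one_mul]
  · right; intro x; rw [hE', eq_neg_of_add_eq_zero_left h1, neg_one_mul]

/-- If `ψ₀` were odd, `sgn(x) ψ₀` would have norm one and Rayleigh quotient `-ω₀`, and being even it
would be orthogonal to `ψ₀`. Off `ψ₀` the quotient is at least `-ω₁ > -ω₀`. -/
theorem even_ground_state {v : ℝ →ᵇ ℝ} {ω₀ ω₁ : ℝ} {ψ₀ : ℝ → ℝ} {g₀ g₁ : L2 ℝ}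
    (S : SpectralPair v ω₀ ω₁ g₀ g₁) (h₀ : NormalizedGenerator v ω₀ ψ₀) (hv : Function.Even v)
    (e₀ : expAvg g₀ = ψ₀) : Function.Even ψ₀ := by
  refine (h₀.even_or_odd hv).resolve_right fun ho => ?_
  have hz : ψ₀ 0 = 0 := by have := ho 0; rw [neg_zero] at this; linarith
  have hz' : expAvg g₀ 0 = 0 := by rw [e₀]; exact hz
  obtain ⟨h, h1, h2⟩ := exists_flip le_rfl S.eq₀ hz' hz'
  rw [e₀] at h2
  have i0 := inner_expOp_eq_integral e₀ h2
  rw [integral_eq_zero_of_odd] at i0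
  · have hn : ‖expOp ℝ h‖ ^ 2 = 1 := by
      rw [norm_sq_eq_integral h2, ← h₀.norm_one]
      congr 1; ext x
      by_cases hx : x ≤ 0
      · simp [hx, not_lt.2 hx]
      · simp [hx, not_le.1 hx]
    have hq := S.quad_lower h
    have hb := S.bessel (expOp ℝ h)
    rw [h1, hn, i0] at hq
    rw [hn, i0] at hb
    have := S.lt; have := S.pos
    nlinarith [sq_nonneg ⟪expOp ℝ g₁, expOp ℝ h⟫_ℝ]
  · intro x
    rcases lt_trichotomy x 0 with hx | hx | hx
    · simp [hx, hx.le, hx.not_gt, ho x, not_le.2 hx]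
    · simp [hx, hz]
    · simp [hx, hx.le, hx.not_gt, ho x, not_le.2 hx]

/-- If an even `ψ` vanished at `a > 0`, its two outer tails with opposite signs would form an odd
function, orthogonal to both even bound states, with form `-ω ‖·‖²`. Nonnegativity kills the tails,
and unique continuation kills `ψ`. At `a = 0` evenness already gives `ψ'(0) = 0`. -/
theorem ne_zero_of_even {v : ℝ →ᵇ ℝ} {ω₀ ω₁ ω : ℝ} {ψ₀ ψ₁ ψ : ℝ → ℝ} {g₀ g₁ g : L2 ℝ}
    (S : SpectralPair v ω₀ ω₁ g₀ g₁) (e₀ : expAvg g₀ = ψ₀) (e₁ : expAvg g₁ = ψ₁)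
    (E₀ : Function.Even ψ₀) (E₁ : Function.Even ψ₁) (hω : 0 < ω) (h : NormalizedGenerator v ω ψ)
    (e : expAvg g = ψ) (hg : formOp ℝ v (-ω) g = 0) (E : Function.Even ψ) (a : ℝ) : ψ a ≠ 0 := by
  have hne : ψ ≠ 0 := fun h0 => by
    have := h.norm_one; simp [h0] at this
  wlog ha : 0 ≤ a generalizing a
  · have := this (-a) (by linarith); rwa [E] at this
  intro hz
  rcases ha.eq_or_lt with ha | ha
  · subst ha
    refine hne (eq_zero_of_initial h.contDiff h.eqn hz ?_)
    have h1 := deriv_comp_neg ψ 0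
    have h2 : (fun x => ψ (-x)) = ψ := funext E
    rw [h2, neg_zero] at h1
    linarith
  · have hz1 : expAvg g a = 0 := by rw [e]; exact hz
    have hz2 : expAvg g (-a) = 0 := by rw [e, E]; exact hz
    obtain ⟨k, h1, h2⟩ := exists_flip (by linarith) hg hz1 hz2
    rw [e] at h2
    have hodd : ∀ x, (Ioi a).indicator ψ (-x) - (Iic (-a)).indicator ψ (-x)
        = -((Ioi a).indicator ψ x - (Iic (-a)).indicator ψ x) := by
      intro x
      simp only [indicator, mem_Ioi, mem_Iic, E x]
      rcases lt_trichotomy x a with h3 | h3 | h3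
      · have e1 : ¬ a < x := h3.not_gt
        have e2 : ¬ (-x ≤ -a) := by linarith
        rcases lt_trichotomy x (-a) with h4 | h4 | h4
        · have e3 : a < -x := by linarith
          simp [e1, e2, e3, h4.le]
        · have : ψ x = 0 := by rw [h4, E]; exact hz
          simp [this]
        · have e3 : ¬ a < -x := by linarith
          have e4 : ¬ x ≤ -a := by linarith
          simp [e1, e2, e3, e4]
      · simp [h3, hz]
      · have e2 : (-x ≤ -a) := by linarith
        have e3 : ¬ a < -x := by linarith
        have e4 : ¬ x ≤ -a := by linarith
        simp [h3, e2, e3, e4]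
    have i0 := inner_expOp_eq_integral e₀ h2
    have i1 := inner_expOp_eq_integral e₁ h2
    rw [integral_eq_zero_of_odd (fun x => by rw [hodd, E₀]; ring)] at i0
    rw [integral_eq_zero_of_odd (fun x => by rw [hodd, E₁]; ring)] at i1
    have hn := S.nonneg k i0 i1
    rw [h1] at hn
    have hT : expOp ℝ k = 0 := by
      have : ‖expOp ℝ k‖ ^ 2 ≤ 0 := by nlinarith [sq_nonneg ‖expOp ℝ k‖]
      exact norm_eq_zero.1 (pow_eq_zero_iff two_ne_zero |>.1 (le_antisymm this (sq_nonneg _)))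
    rw [hT] at h2
    have hae : ∀ᵐ x ∂volume.restrict (Ioi a), ψ x = 0 := by
      rw [ae_restrict_iff' measurableSet_Ioi]
      filter_upwards [h2, Lp.coeFn_zero ℝ 2 volume] with x h3 h4 hx
      rw [h4] at h3
      have e4 : ¬ x ≤ -a := by have : a < x := hx; linarith
      have e5 : a < x := hx
      simpa [e5, e4] using h3.symm
    have hon : EqOn ψ 0 (Ioi a) :=
      Measure.eqOn_open_of_ae_eq hae isOpen_Ioi h.contDiff.continuous.continuousOn
        continuousOn_const
    have hev : ψ =ᶠ[𝓝 (a + 1)] 0 :=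
      hon.eventuallyEq_of_mem (isOpen_Ioi.mem_nhds (by simp))
    refine hne (eq_zero_of_initial h.contDiff h.eqn (a := a + 1) hev.eq_of_nhds ?_)
    rw [hev.deriv_eq]; simp

/-- The first bound state is even and the second one is odd. -/
theorem parity {v : ℝ →ᵇ ℝ} {ω₀ ω₁ : ℝ} {ψ₀ ψ₁ : ℝ → ℝ} {g₀ g₁ : L2 ℝ}
    (S : SpectralPair v ω₀ ω₁ g₀ g₁) (h₀ : NormalizedGenerator v ω₀ ψ₀)
    (h₁ : NormalizedGenerator v ω₁ ψ₁) (hv : Function.Even v)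
    (e₀ : expAvg g₀ = ψ₀) (e₁ : expAvg g₁ = ψ₁) : Function.Even ψ₀ ∧ Function.Odd ψ₁ := by
  have E₀ := even_ground_state S h₀ hv e₀
  refine ⟨E₀, (h₁.even_or_odd hv).resolve_left fun E₁ => ?_⟩
  -- Were `ψ₁` even as well, neither function could vanish, so `ψ₀ ψ₁` would have a constant sign,
  -- against orthogonality.
  have n0 := ne_zero_of_even S e₀ e₁ E₀ E₁ (S.pos.trans S.lt) h₀ e₀ S.eq₀ E₀
  have n1 := ne_zero_of_even S e₀ e₁ E₀ E₁ S.pos h₁ e₁ S.eq₁ E₁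
  have hcont : Continuous fun x => ψ₀ x * ψ₁ x := h₀.contDiff.continuous.mul h₁.contDiff.continuous
  have hi : Integrable fun x => ψ₀ x * ψ₁ x := h₀.memLp.integrable_mul h₁.memLp
  have ho : ∫ x, ψ₀ x * ψ₁ x = 0 := by
    rw [← inner_expOp_eq_integral e₀ ((coeFn_expOp g₁).trans (by rw [e₁])), S.orth]
  have hne : ∀ x, ψ₀ x * ψ₁ x ≠ 0 := fun x => mul_ne_zero (n0 x) (n1 x)
  rcases (hne 0).lt_or_gt with h | h
  · have hneg : ∀ x, ψ₀ x * ψ₁ x < 0 := fun x => by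
      by_contra hx
      obtain ⟨y, hy⟩ := mem_range_of_exists_le_of_exists_ge hcont ⟨0, h.le⟩ ⟨x, not_lt.1 hx⟩
      exact hne y hy
    have := integral_pos_of_integrable_nonneg_nonzero (x := 0) (μ := volume) hcont.neg hi.neg
      (fun x => by simpa using (hneg x).le) (by simpa using hne 0)
    simp only [Pi.neg_apply, integral_neg] at this
    linarith
  · have hpos : ∀ x, 0 < ψ₀ x * ψ₁ x := fun x => by
      by_contra hx
      obtain ⟨y, hy⟩ := mem_range_of_exists_le_of_exists_ge hcont ⟨x, not_lt.1 hx⟩ ⟨0, h.le⟩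
      exact hne y hy
    have := integral_pos_of_integrable_nonneg_nonzero (x := 0) (μ := volume) hcont hi
      (fun x => (hpos x).le) (hne 0)
    linarith

end QuinticNLS

namespace QuinticNLS
open Set Filter
open scoped ContDiff

set_option linter.unusedSectionVars false

/-! ### A fixed point depending on three parameters -/

section FixedPoint

variable {Z W W' : Type*} [NormedAddCommGroup Z] [NormedSpace ℝ Z]
  [NormedAddCommGroup W] [NormedSpace ℝ W] [NormedAddCommGroup W'] [NormedSpace ℝ W']

/-- On the unit ball, `f` is bounded by `C` and Lipschitz with constant `C`. -/
def BoundedLip (C : ℝ) (f : Z → W) : Prop :=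
  ∀ x, ‖x‖ ≤ 1 → ‖f x‖ ≤ C ∧ ∀ y, ‖y‖ ≤ 1 → ‖f x - f y‖ ≤ C * ‖x - y‖

theorem BoundedLip.nonneg {C : ℝ} {f : Z → W} (h : BoundedLip C f) : 0 ≤ C :=
  (norm_nonneg _).trans (h 0 (by simp)).1

theorem BoundedLip.mono {C D : ℝ} {f : Z → W} (h : BoundedLip C f) (hCD : C ≤ D) :
    BoundedLip D f := fun x hx => ⟨(h x hx).1.trans hCD, fun y hy =>
  ((h x hx).2 y hy).trans (mul_le_mul_of_nonneg_right hCD (norm_nonneg _))⟩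

theorem BoundedLip.clm {C : ℝ} {f : Z → W} (h : BoundedLip C f) (L : W →L[ℝ] W') :
    BoundedLip (‖L‖ * C) (fun x => L (f x)) := fun x hx =>
  ⟨(L.le_opNorm _).trans (mul_le_mul_of_nonneg_left (h x hx).1 (norm_nonneg _)), fun y hy => by
    rw [← map_sub, mul_assoc]
    exact (L.le_opNorm _).trans (mul_le_mul_of_nonneg_left ((h x hx).2 y hy) (norm_nonneg _))⟩

theorem BoundedLip.prodMk {C : ℝ} {f : Z → W} {g : Z → W'} (hf : BoundedLip C f)
    (hg : BoundedLip C g) : BoundedLip C (fun x => (f x, g x)) := fun x hx =>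
  ⟨norm_prod_le_iff.2 ⟨(hf x hx).1, (hg x hx).1⟩, fun y hy =>
    norm_prod_le_iff.2 ⟨(hf x hx).2 y hy, (hg x hx).2 y hy⟩⟩

/-- The product rule for Lipschitz bounds; the factor `2` counts its two terms. -/
theorem BoundedLip.bilin {W'' : Type*} [NormedAddCommGroup W''] [NormedSpace ℝ W''] {C D : ℝ}
    {f : Z → W} {g : Z → W'} (hf : BoundedLip C f) (hg : BoundedLip D g)
    {B : W → W' → W''} (hB : ∀ u v, ‖B u v‖ ≤ ‖u‖ * ‖v‖)
    (hl : ∀ u u' v, B (u - u') v = B u v - B u' v) (hr : ∀ u v v', B u (v - v') = B u v - B u v') :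
    BoundedLip (2 * C * D) (fun x => B (f x) (g x)) := fun x hx => by
  have hC := hf.nonneg
  have hD := hg.nonneg
  have h1 := hf x hx
  have h2 := hg x hx
  constructor
  · refine (hB _ _).trans ((mul_le_mul h1.1 h2.1 (norm_nonneg _) hC).trans ?_)
    nlinarith [mul_nonneg hC hD]
  · intro y hy
    have e : B (f x) (g x) - B (f y) (g y) = B (f x - f y) (g x) + B (f y) (g x - g y) := by
      rw [hl, hr]; abel
    rw [e]
    refine (norm_add_le _ _).trans ((add_le_add (hB _ _) (hB _ _)).trans ?_)
    have a1 := mul_le_mul (h1.2 y hy) h2.1 (norm_nonneg _) (by positivity)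
    have a2 := mul_le_mul (hf y hy).1 (h2.2 y hy) (norm_nonneg _) hC
    linarith

/-- `s² M₁ + s σ M₂ + σ² M₃` at the parameters `(σ, s, w)`. -/
def quadForm (M₁ M₂ M₃ : Z → W) (p : ℝ × ℝ × ℝ) (x : Z) : W :=
  p.2.1 ^ 2 • M₁ x + (p.2.1 * p.1) • M₂ x + p.1 ^ 2 • M₃ x

variable {M₁ M₂ M₃ : Z → W} {C : ℝ}

theorem abs_coeff_le {p : ℝ × ℝ × ℝ} {τ : ℝ} (h1 : |p.1| ≤ τ) (h2 : |p.2.1| ≤ τ) :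
    |p.2.1 ^ 2| ≤ τ ^ 2 ∧ |p.2.1 * p.1| ≤ τ ^ 2 ∧ |p.1 ^ 2| ≤ τ ^ 2 := by
  have h0 : 0 ≤ τ := (abs_nonneg _).trans h1
  rw [abs_pow, abs_pow, abs_mul, sq τ, sq, sq]
  exact ⟨mul_le_mul h2 h2 (abs_nonneg _) h0, mul_le_mul h2 h1 (abs_nonneg _) h0,
    mul_le_mul h1 h1 (abs_nonneg _) h0⟩

theorem abs_coeff_sub_le {p q : ℝ × ℝ × ℝ} {τ : ℝ} (h1 : |p.1| ≤ τ) (h2 : |p.2.1| ≤ τ)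
    (h3 : |q.1| ≤ τ) (h4 : |q.2.1| ≤ τ) :
    |p.2.1 ^ 2 - q.2.1 ^ 2| ≤ 2 * τ * (|p.1 - q.1| + |p.2.1 - q.2.1|) ∧
    |p.2.1 * p.1 - q.2.1 * q.1| ≤ 2 * τ * (|p.1 - q.1| + |p.2.1 - q.2.1|) ∧
    |p.1 ^ 2 - q.1 ^ 2| ≤ 2 * τ * (|p.1 - q.1| + |p.2.1 - q.2.1|) := by
  have h0 : 0 ≤ τ := (abs_nonneg _).trans h1
  have a1 := abs_nonneg (p.1 - q.1)
  have a2 := abs_nonneg (p.2.1 - q.2.1)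
  have b1 := mul_nonneg h0 a1
  have b2 := mul_nonneg h0 a2
  refine ⟨?_, ?_, ?_⟩
  · have : p.2.1 ^ 2 - q.2.1 ^ 2 = (p.2.1 + q.2.1) * (p.2.1 - q.2.1) := by ring
    rw [this, abs_mul]
    have := mul_le_mul_of_nonneg_right ((abs_add_le _ _).trans (add_le_add h2 h4)) a2
    linarith
  · have : p.2.1 * p.1 - q.2.1 * q.1 = p.2.1 * (p.1 - q.1) + (p.2.1 - q.2.1) * q.1 := by ring
    rw [this]
    refine (abs_add_le _ _).trans ?_
    rw [abs_mul, abs_mul]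
    have c1 := mul_le_mul_of_nonneg_right h2 a1
    have c2 := mul_le_mul_of_nonneg_left h3 a2
    linarith
  · have : p.1 ^ 2 - q.1 ^ 2 = (p.1 + q.1) * (p.1 - q.1) := by ring
    rw [this, abs_mul]
    have := mul_le_mul_of_nonneg_right ((abs_add_le _ _).trans (add_le_add h1 h3)) a1
    linarith

theorem norm_comb_le {a b c A B : ℝ} {u v w : W} (ha : |a| ≤ A) (hb : |b| ≤ A) (hc : |c| ≤ A)
    (hu : ‖u‖ ≤ B) (hv : ‖v‖ ≤ B) (hw : ‖w‖ ≤ B) : ‖a • u + b • v + c • w‖ ≤ 3 * A * B := by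
  have hA : 0 ≤ A := (abs_nonneg _).trans ha
  refine norm_add₃_le.trans ?_
  rw [norm_smul, norm_smul, norm_smul]
  have h1 := mul_le_mul ha hu (norm_nonneg _) hA
  have h2 := mul_le_mul hb hv (norm_nonneg _) hA
  have h3 := mul_le_mul hc hw (norm_nonneg _) hA
  simp only [Real.norm_eq_abs]
  linarith

theorem norm_quadForm_le (h₁ : BoundedLip C M₁) (h₂ : BoundedLip C M₂) (h₃ : BoundedLip C M₃)
    {p : ℝ × ℝ × ℝ} {τ : ℝ} (hp1 : |p.1| ≤ τ) (hp2 : |p.2.1| ≤ τ) {x : Z} (hx : ‖x‖ ≤ 1) :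
    ‖quadForm M₁ M₂ M₃ p x‖ ≤ 3 * τ ^ 2 * C := by
  obtain ⟨c1, c2, c3⟩ := abs_coeff_le hp1 hp2
  exact norm_comb_le c1 c2 c3 (h₁ x hx).1 (h₂ x hx).1 (h₃ x hx).1

theorem norm_quadForm_sub_le (h₁ : BoundedLip C M₁) (h₂ : BoundedLip C M₂) (h₃ : BoundedLip C M₃)
    {p : ℝ × ℝ × ℝ} {τ : ℝ} (hp1 : |p.1| ≤ τ) (hp2 : |p.2.1| ≤ τ) {x y : Z} (hx : ‖x‖ ≤ 1)
    (hy : ‖y‖ ≤ 1) :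
    ‖quadForm M₁ M₂ M₃ p x - quadForm M₁ M₂ M₃ p y‖ ≤ 3 * τ ^ 2 * (C * ‖x - y‖) := by
  obtain ⟨c1, c2, c3⟩ := abs_coeff_le hp1 hp2
  have e : quadForm M₁ M₂ M₃ p x - quadForm M₁ M₂ M₃ p y
      = p.2.1 ^ 2 • (M₁ x - M₁ y) + (p.2.1 * p.1) • (M₂ x - M₂ y) + p.1 ^ 2 • (M₃ x - M₃ y) := by
    unfold quadForm; module
  rw [e]
  exact norm_comb_le c1 c2 c3 ((h₁ x hx).2 y hy) ((h₂ x hx).2 y hy) ((h₃ x hx).2 y hy)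

theorem norm_quadForm_sub_le' (h₁ : BoundedLip C M₁) (h₂ : BoundedLip C M₂)
    (h₃ : BoundedLip C M₃) {p q : ℝ × ℝ × ℝ} {τ : ℝ} (hp1 : |p.1| ≤ τ) (hp2 : |p.2.1| ≤ τ)
    (hq1 : |q.1| ≤ τ) (hq2 : |q.2.1| ≤ τ) {x : Z} (hx : ‖x‖ ≤ 1) :
    ‖quadForm M₁ M₂ M₃ p x - quadForm M₁ M₂ M₃ q x‖
      ≤ 6 * τ * C * (|p.1 - q.1| + |p.2.1 - q.2.1|) := by
  obtain ⟨c1, c2, c3⟩ := abs_coeff_sub_le hp1 hp2 hq1 hq2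
  have e : quadForm M₁ M₂ M₃ p x - quadForm M₁ M₂ M₃ q x
      = (p.2.1 ^ 2 - q.2.1 ^ 2) • M₁ x + (p.2.1 * p.1 - q.2.1 * q.1) • M₂ x
        + (p.1 ^ 2 - q.1 ^ 2) • M₃ x := by
    unfold quadForm; module
  rw [e]
  refine (norm_comb_le c1 c2 c3 (h₁ x hx).1 (h₂ x hx).1 (h₃ x hx).1).trans
    (le_of_eq (by ring))

theorem contDiff_quadForm {n : ℕ∞ω} (h₁ : ContDiff ℝ n M₁) (h₂ : ContDiff ℝ n M₂)
    (h₃ : ContDiff ℝ n M₃) :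
    ContDiff ℝ n (fun q : (ℝ × ℝ × ℝ) × Z => quadForm M₁ M₂ M₃ q.1 q.2) := by
  unfold quadForm; fun_prop

end FixedPoint

section Family

variable {Z : Type*} [NormedAddCommGroup Z] [NormedSpace ℝ Z] [CompleteSpace Z]
  {M₁ M₂ M₃ : Z → Z} {M₄ : Z →L[ℝ] Z} {C e : ℝ}

/-- Assumptions under which `x = s² M₁ x + s σ M₂ x + σ² M₃ x + w M₄ x` is solved by
contraction in the unit ball for `‖(σ, s, w)‖ < e`. -/
structure SmallFamily (M₁ M₂ M₃ : Z → Z) (M₄ : Z →L[ℝ] Z) (C e : ℝ) : Prop where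
  h₁ : BoundedLip C M₁
  h₂ : BoundedLip C M₂
  h₃ : BoundedLip C M₃
  h₄ : ‖M₄‖ ≤ C
  s₁ : ContDiff ℝ ω M₁
  s₂ : ContDiff ℝ ω M₂
  s₃ : ContDiff ℝ ω M₃
  pos : 0 < e
  le_one : e ≤ 1
  small : 8 * C * e ≤ 1

/-- The right-hand side of the fixed point equation. -/
def famMap (M₁ M₂ M₃ : Z → Z) (M₄ : Z →L[ℝ] Z) (p : ℝ × ℝ × ℝ) (x : Z) : Z :=
  quadForm M₁ M₂ M₃ p x + p.2.2 • M₄ x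

theorem abs_le_of_norm_le {p : ℝ × ℝ × ℝ} {e : ℝ} (h : ‖p‖ ≤ e) :
    |p.1| ≤ e ∧ |p.2.1| ≤ e ∧ |p.2.2| ≤ e := by
  rw [norm_prod_le_iff, norm_prod_le_iff] at h
  exact h

namespace SmallFamily

theorem norm_sub_le (H : SmallFamily M₁ M₂ M₃ M₄ C e) {p : ℝ × ℝ × ℝ} (hp : ‖p‖ ≤ e)
    {x y : Z} (hx : ‖x‖ ≤ 1) (hy : ‖y‖ ≤ 1) :
    ‖famMap M₁ M₂ M₃ M₄ p x - famMap M₁ M₂ M₃ M₄ p y‖ ≤ 1 / 2 * ‖x - y‖ := by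
  obtain ⟨p1, p2, p3⟩ := abs_le_of_norm_le hp
  have hC := H.h₁.nonneg
  have h1 := norm_quadForm_sub_le H.h₁ H.h₂ H.h₃ p1 p2 hx hy
  have h2 : ‖p.2.2 • M₄ (x - y)‖ ≤ e * (C * ‖x - y‖) := by
    rw [norm_smul]
    exact mul_le_mul p3 (M₄.le_of_opNorm_le H.h₄ _) (norm_nonneg _) H.pos.le
  have e1 : famMap M₁ M₂ M₃ M₄ p x - famMap M₁ M₂ M₃ M₄ p y
      = (quadForm M₁ M₂ M₃ p x - quadForm M₁ M₂ M₃ p y) + p.2.2 • M₄ (x - y) := by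
    unfold famMap; rw [map_sub]; module
  rw [e1]
  -- The constants add up to `3 C e² + C e ≤ 4 C e ≤ 1/2`.
  refine (norm_add_le _ _).trans ((add_le_add h1 h2).trans ?_)
  have h3 : e ^ 2 ≤ e := by nlinarith [H.pos, H.le_one]
  have h4 : 0 ≤ C * ‖x - y‖ := by positivity
  have h5 := mul_le_mul_of_nonneg_right h3 h4
  have h6 := mul_le_mul_of_nonneg_right H.small (norm_nonneg (x - y))
  linarith

theorem norm_le (H : SmallFamily M₁ M₂ M₃ M₄ C e) {p : ℝ × ℝ × ℝ} (hp : ‖p‖ ≤ e)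
    {x : Z} (hx : ‖x‖ ≤ 1) : ‖famMap M₁ M₂ M₃ M₄ p x‖ ≤ 1 / 2 := by
  obtain ⟨p1, p2, p3⟩ := abs_le_of_norm_le hp
  have hC := H.h₁.nonneg
  have h1 := norm_quadForm_le H.h₁ H.h₂ H.h₃ p1 p2 hx
  have h2 : ‖p.2.2 • M₄ x‖ ≤ e * (C * 1) := by
    rw [norm_smul]
    exact mul_le_mul p3 ((M₄.le_of_opNorm_le H.h₄ _).trans (mul_le_mul_of_nonneg_left hx hC))
      (norm_nonneg _) H.pos.le
  refine (norm_add_le _ _).trans ((add_le_add h1 h2).trans ?_)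
  have h3 : e ^ 2 ≤ e := by nlinarith [H.pos, H.le_one]
  have h5 := mul_le_mul_of_nonneg_right h3 hC
  have := H.small
  linarith

theorem existsUnique (H : SmallFamily M₁ M₂ M₃ M₄ C e) {p : ℝ × ℝ × ℝ} (hp : ‖p‖ ≤ e) :
    ∃ x : Z, ‖x‖ ≤ 1 ∧ famMap M₁ M₂ M₃ M₄ p x = x := by
  have hmaps : MapsTo (famMap M₁ M₂ M₃ M₄ p) (Metric.closedBall 0 1) (Metric.closedBall 0 1) := by
    intro x hx
    rw [mem_closedBall_zero_iff] at *
    exact (H.norm_le hp hx).trans (by norm_num)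
  have hc : ContractingWith (1 / 2) (hmaps.restrict (famMap M₁ M₂ M₃ M₄ p) _ _) := by
    refine ⟨by rw [← NNReal.coe_lt_coe]; norm_num, LipschitzWith.of_dist_le_mul fun x y => ?_⟩
    have := H.norm_sub_le hp (mem_closedBall_zero_iff.1 x.2) (mem_closedBall_zero_iff.1 y.2)
    simpa [Subtype.dist_eq, dist_eq_norm] using this
  obtain ⟨y, hy, hfix, -⟩ := hc.exists_fixedPoint' Metric.isClosed_closedBall.isComplete hmaps
    (x := 0) (by simp) (edist_ne_top _ _)
  exact ⟨y, mem_closedBall_zero_iff.1 hy, hfix⟩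

open Classical in
/-- The fixed point in the unit ball. -/
def sol (_ : SmallFamily M₁ M₂ M₃ M₄ C e) (p : ℝ × ℝ × ℝ) : Z :=
  if h : ∃ x : Z, ‖x‖ ≤ 1 ∧ famMap M₁ M₂ M₃ M₄ p x = x then h.choose else 0

theorem sol_spec (H : SmallFamily M₁ M₂ M₃ M₄ C e) {p : ℝ × ℝ × ℝ} (hp : ‖p‖ ≤ e) :
    ‖H.sol p‖ ≤ 1 ∧ famMap M₁ M₂ M₃ M₄ p (H.sol p) = H.sol p := by
  have h := H.existsUnique hp
  rw [sol, dif_pos h]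
  exact h.choose_spec

theorem sol_lt_one (H : SmallFamily M₁ M₂ M₃ M₄ C e) {p : ℝ × ℝ × ℝ} (hp : ‖p‖ ≤ e) :
    ‖H.sol p‖ < 1 := by
  have h := H.norm_le hp (H.sol_spec hp).1
  rw [(H.sol_spec hp).2] at h
  linarith

theorem eq_sol (H : SmallFamily M₁ M₂ M₃ M₄ C e) {p : ℝ × ℝ × ℝ} (hp : ‖p‖ ≤ e) {x : Z}
    (hx : ‖x‖ ≤ 1) (hfix : famMap M₁ M₂ M₃ M₄ p x = x) : x = H.sol p := by
  have h := H.norm_sub_le hp hx (H.sol_spec hp).1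
  rw [hfix, (H.sol_spec hp).2] at h
  have : ‖x - H.sol p‖ ≤ 0 := by linarith
  exact sub_eq_zero.1 (norm_le_zero_iff.1 this)

/-- All terms except `w M₄ x` are quadratic in `(σ, s)`, and that one is absorbed on the left
because `C e ≤ 1/8`. -/
theorem norm_sol_le (H : SmallFamily M₁ M₂ M₃ M₄ C e) {p : ℝ × ℝ × ℝ} (hp : ‖p‖ ≤ e) {τ : ℝ}
    (h1 : |p.1| ≤ τ) (h2 : |p.2.1| ≤ τ) : ‖H.sol p‖ ≤ 6 * C * τ ^ 2 := by
  have hC := H.h₁.nonneg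
  have hx := (H.sol_spec hp).1
  have a1 := norm_quadForm_le H.h₁ H.h₂ H.h₃ h1 h2 hx
  have a2 : ‖p.2.2 • M₄ (H.sol p)‖ ≤ e * (C * ‖H.sol p‖) := by
    rw [norm_smul]
    exact mul_le_mul (abs_le_of_norm_le hp).2.2 (M₄.le_of_opNorm_le H.h₄ _) (norm_nonneg _)
      H.pos.le
  have a3 : ‖H.sol p‖ ≤ 3 * τ ^ 2 * C + e * (C * ‖H.sol p‖) := by
    conv_lhs => rw [← (H.sol_spec hp).2]
    exact (norm_add_le _ _).trans (add_le_add a1 a2)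
  have a4 := mul_le_mul_of_nonneg_right H.small (norm_nonneg (H.sol p))
  have : 0 ≤ ‖H.sol p‖ := norm_nonneg _
  linarith

/-- A change of `w` acts through `M₄` at the solution, which is itself `O(τ²)`. These powers of `τ`
produce the orders `τ³` and `τ⁴` in `RedFun`. -/
theorem norm_sol_sub_le (H : SmallFamily M₁ M₂ M₃ M₄ C e) {p q : ℝ × ℝ × ℝ} (hp : ‖p‖ ≤ e)
    (hq : ‖q‖ ≤ e) {τ : ℝ} (hp1 : |p.1| ≤ τ) (hp2 : |p.2.1| ≤ τ) (hq1 : |q.1| ≤ τ)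
    (hq2 : |q.2.1| ≤ τ) :
    ‖H.sol p - H.sol q‖ ≤ 12 * C * τ * (|p.1 - q.1| + |p.2.1 - q.2.1|)
      + 12 * C ^ 2 * τ ^ 2 * |p.2.2 - q.2.2| := by
  have hC := H.h₁.nonneg
  have hx := (H.sol_spec hp).1
  have hy := (H.sol_spec hq).1
  set x := H.sol p with hxd
  set y := H.sol q with hyd
  have a1 := H.norm_sub_le hp hx hy
  have a2 := norm_quadForm_sub_le' H.h₁ H.h₂ H.h₃ hp1 hp2 hq1 hq2 hy
  have a3 : ‖(p.2.2 - q.2.2) • M₄ y‖ ≤ |p.2.2 - q.2.2| * (C * (6 * C * τ ^ 2)) := by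
    rw [norm_smul]
    refine mul_le_mul_of_nonneg_left ((M₄.le_of_opNorm_le H.h₄ _).trans ?_) (abs_nonneg _)
    exact mul_le_mul_of_nonneg_left (H.norm_sol_le hq hq1 hq2) hC
  have e1 : x - y = (famMap M₁ M₂ M₃ M₄ p x - famMap M₁ M₂ M₃ M₄ p y)
      + ((quadForm M₁ M₂ M₃ p y - quadForm M₁ M₂ M₃ q y) + (p.2.2 - q.2.2) • M₄ y) := by
    have h3 : y = famMap M₁ M₂ M₃ M₄ q y := (H.sol_spec hq).2.symm
    rw [(H.sol_spec hp).2]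
    nth_rewrite 1 [h3]
    unfold famMap
    module
  have a4 : ‖x - y‖ ≤ 1 / 2 * ‖x - y‖ + (6 * τ * C * (|p.1 - q.1| + |p.2.1 - q.2.1|)
      + |p.2.2 - q.2.2| * (C * (6 * C * τ ^ 2))) := by
    conv_lhs => rw [e1]
    exact (norm_add_le _ _).trans (add_le_add a1 ((norm_add_le _ _).trans (add_le_add a2 a3)))
  linarith

/-- The implicit function theorem applies because the derivative in `x` is `1` minus an operator of
norm at most `1/2`. The implicit branch remains in the unit ball, where the fixed point is unique,
so it coincides with `sol`. -/
theorem contDiffAt_sol (H : SmallFamily M₁ M₂ M₃ M₄ C e) {p : ℝ × ℝ × ℝ} (hp : ‖p‖ < e) :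
    ContDiffAt ℝ ω H.sol p := by
  set Φ : (ℝ × ℝ × ℝ) × Z → Z := fun q => q.2 - famMap M₁ M₂ M₃ M₄ q.1 q.2 with hΦ
  have hF : ContDiff ℝ ω (fun q : (ℝ × ℝ × ℝ) × Z => famMap M₁ M₂ M₃ M₄ q.1 q.2) := by
    have := contDiff_quadForm H.s₁ H.s₂ H.s₃
    unfold famMap; fun_prop
  have hΦc : ContDiff ℝ ω Φ := contDiff_snd.sub hF
  set u : (ℝ × ℝ × ℝ) × Z := (p, H.sol p) with hu
  have hω : (ω : ℕ∞ω) ≠ 0 := by simp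
  have hΦu : Φ u = 0 := by simp [hΦ, hu, (H.sol_spec hp.le).2]
  have hinv : (fderiv ℝ Φ u ∘L .inr ℝ (ℝ × ℝ × ℝ) Z).IsInvertible := by
    have hFd := (hF.differentiable hω u).hasFDerivAt
    set F' := fderiv ℝ (fun q : (ℝ × ℝ × ℝ) × Z => famMap M₁ M₂ M₃ M₄ q.1 q.2) u
    have hsec : HasFDerivAt (fun x : Z => famMap M₁ M₂ M₃ M₄ p x) (F' ∘L .inr ℝ (ℝ × ℝ × ℝ) Z)
        (H.sol p) := by
      have h1 : HasFDerivAt (fun x : Z => ((p, x) : (ℝ × ℝ × ℝ) × Z)) (.inr ℝ (ℝ × ℝ × ℝ) Z)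
          (H.sol p) := hasFDerivAt_prodMk_right p (H.sol p)
      exact HasFDerivAt.comp (H.sol p) hFd h1
    have hn : ‖F' ∘L .inr ℝ (ℝ × ℝ × ℝ) Z‖ ≤ 1 / 2 := by
      refine hsec.le_of_lip' (by norm_num) ?_
      have : Metric.ball (0 : Z) 1 ∈ 𝓝 (H.sol p) :=
        Metric.isOpen_ball.mem_nhds (mem_ball_zero_iff.2 (H.sol_lt_one hp.le))
      filter_upwards [this] with x hx
      exact H.norm_sub_le hp.le (mem_ball_zero_iff.1 hx).le (H.sol_spec hp.le).1
    have hder : fderiv ℝ Φ u ∘L .inr ℝ (ℝ × ℝ × ℝ) Z = 1 - F' ∘L .inr ℝ (ℝ × ℝ × ℝ) Z := by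
      have : fderiv ℝ Φ u = .snd ℝ (ℝ × ℝ × ℝ) Z - F' := (hasFDerivAt_snd.sub hFd).fderiv
      rw [this]; ext x; simp
    rw [hder]
    obtain ⟨U, hU⟩ := isUnit_one_sub_of_norm_lt_one (lt_of_le_of_lt hn (by norm_num))
    exact ⟨ContinuousLinearEquiv.unitsEquiv ℝ Z U, by rw [← hU]; ext x; simp⟩
  have hcd : ContDiffAt ℝ ω Φ u := hΦc.contDiffAt
  have hX := hcd.contDiffAt_implicitFunction hω hinv
  have hX0 : hcd.implicitFunction hω hinv p = H.sol p := hcd.implicitFunction_apply_self hω hinv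
  refine hX.congr_of_eventuallyEq ?_
  have hev := hcd.eventually_apply_implicitFunction hω hinv
  have hball : ∀ᶠ q in 𝓝 p, ‖hcd.implicitFunction hω hinv q‖ < 1 := by
    refine hX.continuousAt.norm.tendsto.eventually_lt_const ?_
    show ‖hcd.implicitFunction hω hinv p‖ < 1
    rw [hX0]; exact H.sol_lt_one hp.le
  have hpe : ∀ᶠ q in 𝓝 p, ‖q‖ < e := (continuous_norm.tendsto p).eventually_lt_const hp
  filter_upwards [hev, hball, hpe] with q h1 h2 h3
  refine (H.eq_sol h3.le h2.le ?_).symm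
  rw [hΦu] at h1
  exact (sub_eq_zero.1 h1).symm

end SmallFamily
end Family
end QuinticNLS

namespace QuinticNLS
open Set Filter
open scoped ContDiff

/-! ### The reduced equations as functions of three real parameters -/

/-- `f(σ, s, w) = w + k - (a s² + b s σ + c σ²) + h` where `h` vanishes at `s = σ = 0` and is
small together with its first differences. -/
structure RedFun (a b c k C e : ℝ) (f : ℝ × ℝ × ℝ → ℝ) : Prop where
  zero : ∀ w, |w| < e → f (0, 0, w) = w + k
  lip : ∀ p q : ℝ × ℝ × ℝ, ∀ τ, ‖p‖ < e → ‖q‖ < e → |p.1| ≤ τ → |p.2.1| ≤ τ → |q.1| ≤ τ →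
    |q.2.1| ≤ τ →
    |(f p - (p.2.2 + k - (a * p.2.1 ^ 2 + b * (p.2.1 * p.1) + c * p.1 ^ 2)))
      - (f q - (q.2.2 + k - (a * q.2.1 ^ 2 + b * (q.2.1 * q.1) + c * q.1 ^ 2)))|
      ≤ C * (τ ^ 3 * (|p.1 - q.1| + |p.2.1 - q.2.1|) + τ ^ 4 * |p.2.2 - q.2.2|)
  smooth : ∀ p, ‖p‖ < e → ContDiffAt ℝ ω f p

/-- The remainder is the quadratic form with coefficients `J(x) - J(0)` and `x = O(τ²)`. Differences
in `(σ, s)` get `36 C²` from the change of `x` and `36 C²` from the coefficients; differences in `w`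
get `36 C³`. -/
theorem SmallFamily.redFun {Z : Type*} [NormedAddCommGroup Z] [NormedSpace ℝ Z] [CompleteSpace Z]
    {M₁ M₂ M₃ : Z → Z} {M₄ : Z →L[ℝ] Z} {C e : ℝ} (H : SmallFamily M₁ M₂ M₃ M₄ C e)
    {J₁ J₂ J₃ : Z → ℝ} (h₁ : BoundedLip C J₁) (h₂ : BoundedLip C J₂) (h₃ : BoundedLip C J₃)
    (s₁ : ContDiff ℝ ω J₁) (s₂ : ContDiff ℝ ω J₂) (s₃ : ContDiff ℝ ω J₃) (k : ℝ) :
    RedFun (J₁ 0) (J₂ 0) (J₃ 0) k (72 * C ^ 2 + 36 * C ^ 3) e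
      (fun p => p.2.2 + k - quadForm J₁ J₂ J₃ p (H.sol p)) where
  zero := fun w hw => by simp [quadForm]
  lip := by
    intro p q τ hp hq hp1 hp2 hq1 hq2
    have hC := H.h₁.nonneg
    have hτ : 0 ≤ τ := (abs_nonneg _).trans hp1
    set x := H.sol p
    set y := H.sol q
    have hx : ‖x‖ ≤ 1 := (H.sol_spec hp.le).1
    have hy : ‖y‖ ≤ 1 := (H.sol_spec hq.le).1
    set Δ := |p.1 - q.1| + |p.2.1 - q.2.1| with hΔ
    have hΔ0 : 0 ≤ Δ := by positivity
    have a1 := norm_quadForm_sub_le h₁ h₂ h₃ hp1 hp2 hx hy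
    have a2 := H.norm_sol_sub_le hp.le hq.le hp1 hp2 hq1 hq2
    have a3 := H.norm_sol_le hq.le hq1 hq2
    obtain ⟨c1, c2, c3⟩ := abs_coeff_sub_le hp1 hp2 hq1 hq2
    have hJ : ∀ J : Z → ℝ, BoundedLip C J → ‖J y - J 0‖ ≤ C * (6 * C * τ ^ 2) := fun J hJ =>
      ((hJ y hy).2 0 (by simp)).trans (by rw [sub_zero]; exact mul_le_mul_of_nonneg_left a3 hC)
    have a4 := norm_comb_le c1 c2 c3 (hJ _ h₁) (hJ _ h₂) (hJ _ h₃)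
    have e : ((p.2.2 + k - quadForm J₁ J₂ J₃ p x)
          - (p.2.2 + k - (J₁ 0 * p.2.1 ^ 2 + J₂ 0 * (p.2.1 * p.1) + J₃ 0 * p.1 ^ 2)))
        - ((q.2.2 + k - quadForm J₁ J₂ J₃ q y)
          - (q.2.2 + k - (J₁ 0 * q.2.1 ^ 2 + J₂ 0 * (q.2.1 * q.1) + J₃ 0 * q.1 ^ 2)))
        = -((quadForm J₁ J₂ J₃ p x - quadForm J₁ J₂ J₃ p y)
          + ((p.2.1 ^ 2 - q.2.1 ^ 2) • (J₁ y - J₁ 0) + (p.2.1 * p.1 - q.2.1 * q.1) • (J₂ y - J₂ 0)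
            + (p.1 ^ 2 - q.1 ^ 2) • (J₃ y - J₃ 0))) := by
      simp only [quadForm, smul_eq_mul]; ring
    rw [e, ← Real.norm_eq_abs, norm_neg]
    refine (norm_add_le _ _).trans ((add_le_add a1 a4).trans ?_)
    have a5 := mul_le_mul_of_nonneg_left a2 (by positivity : 0 ≤ 3 * τ ^ 2 * C)
    have w0 : 0 ≤ |p.2.2 - q.2.2| := abs_nonneg _
    have t1 : 0 ≤ C ^ 3 * τ ^ 3 * Δ := by positivity
    have t2 : 0 ≤ C ^ 2 * τ ^ 4 * |p.2.2 - q.2.2| := by positivity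
    nlinarith
  smooth := fun p hp => by
    have h := H.contDiffAt_sol hp
    have a1 : ContDiffAt ℝ ω (fun p => J₁ (H.sol p)) p := s₁.contDiffAt.comp p h
    have a2 : ContDiffAt ℝ ω (fun p => J₂ (H.sol p)) p := s₂.contDiffAt.comp p h
    have a3 : ContDiffAt ℝ ω (fun p => J₃ (H.sol p)) p := s₃.contDiffAt.comp p h
    simp only [quadForm, smul_eq_mul]
    fun_prop

/-- The data of the two reduced equations. -/
structure RedPair (a₀ M C e A B D E d : ℝ) (f g : ℝ × ℝ × ℝ → ℝ) : Prop where
  hf : RedFun A (10 * B) (5 * D) 0 C e f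
  hg : RedFun (5 * B) (10 * D) E d C e g
  hA : |A| ≤ M
  hB : |B| ≤ M
  hD : |D| ≤ M
  ha : 0 < a₀
  h1 : a₀ < 5 * B - A
  h2 : a₀ < 5 * B ^ 2 - A * D
  hC : 0 ≤ C

theorem norm_triple_lt {x y z e : ℝ} : ‖((x, y, z) : ℝ × ℝ × ℝ)‖ < e ↔ |x| < e ∧ |y| < e ∧ |z| < e := by
  simp [Prod.norm_def]

namespace RedPair

variable {a₀ M C e A B D E d : ℝ} {f g : ℝ × ℝ × ℝ → ℝ}

/-- On the zero set of `f` at `σ = 0` one has `w ≈ A s²`; the dependence of the remainder on `w` is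
absorbed by `2 C τ⁴ ≤ 1`. -/
theorem lipW (H : RedPair a₀ M C e A B D E d f g) {τ s s' w w' : ℝ} (hτ1 : τ ≤ 1)
    (hCτ : 2 * (C * τ ^ 4) ≤ 1) (hs : 0 ≤ s) (hsτ : s ≤ τ) (hs' : 0 ≤ s') (hsτ' : s' ≤ τ)
    (hτe : τ < e) (hw : |w| < e) (hw' : |w'| < e) (h0 : f (0, s, w) = 0) (h0' : f (0, s', w') = 0) :
    |w - w'| ≤ 2 * (2 * M + C) * τ * |s - s'| := by
  have hC := H.hC
  have hM : 0 ≤ M := (abs_nonneg _).trans H.hA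
  have hτ : 0 ≤ τ := hs.trans hsτ
  have a := H.hf.lip (0, s, w) (0, s', w') τ
    (norm_triple_lt.2 ⟨by simpa using hτ.trans_lt hτe, by rw [abs_of_nonneg hs]; linarith, hw⟩)
    (norm_triple_lt.2 ⟨by simpa using hτ.trans_lt hτe, by rw [abs_of_nonneg hs']; linarith, hw'⟩)
    (by simpa using hτ) (by simpa [abs_of_nonneg hs]) (by simpa using hτ)
    (by simpa [abs_of_nonneg hs'])
  simp only [h0, h0', sub_self, abs_zero, zero_add] at a
  have e1 : w - w' = A * (s ^ 2 - s' ^ 2)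
      - ((0 - (w + 0 - (A * s ^ 2 + 10 * B * (s * 0) + 5 * D * 0 ^ 2)))
      - (0 - (w' + 0 - (A * s' ^ 2 + 10 * B * (s' * 0) + 5 * D * 0 ^ 2)))) * (-1) * (-1) := by ring
  have e2 : |A * (s ^ 2 - s' ^ 2)| ≤ M * (2 * τ * |s - s'|) := by
    have : s ^ 2 - s' ^ 2 = (s + s') * (s - s') := by ring
    rw [abs_mul, this, abs_mul, abs_of_nonneg (by linarith : 0 ≤ s + s')]
    exact mul_le_mul H.hA (mul_le_mul_of_nonneg_right (by linarith) (abs_nonneg _))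
      (by positivity) hM
  have e3 : |w - w'| ≤ M * (2 * τ * |s - s'|)
      + C * (τ ^ 3 * |s - s'| + τ ^ 4 * |w - w'|) := by
    have : w - w' = A * (s ^ 2 - s' ^ 2)
      + ((0 - (w + 0 - (A * s ^ 2 + 10 * B * (s * 0) + 5 * D * 0 ^ 2)))
      - (0 - (w' + 0 - (A * s' ^ 2 + 10 * B * (s' * 0) + 5 * D * 0 ^ 2)))) * (-1) := by ring
    rw [this]
    refine (abs_add_le _ _).trans (add_le_add e2 ?_)
    rw [abs_mul]
    simp only [abs_neg, abs_one, mul_one]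
    rw [← this]
    exact a
  have e4 := mul_le_mul_of_nonneg_right hCτ (abs_nonneg (w - w'))
  have e5 : C * (τ ^ 3 * |s - s'|) ≤ C * (τ * |s - s'|) := by
    refine mul_le_mul_of_nonneg_left (mul_le_mul_of_nonneg_right ?_ (abs_nonneg _)) hC
    exact pow_le_of_le_one hτ hτ1 three_ne_zero
  linarith

/-- Subtracting the two equations eliminates `w` and leaves `(5B - A)(s² - s'²)` against a remainder
of size `τ³ |s - s'|`. For positive `s`, `s'` the left side is at least `a₀ τ |s - s'|` with `τ =
max s s'`, which wins for small `τ`. -/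
theorem unique (H : RedPair a₀ M C e A B D E d f g) {t s s' w w' : ℝ} (ht1 : t ≤ 1)
    (hte : t ≤ e) (hCt : 2 * (C * t ^ 4) ≤ 1) (hts : 2 * C * (1 + 2 * (2 * M + C)) * t ^ 2 < a₀)
    (hs : 0 < s) (hst : s < t) (hs' : 0 < s') (hst' : s' < t)
    (hw : |w| < e) (hw' : |w'| < e) (hf0 : f (0, s, w) = 0) (hf0' : f (0, s', w') = 0)
    (hg0 : g (0, s, w) = 0) (hg0' : g (0, s', w') = 0) : s = s' ∧ w = w' := by
  have hC := H.hC
  have hM : 0 ≤ M := (abs_nonneg _).trans H.hA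
  set τ := max s s' with hτd
  have hτ : 0 < τ := lt_max_of_lt_left hs
  have hτt : τ < t := max_lt hst hst'
  have hCτ : 2 * (C * τ ^ 4) ≤ 1 := by
    have : τ ^ 4 ≤ t ^ 4 := pow_le_pow_left₀ hτ.le hτt.le 4
    nlinarith
  have hl := H.lipW (hτt.le.trans ht1) hCτ hs.le (le_max_left _ _) hs'.le (le_max_right _ _)
    (hτt.trans_le hte) hw hw' hf0 hf0'
  suffices hss : s = s' by
    refine ⟨hss, ?_⟩
    rw [hss, sub_self, abs_zero, mul_zero] at hl
    exact sub_eq_zero.1 (abs_nonpos_iff.1 hl)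
  by_contra hne
  have hΔ : 0 < |s - s'| := abs_pos.2 (sub_ne_zero.2 hne)
  have hp : ∀ z, 0 < z → z ≤ τ → ∀ y, |y| < e → ‖((0, z, y) : ℝ × ℝ × ℝ)‖ < e := fun z hz hzτ y hy =>
    norm_triple_lt.2 ⟨by simpa using hτ.trans (hτt.trans_le hte),
      by rw [abs_of_pos hz]; linarith, hy⟩
  have af := H.hf.lip (0, s, w) (0, s', w') τ (hp s hs (le_max_left _ _) w hw)
    (hp s' hs' (le_max_right _ _) w' hw') (by simpa using hτ.le)
    (by show |s| ≤ τ; rw [abs_of_pos hs]; exact le_max_left _ _) (by simpa using hτ.le)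
    (by show |s'| ≤ τ; rw [abs_of_pos hs']; exact le_max_right _ _)
  have ag := H.hg.lip (0, s, w) (0, s', w') τ (hp s hs (le_max_left _ _) w hw)
    (hp s' hs' (le_max_right _ _) w' hw') (by simpa using hτ.le)
    (by show |s| ≤ τ; rw [abs_of_pos hs]; exact le_max_left _ _) (by simpa using hτ.le)
    (by show |s'| ≤ τ; rw [abs_of_pos hs']; exact le_max_right _ _)
  simp only [hf0, hf0', hg0, hg0', sub_self, abs_zero, zero_add] at af ag
  have hsq : τ * |s - s'| ≤ |s ^ 2 - s' ^ 2| := by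
    have : s ^ 2 - s' ^ 2 = (s + s') * (s - s') := by ring
    rw [this, abs_mul, abs_of_pos (by linarith : 0 < s + s')]
    exact mul_le_mul_of_nonneg_right (max_le (by linarith) (by linarith)) (abs_nonneg _)
  have key : (5 * B - A) * |s ^ 2 - s' ^ 2|
      ≤ 2 * (C * (τ ^ 3 * |s - s'| + τ ^ 4 * |w - w'|)) := by
    rw [← abs_of_pos (H.ha.trans H.h1), ← abs_mul]
    refine le_trans (le_of_eq ?_) ((abs_sub _ _).trans
      ((add_le_add ag af).trans (le_of_eq (two_mul _).symm)))
    congr 1; ring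
  have k1 : a₀ * (τ * |s - s'|) ≤ (5 * B - A) * |s ^ 2 - s' ^ 2| :=
    mul_le_mul H.h1.le hsq (by positivity) (H.ha.trans H.h1).le
  have k2 : τ ^ 4 * |w - w'| ≤ 2 * (2 * M + C) * (τ ^ 3 * |s - s'|) := by
    refine (mul_le_mul_of_nonneg_left hl (by positivity)).trans ?_
    have h5 : τ ^ 5 ≤ τ ^ 3 := pow_le_pow_of_le_one hτ.le (hτt.le.trans ht1) (by norm_num)
    have : 0 ≤ 2 * (2 * M + C) * |s - s'| := by positivity
    have := mul_le_mul_of_nonneg_right h5 this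
    linarith
  have k3 := mul_le_mul_of_nonneg_left k2 hC
  have k4 : a₀ * (τ * |s - s'|) ≤ (2 * C * (1 + 2 * (2 * M + C)) * τ ^ 2) * (τ * |s - s'|) := by
    linarith
  have k5 := le_of_mul_le_mul_right k4 (by positivity)
  have k6 : τ ^ 2 ≤ t ^ 2 := pow_le_pow_left₀ hτ.le hτt.le 2
  have k7 := mul_le_mul_of_nonneg_left k6 (by positivity : 0 ≤ 2 * C * (1 + 2 * (2 * M + C)))
  linarith

/-- Two intermediate value arguments. In `w` with `s` fixed, `f = 0` has a root `W s`, continuous by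
`lipW`. Then `g(0, s, W s)` equals `d > 0` at `s = 0` and is about `d - (5B - A) t²` at `s = t`,
negative because `d < a₀ t² / 2` and the remainders are at most `a₀ t² / 2`. -/
theorem exists_zero (H : RedPair a₀ M C e A B D E d f g) {t : ℝ} {b : ℝ} (ht : 0 < t) (ht1 : t ≤ 1)
    (hte : t < e) (hCt : 2 * (C * t ^ 4) ≤ 1) (hb : (M + C) * t ^ 2 < b) (hbe : b < e)
    (hts : 4 * C * t ^ 2 ≤ a₀) (hd : 0 < d) (hdt : d < a₀ * t ^ 2 / 2) :
    ∃ s w, 0 < s ∧ s ≤ t ∧ |w| ≤ b ∧ f (0, s, w) = 0 ∧ g (0, s, w) = 0 := by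
  have hC := H.hC
  have hM : 0 ≤ M := (abs_nonneg _).trans H.hA
  have hb0 : 0 < b := lt_of_le_of_lt (by positivity) hb
  have he : 0 < e := ht.trans hte
  have hmem : ∀ s ∈ Icc 0 t, ∀ w, |w| ≤ b → ‖((0, s, w) : ℝ × ℝ × ℝ)‖ < e := fun s hs w hw =>
    norm_triple_lt.2 ⟨by simpa using he, by rw [abs_of_nonneg hs.1]; linarith [hs.2], by linarith⟩
  have hrem : ∀ {a' b' c' k : ℝ} {F : ℝ × ℝ × ℝ → ℝ}, RedFun a' b' c' k C e F →
      ∀ s ∈ Icc 0 t, ∀ w, |w| ≤ b → |F (0, s, w) - (w + k - a' * s ^ 2)| ≤ C * s ^ 4 := by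
    intro a' b' c' k F hF s hs w hw
    have := hF.lip (0, s, w) (0, 0, w) s (hmem s hs w hw) (hmem 0 ⟨le_rfl, ht.le⟩ w hw)
      (by simpa using hs.1) (by simp [abs_of_nonneg hs.1]) (by simpa using hs.1)
      (by simpa using hs.1)
    rw [hF.zero w (lt_of_le_of_lt hw hbe)] at this
    simp only [sub_self, abs_zero, zero_add, sub_zero, mul_zero, add_zero, abs_of_nonneg hs.1,
      ne_eq, OfNat.ofNat_ne_zero, not_false_eq_true, zero_pow] at this
    refine this.trans (le_of_eq ?_)
    ring
  have hW : ∀ s ∈ Icc 0 t, ∃ w, |w| ≤ b ∧ f (0, s, w) = 0 := by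
    intro s hs
    have hcont : ContinuousOn (fun w => f (0, s, w)) (Icc (-b) b) := by
      intro w hw
      have h1 : ContinuousAt f (0, s, w) :=
        (H.hf.smooth _ (hmem s hs w (abs_le.2 hw))).continuousAt
      exact (ContinuousAt.comp (f := fun w : ℝ => ((0, s, w) : ℝ × ℝ × ℝ)) h1
        (by fun_prop)).continuousWithinAt
    have hs2 : s ^ 2 ≤ t ^ 2 := pow_le_pow_left₀ hs.1 hs.2 2
    have hs4 : s ^ 4 ≤ t ^ 2 := by
      refine (pow_le_pow_left₀ hs.1 hs.2 4).trans (pow_le_pow_of_le_one ht.le ht1 (by norm_num))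
    have hAs : |A * s ^ 2| ≤ M * t ^ 2 := by
      rw [abs_mul, abs_of_nonneg (sq_nonneg s)]
      exact mul_le_mul H.hA hs2 (sq_nonneg _) hM
    have hCs := mul_le_mul_of_nonneg_left hs4 hC
    have hsm := abs_le.1 hAs
    have r1 := abs_le.1 (hrem H.hf s hs b (abs_of_pos hb0).le)
    have r2 := abs_le.1 (hrem H.hf s hs (-b) (by rw [abs_neg, abs_of_pos hb0]))
    obtain ⟨w, hw, hw0⟩ := intermediate_value_Icc (by linarith : -b ≤ b) hcont
      (show (0 : ℝ) ∈ Icc (f (0, s, -b)) (f (0, s, b)) from ⟨by linarith [r2.2], by linarith [r1.1]⟩)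
    exact ⟨w, abs_le.2 hw, hw0⟩
  choose! W hWb hW0 using hW
  have hWc : ContinuousOn W (Icc 0 t) := by
    have : LipschitzOnWith (2 * (2 * M + C) * t).toNNReal W (Icc 0 t) := by
      refine LipschitzOnWith.of_dist_le_mul fun s hs s' hs' => ?_
      rw [Real.coe_toNNReal _ (by positivity), Real.dist_eq, Real.dist_eq]
      exact H.lipW ht1 hCt hs.1 hs.2 hs'.1 hs'.2 hte ((hWb s hs).trans_lt hbe)
        ((hWb s' hs').trans_lt hbe) (hW0 s hs) (hW0 s' hs')
    exact this.continuousOn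
  have hkc : ContinuousOn (fun s => g (0, s, W s)) (Icc 0 t) := by
    intro s hs
    have h1 : ContinuousAt g (0, s, W s) := (H.hg.smooth _ (hmem s hs _ (hWb s hs))).continuousAt
    exact ContinuousAt.comp_continuousWithinAt (f := fun s : ℝ => ((0, s, W s) : ℝ × ℝ × ℝ)) h1
      (continuousWithinAt_const.prodMk (continuousWithinAt_id.prodMk (hWc s hs)))
  have h0mem : (0 : ℝ) ∈ Icc 0 t := ⟨le_rfl, ht.le⟩
  have htmem : t ∈ Icc 0 t := ⟨ht.le, le_rfl⟩
  have hk0 : g (0, 0, W 0) = d := by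
    have h1 := hW0 0 h0mem
    rw [H.hf.zero _ ((hWb 0 h0mem).trans_lt hbe), add_zero] at h1
    rw [H.hg.zero _ ((hWb 0 h0mem).trans_lt hbe), h1, zero_add]
  have hkt : g (0, t, W t) < 0 := by
    have r1 := abs_le.1 (hrem H.hf t htmem _ (hWb t htmem))
    have r2 := abs_le.1 (hrem H.hg t htmem _ (hWb t htmem))
    rw [hW0 t htmem] at r1
    have h3 := mul_le_mul_of_nonneg_right hts (sq_nonneg t)
    have h4 := mul_lt_mul_of_pos_right H.h1 (by positivity : 0 < t ^ 2)
    nlinarith [r1.1, r2.2]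
  obtain ⟨s, hs, hs0⟩ := intermediate_value_Icc' ht.le hkc
    (show (0 : ℝ) ∈ Icc (g (0, t, W t)) (g (0, 0, W 0)) from ⟨hkt.le, by rw [hk0]; exact hd.le⟩)
  refine ⟨s, W s, lt_of_le_of_ne hs.1 ?_, hs.2, hWb s hs, hW0 s hs, hs0⟩
  rintro rfl
  simp only [hk0] at hs0
  exact hd.ne' hs0

end RedPair
end QuinticNLS

namespace QuinticNLS
open Set Filter
open scoped ContDiff

/-! ### The branch of zeros of the reduced equations -/

/-- A derivative inherits the Lipschitz bound of the remainder. Near `(0, s, w)` both relevant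
coordinates are below `τ = 2 s`, whence `8 s³` and `16 s⁴`. -/
theorem RedFun.fderiv_bound {a b c k C e : ℝ} {f : ℝ × ℝ × ℝ → ℝ} (H : RedFun a b c k C e f)
    (hC : 0 ≤ C) {s w : ℝ} (hs : 0 < s) (hse : s < e) (hw : |w| < e) (v : ℝ × ℝ × ℝ) :
    |fderiv ℝ f (0, s, w) v - (v.2.2 - (2 * a * s * v.2.1 + b * s * v.1))|
      ≤ C * (8 * s ^ 3 * (|v.1| + |v.2.1|) + 16 * s ^ 4 * |v.2.2|) := by
  set p : ℝ × ℝ × ℝ := (0, s, w) with hp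
  have hpe : ‖p‖ < e := norm_triple_lt.2 ⟨by simpa using hs.trans hse, by rwa [abs_of_pos hs], hw⟩
  have hd : HasFDerivAt f (fderiv ℝ f p) p :=
    ((H.smooth p hpe).differentiableAt (by simp)).hasFDerivAt
  have h1 : HasDerivAt (fun t : ℝ => f (p + t • v)) (fderiv ℝ f p v) 0 := hd.hasLineDerivAt v
  have h2 : HasDerivAt (fun t : ℝ => (w + t * v.2.2) + k - (a * (s + t * v.2.1) ^ 2
      + b * ((s + t * v.2.1) * (t * v.1)) + c * (t * v.1) ^ 2))
      (v.2.2 - (2 * a * s * v.2.1 + b * s * v.1)) 0 := by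
    have e1 : HasDerivAt (fun t : ℝ => t * v.1) v.1 0 := by
      simpa using (hasDerivAt_id (0 : ℝ)).mul_const v.1
    have e2 : HasDerivAt (fun t : ℝ => s + t * v.2.1) v.2.1 0 := by
      simpa using ((hasDerivAt_id (0 : ℝ)).mul_const v.2.1).const_add s
    have e3 : HasDerivAt (fun t : ℝ => w + t * v.2.2 + k) v.2.2 0 := by
      simpa using (((hasDerivAt_id (0 : ℝ)).mul_const v.2.2).const_add w).add_const k
    refine (e3.sub ((((e2.pow 2).const_mul a).add ((e2.mul e1).const_mul b)).add
      ((e1.pow 2).const_mul c))).congr_deriv ?_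
    simp; ring
  have h3 := h1.sub h2
  rw [← Real.norm_eq_abs]
  refine h3.le_of_lip' (by positivity) ?_
  have hcont : Continuous fun t : ℝ => p + t • v := by fun_prop
  have hev1 : ∀ᶠ t : ℝ in 𝓝 0, ‖p + t • v‖ < e :=
    (hcont.norm.tendsto 0).eventually_lt_const (by simpa using hpe)
  have hev2 : ∀ᶠ t : ℝ in 𝓝 0, |(p + t • v).1| < 2 * s :=
    ((continuous_fst.comp hcont).abs.tendsto 0).eventually_lt_const (by simpa [hp] using hs)
  have hev3 : ∀ᶠ t : ℝ in 𝓝 0, |(p + t • v).2.1| < 2 * s :=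
    (((continuous_fst.comp continuous_snd).comp hcont).abs.tendsto 0).eventually_lt_const
      (by simp [hp, abs_of_pos hs]; linarith)
  filter_upwards [hev1, hev2, hev3] with t t1 t2 t3
  have := H.lip (p + t • v) p (2 * s) t1 hpe t2.le t3.le (by simpa [hp] using hs.le)
    (by show |s| ≤ 2 * s; rw [abs_of_pos hs]; linarith)
  simp only [hp, Prod.fst_add, Prod.snd_add, Prod.smul_fst, Prod.smul_snd, smul_eq_mul, zero_add,
    sub_zero, add_sub_cancel_left, abs_mul, mul_zero, add_zero] at this
  simp only [Real.norm_eq_abs, Pi.sub_apply, zero_mul, add_zero, mul_zero, zero_smul, sub_zero]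
  refine le_trans (le_of_eq ?_) (this.trans (le_of_eq ?_))
  · simp [hp]
  · ring

theorem abs_mul_le_mul {x y X Y : ℝ} (hx : |x| ≤ X) (hy : |y| ≤ Y) : |x * y| ≤ X * Y := by
  rw [abs_mul]; exact mul_le_mul hx hy (abs_nonneg _) ((abs_nonneg _).trans hx)

set_option maxHeartbeats 1000000 in
/-- Linear algebra at the bifurcation point, after scaling out `s`. -/
theorem branch_algebra {a₀ M q A B D s a₁ a₂ a₃ b₁ b₂ b₃ S W : ℝ} (ha : 0 < a₀) (hq1 : q ≤ 1)
    (hqa : q * (32 * M + 6) ≤ a₀) (hA : |A| ≤ M) (hB : |B| ≤ M) (hD : |D| ≤ M)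
    (h1 : a₀ < 5 * B - A) (h2 : a₀ < 5 * B ^ 2 - A * D) (hs : 0 < s)
    (ha₁ : |a₁| ≤ q) (ha₂ : |a₂| ≤ q) (ha₃ : |a₃| ≤ q)
    (hb₁ : |b₁| ≤ q) (hb₂ : |b₂| ≤ q) (hb₃ : |b₃| ≤ q) :
    0 < s * (-2 * A + a₁) * (1 + b₃) - (1 + a₃) * (s * (-10 * B + b₁)) ∧
    (s * (-2 * A + a₁) * S + (1 + a₃) * W = -(s * (-10 * B + a₂)) →
      s * (-10 * B + b₁) * S + (1 + b₃) * W = -(s * (-10 * D + b₂)) →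
      |S - 5 * (B - D) / (5 * B - A)| ≤ q * ((4 + 20 * M) * (1 + 10 * M / a₀) / a₀) ∧
      |W - 10 * s * ((5 * B ^ 2 - A * D) / (5 * B - A))|
        ≤ s * q * ((32 * M + 2 + (4 + 12 * M) * (60 * M ^ 2 / a₀)) / a₀) ∧ 0 < W) := by
  have hq : 0 ≤ q := (abs_nonneg _).trans ha₁
  have hM : 0 ≤ M := (abs_nonneg _).trans hA
  set P := 5 * B - A with hP
  set Q := 5 * B ^ 2 - A * D with hQ
  have hP0 : 0 < P := ha.trans h1
  have bq : ∀ {x y : ℝ}, |x| ≤ q → |y| ≤ q → |x * y| ≤ q := fun hx hy =>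
    (abs_mul_le_mul hx hy).trans (by nlinarith)
  -- The `θ`s collect the errors in Cramer's rule: the determinant is `s (2P + θ₁)`, and the
  -- numerators, freed of the common factor `s`, are `10 (B - D) + θ₂` and `s (20 Q + θ₃)`.
  set θ₁ := a₁ - 2 * A * b₃ + a₁ * b₃ - b₁ + 10 * B * a₃ - a₃ * b₁ with hθ₁
  set θ₂ := -a₂ + 10 * B * b₃ - a₂ * b₃ + b₂ - 10 * D * a₃ + a₃ * b₂ with hθ₂
  set θ₃ := 2 * A * b₂ + 10 * D * a₁ - a₁ * b₂ - 10 * B * b₁ - 10 * B * a₂ + a₂ * b₁ with hθ₃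
  have t1 : |θ₁| ≤ q * (4 + 12 * M) := by
    have c1 := abs_le.1 ha₁; have c2 := abs_le.1 hb₁
    have c3 := abs_le.1 (abs_mul_le_mul hA hb₃); have c4 := abs_le.1 (abs_mul_le_mul hB ha₃)
    have c5 := abs_le.1 (bq ha₁ hb₃); have c6 := abs_le.1 (bq ha₃ hb₁)
    rw [hθ₁, abs_le]; clear * - c1 c2 c3 c4 c5 c6; constructor <;> linarith
  have t2 : |θ₂| ≤ q * (4 + 20 * M) := by
    have c1 := abs_le.1 ha₂; have c2 := abs_le.1 hb₂
    have c3 := abs_le.1 (abs_mul_le_mul hB hb₃); have c4 := abs_le.1 (abs_mul_le_mul hD ha₃)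
    have c5 := abs_le.1 (bq ha₂ hb₃); have c6 := abs_le.1 (bq ha₃ hb₂)
    rw [hθ₂, abs_le]; clear * - c1 c2 c3 c4 c5 c6; constructor <;> linarith
  have t3 : |θ₃| ≤ q * (32 * M + 2) := by
    have c1 := abs_le.1 (abs_mul_le_mul hA hb₂); have c2 := abs_le.1 (abs_mul_le_mul hD ha₁)
    have c3 := abs_le.1 (abs_mul_le_mul hB hb₁); have c4 := abs_le.1 (abs_mul_le_mul hB ha₂)
    have c5 := abs_le.1 (bq ha₁ hb₂); have c6 := abs_le.1 (bq ha₂ hb₁)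
    rw [hθ₃, abs_le]; clear * - c1 c2 c3 c4 c5 c6; constructor <;> linarith
  have hqM : 0 ≤ q * M := mul_nonneg hq hM
  have hdet : a₀ ≤ 2 * P + θ₁ := by
    have := (abs_le.1 t1).1
    linarith
  refine ⟨?_, fun E1 E2 => ?_⟩
  · have : s * (-2 * A + a₁) * (1 + b₃) - (1 + a₃) * (s * (-10 * B + b₁)) = s * (2 * P + θ₁) := by
      rw [hP, hθ₁]; ring
    rw [this]; exact mul_pos hs (ha.trans_le hdet)
  · have hS : S * (2 * P + θ₁) = 10 * (B - D) + θ₂ := by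
      have : s * (S * (2 * P + θ₁)) = s * (10 * (B - D) + θ₂) := by
        rw [hP, hθ₁, hθ₂]; linear_combination (1 + b₃) * E1 - (1 + a₃) * E2
      exact mul_left_cancel₀ hs.ne' this
    have hW : W * (2 * P + θ₁) = s * (20 * Q + θ₃) := by
      have : s * (W * (2 * P + θ₁)) = s * (s * (20 * Q + θ₃)) := by
        rw [hP, hθ₁, hQ, hθ₃]
        linear_combination s * (-2 * A + a₁) * E2 - s * (-10 * B + b₁) * E1
      exact mul_left_cancel₀ hs.ne' this
    have hpos : 0 < 2 * P + θ₁ := ha.trans_le hdet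
    have final : ∀ {x N : ℝ}, |x * (2 * P + θ₁)| ≤ N → |x| ≤ N / a₀ := by
      intro x N h
      rw [le_div_iff₀ ha]
      rw [abs_mul, abs_of_pos hpos] at h
      exact (mul_le_mul_of_nonneg_left hdet (abs_nonneg _)).trans h
    have hBD : |5 * (B - D) / P| ≤ 10 * M / a₀ := by
      rw [abs_div, abs_of_pos hP0]
      refine div_le_div₀ (by positivity) ?_ ha h1.le
      have c1 := abs_le.1 hB; have c2 := abs_le.1 hD
      rw [abs_le]; constructor <;> linarith [c1.1, c1.2, c2.1, c2.2]
    have hQP : |10 * (Q / P)| ≤ 60 * M ^ 2 / a₀ := by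
      have : 10 * (Q / P) = (10 * Q) / P := by ring
      rw [this, abs_div, abs_of_pos hP0]
      refine div_le_div₀ (by positivity) ?_ ha h1.le
      have c1 := abs_le.1 (abs_mul_le_mul hB hB); have c2 := abs_le.1 (abs_mul_le_mul hA hD)
      rw [hQ, abs_le]; constructor <;> linarith [c1.1, c1.2, c2.1, c2.2]
    refine ⟨?_, ?_, ?_⟩
    · rw [← mul_div_assoc]
      refine final ?_
      have : (S - 5 * (B - D) / P) * (2 * P + θ₁) = θ₂ - θ₁ * (5 * (B - D) / P) := by
        rw [sub_mul, hS]; field_simp; ring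
      rw [this]
      have c := abs_mul_le_mul t1 hBD
      have : 0 ≤ 10 * M / a₀ := by positivity
      have : 0 ≤ q * (8 * M) * (10 * M / a₀) := by positivity
      refine (abs_sub _ _).trans ((add_le_add t2 c).trans ?_)
      linarith
    · rw [← mul_div_assoc (s * q)]
      refine final ?_
      have : (W - 10 * s * (Q / P)) * (2 * P + θ₁) = s * (θ₃ - θ₁ * (10 * (Q / P))) := by
        rw [sub_mul, hW]; field_simp; ring
      rw [this, abs_mul, abs_of_pos hs, mul_assoc]
      refine mul_le_mul_of_nonneg_left ?_ hs.le
      have c := abs_mul_le_mul t1 hQP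
      refine (abs_sub _ _).trans ((add_le_add t3 c).trans (le_of_eq ?_))
      ring
    -- `Q > a₀` dominates, since `|θ₃| ≤ q (32 M + 2) ≤ a₀`.
    · have h5 : 0 < s * (20 * Q + θ₃) := by
        refine mul_pos hs ?_
        have := (abs_le.1 t3).1
        linarith
      rw [← hW] at h5
      exact (pos_iff_pos_of_mul_pos h5).2 hpos

namespace RedPair

variable {a₀ M C e A B D E d : ℝ} {f g : ℝ × ℝ × ℝ → ℝ}

/-- The implicit function theorem in `(s, w)` over `σ = 0`. Differentiating `f = g = 0` along the
branch gives a linear system for `(S', W')`, solved with error control by `branch_algebra`. -/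
theorem exists_branch (H : RedPair a₀ M C e A B D E d f g) {s w : ℝ} (hs : 0 < s) (hs1 : s ≤ 1)
    (hse : s < e) (hw : |w| < e) (hq1 : 16 * C * s ^ 2 ≤ 1)
    (hqa : 16 * C * s ^ 2 * (32 * M + 6) ≤ a₀) (hf0 : f (0, s, w) = 0) (hg0 : g (0, s, w) = 0) :
    (fderiv ℝ f (0, s, w) (0, 1, 0) * fderiv ℝ g (0, s, w) (0, 0, 1)
      - fderiv ℝ f (0, s, w) (0, 0, 1) * fderiv ℝ g (0, s, w) (0, 1, 0) ≠ 0) ∧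
    ∃ S W : ℝ → ℝ, ContDiffAt ℝ ω S 0 ∧ ContDiffAt ℝ ω W 0 ∧ S 0 = s ∧ W 0 = w ∧
      (∀ᶠ σ in 𝓝 0, f (σ, S σ, W σ) = 0 ∧ g (σ, S σ, W σ) = 0) ∧
      |deriv S 0 - 5 * (B - D) / (5 * B - A)|
        ≤ 16 * C * s ^ 2 * ((4 + 20 * M) * (1 + 10 * M / a₀) / a₀) ∧
      |deriv W 0 - 10 * s * ((5 * B ^ 2 - A * D) / (5 * B - A))|
        ≤ s * (16 * C * s ^ 2) * ((32 * M + 2 + (4 + 12 * M) * (60 * M ^ 2 / a₀)) / a₀) ∧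
      0 < deriv W 0 := by
  have hC := H.hC
  set p : ℝ × ℝ × ℝ := (0, s, w) with hp
  have hpe : ‖p‖ < e := norm_triple_lt.2 ⟨by simpa using hs.trans hse, by rwa [abs_of_pos hs], hw⟩
  set f' := fderiv ℝ f p
  set g' := fderiv ℝ g p
  set q := 16 * C * s ^ 2 with hq
  have hs2 : s ^ 4 ≤ s ^ 2 := pow_le_pow_of_le_one hs.le hs1 (by norm_num)
  have hCs : 0 ≤ C * s ^ 2 := by positivity
  -- scaled partial derivatives
  have scal : ∀ {x y : ℝ}, |x - s * y| ≤ C * (8 * s ^ 3) → ∃ z, |z| ≤ q ∧ x = s * (y + z) := by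
    intro x y h
    refine ⟨(x - s * y) / s, ?_, by field_simp; ring⟩
    rw [abs_div, abs_of_pos hs, div_le_iff₀ hs]
    refine h.trans ?_
    rw [hq]
    have : 0 ≤ C * s ^ 3 := by positivity
    nlinarith
  have scal' : ∀ {x : ℝ}, |x - 1| ≤ C * (16 * s ^ 4) → ∃ z, |z| ≤ q ∧ x = 1 + z := by
    intro x h
    refine ⟨x - 1, h.trans ?_, by ring⟩
    rw [hq]
    have := mul_le_mul_of_nonneg_left hs2 hC
    linarith
  obtain ⟨a₁, ha₁, ef1⟩ := scal (x := f' (0, 1, 0)) (y := -2 * A) (by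
    have := H.hf.fderiv_bound hC hs hse hw (0, 1, 0)
    simp only [abs_zero, abs_one, zero_add, mul_zero, add_zero, mul_one, zero_sub] at this
    convert this using 2; ring)
  obtain ⟨a₂, ha₂, ef2⟩ := scal (x := f' (1, 0, 0)) (y := -10 * B) (by
    have := H.hf.fderiv_bound hC hs hse hw (1, 0, 0)
    simp only [abs_zero, abs_one, zero_add, mul_zero, add_zero, mul_one, zero_sub] at this
    convert this using 2; ring)
  obtain ⟨a₃, ha₃, ef3⟩ := scal' (x := f' (0, 0, 1)) (by
    have := H.hf.fderiv_bound hC hs hse hw (0, 0, 1)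
    simpa only [abs_zero, abs_one, zero_add, mul_zero, add_zero, mul_one, sub_zero] using this)
  obtain ⟨b₁, hb₁, eg1⟩ := scal (x := g' (0, 1, 0)) (y := -10 * B) (by
    have := H.hg.fderiv_bound hC hs hse hw (0, 1, 0)
    simp only [abs_zero, abs_one, zero_add, mul_zero, add_zero, mul_one, zero_sub] at this
    convert this using 2; ring)
  obtain ⟨b₂, hb₂, eg2⟩ := scal (x := g' (1, 0, 0)) (y := -10 * D) (by
    have := H.hg.fderiv_bound hC hs hse hw (1, 0, 0)
    simp only [abs_zero, abs_one, zero_add, mul_zero, add_zero, mul_one, zero_sub] at this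
    convert this using 2; ring)
  obtain ⟨b₃, hb₃, eg3⟩ := scal' (x := g' (0, 0, 1)) (by
    have := H.hg.fderiv_bound hC hs hse hw (0, 0, 1)
    simpa only [abs_zero, abs_one, zero_add, mul_zero, add_zero, mul_one, sub_zero] using this)
  have alg := fun S W => branch_algebra (S := S) (W := W) H.ha hq1 hqa H.hA H.hB H.hD H.h1 H.h2 hs
    ha₁ ha₂ ha₃ hb₁ hb₂ hb₃
  have hdet : f' (0, 1, 0) * g' (0, 0, 1) - f' (0, 0, 1) * g' (0, 1, 0) ≠ 0 := by
    rw [ef1, ef3, eg1, eg3]; exact (alg 0 0).1.ne'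
  refine ⟨hdet, ?_⟩
  set Φ : ℝ × ℝ × ℝ → ℝ × ℝ := fun p => (f p, g p) with hΦ
  have hω : (ω : ℕ∞ω) ≠ 0 := by simp
  have hcd : ContDiffAt ℝ ω Φ p := (H.hf.smooth p hpe).prodMk (H.hg.smooth p hpe)
  have hfd : HasFDerivAt f f' p := ((H.hf.smooth p hpe).differentiableAt hω).hasFDerivAt
  have hgd : HasFDerivAt g g' p := ((H.hg.smooth p hpe).differentiableAt hω).hasFDerivAt
  have hΦd : fderiv ℝ Φ p = f'.prod g' := (hfd.prodMk hgd).fderiv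
  have dec : ∀ (L : ℝ × ℝ × ℝ →L[ℝ] ℝ) (x y z : ℝ),
      L (x, y, z) = x * L (1, 0, 0) + y * L (0, 1, 0) + z * L (0, 0, 1) := by
    intro L x y z
    rw [← smul_eq_mul, ← smul_eq_mul, ← smul_eq_mul, ← map_smul, ← map_smul, ← map_smul, ← map_add,
      ← map_add]
    simp
  have hinv : (fderiv ℝ Φ p ∘L .inr ℝ ℝ (ℝ × ℝ)).IsInvertible := by
    set L := fderiv ℝ Φ p ∘L .inr ℝ ℝ (ℝ × ℝ) with hL
    have hinj : Function.Injective L := by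
      rw [injective_iff_map_eq_zero]
      rintro ⟨y, z⟩ h
      have h' : (f' (0, y, z), g' (0, y, z)) = ((0, 0) : ℝ × ℝ) := by
        rw [hL, hΦd] at h; exact h
      rw [Prod.mk.injEq, dec f', dec g'] at h'
      obtain ⟨h1, h2⟩ := h'
      have hy : (f' (0, 1, 0) * g' (0, 0, 1) - f' (0, 0, 1) * g' (0, 1, 0)) * y = 0 := by
        linear_combination g' (0, 0, 1) * h1 - f' (0, 0, 1) * h2
      have hz : (f' (0, 1, 0) * g' (0, 0, 1) - f' (0, 0, 1) * g' (0, 1, 0)) * z = 0 := by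
        linear_combination f' (0, 1, 0) * h2 - g' (0, 1, 0) * h1
      rw [(mul_eq_zero.1 hy).resolve_left hdet, (mul_eq_zero.1 hz).resolve_left hdet]; rfl
    have hsurj : Function.Surjective L :=
      LinearMap.surjective_of_injective (f := (L : ℝ × ℝ →ₗ[ℝ] ℝ × ℝ)) hinj
    exact ⟨ContinuousLinearEquiv.ofBijective L (LinearMap.ker_eq_bot.2 hinj)
      (LinearMap.range_eq_top.2 hsurj), by ext <;> rfl⟩
  have hX := hcd.contDiffAt_implicitFunction hω hinv
  have hX0 : hcd.implicitFunction hω hinv 0 = (s, w) := hcd.implicitFunction_apply_self hω hinv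
  have hev := hcd.eventually_apply_implicitFunction hω hinv
  set X := hcd.implicitFunction hω hinv with hXd
  have hX' : ContDiffAt ℝ ω X 0 := hX
  have hS : ContDiffAt ℝ ω (fun σ => (X σ).1) 0 := contDiffAt_fst.comp 0 hX'
  have hW : ContDiffAt ℝ ω (fun σ => (X σ).2) 0 := contDiffAt_snd.comp 0 hX'
  have hev' : ∀ᶠ σ in 𝓝 0, f (σ, (X σ).1, (X σ).2) = 0 ∧ g (σ, (X σ).1, (X σ).2) = 0 := by
    filter_upwards [hev] with σ h
    have h2 : Φ p = (0, 0) := by simp [hΦ, hf0, hg0]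
    rw [h2] at h
    exact ⟨congrArg Prod.fst h, congrArg Prod.snd h⟩
  refine ⟨fun σ => (X σ).1, fun σ => (X σ).2, hS, hW, congrArg Prod.fst hX0,
    congrArg Prod.snd hX0, hev', ?_⟩
  have dS := (hS.differentiableAt hω).hasDerivAt
  have dW := (hW.differentiableAt hω).hasDerivAt
  set S' := deriv (fun σ => (X σ).1) 0
  set W' := deriv (fun σ => (X σ).2) 0
  have hcurve : HasDerivAt (fun σ : ℝ => (σ, (X σ).1, (X σ).2)) ((1, S', W') : ℝ × ℝ × ℝ) 0 :=
    (hasDerivAt_id 0).prodMk (dS.prodMk dW)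
  have hc0 : ((0, (X 0).1, (X 0).2) : ℝ × ℝ × ℝ) = p := by rw [hX0]
  have rel : ∀ (F : ℝ × ℝ × ℝ → ℝ) (F' : ℝ × ℝ × ℝ →L[ℝ] ℝ), HasFDerivAt F F' p →
      (∀ᶠ σ in 𝓝 0, F (σ, (X σ).1, (X σ).2) = 0) → F' (1, S', W') = 0 := by
    intro F F' hF hev
    have h1 : HasDerivAt (fun σ : ℝ => F (σ, (X σ).1, (X σ).2)) (F' (1, S', W')) 0 :=
      HasFDerivAt.comp_hasDerivAt (f := fun σ : ℝ => (σ, (X σ).1, (X σ).2)) 0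
        (by rw [hc0]; exact hF) hcurve
    have h2 : HasDerivAt (fun σ : ℝ => F (σ, (X σ).1, (X σ).2)) 0 0 :=
      (hasDerivAt_const (0 : ℝ) (0 : ℝ)).congr_of_eventuallyEq hev
    exact h1.unique h2
  have r1 := rel f f' hfd (hev'.mono fun _ h => h.1)
  have r2 := rel g g' hgd (hev'.mono fun _ h => h.2)
  rw [dec, ef1, ef2, ef3] at r1
  rw [dec, eg1, eg2, eg3] at r2
  exact (alg S' W').2 (by linarith) (by linarith)

end RedPair
end QuinticNLS

namespace QuinticNLS
open Set Filter
open scoped ENNReal InnerProductSpace BoundedContinuousFunction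

/-! ### The quintic nonlinearity on `L²` -/

variable {v : ℝ →ᵇ ℝ} {ω₀ ω₁ : ℝ} {g₀ g₁ : L2 ℝ}

/-- The orthogonal projection onto the complement of `T g₀` and `T g₁`. -/
def projC (g₀ g₁ : L2 ℝ) : L2 ℝ →L[ℝ] L2 ℝ :=
  ContinuousLinearMap.id ℝ _ - (innerSL ℝ (expOp ℝ g₀)).smulRight (expOp ℝ g₀)
    - (innerSL ℝ (expOp ℝ g₁)).smulRight (expOp ℝ g₁)

theorem projC_apply (g₀ g₁ f : L2 ℝ) : projC g₀ g₁ f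
    = f - ⟪expOp ℝ g₀, f⟫_ℝ • expOp ℝ g₀ - ⟪expOp ℝ g₁, f⟫_ℝ • expOp ℝ g₁ := by
  simp [projC]

namespace SpectralPair

theorem norm_projC_le (S : SpectralPair v ω₀ ω₁ g₀ g₁) (f : L2 ℝ) :
    ‖projC g₀ g₁ f‖ ≤ 3 * ‖f‖ := by
  rw [projC_apply]
  have h : ∀ {u : L2 ℝ}, ‖u‖ = 1 → ‖⟪u, f⟫_ℝ • u‖ ≤ ‖f‖ := fun {u} hu => by
    rw [norm_smul, hu, mul_one]
    simpa [hu] using norm_inner_le_norm (𝕜 := ℝ) u f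
  refine (norm_sub_le _ _).trans ?_
  have := norm_sub_le f (⟪expOp ℝ g₀, f⟫_ℝ • expOp ℝ g₀)
  have := h S.norm₀
  have := h S.norm₁
  linarith

theorem inner_projC₀ (S : SpectralPair v ω₀ ω₁ g₀ g₁) (f : L2 ℝ) :
    ⟪projC g₀ g₁ f, expOp ℝ g₀⟫_ℝ = 0 := by
  rw [projC_apply, inner_sub_left, inner_sub_left, inner_smul_left, inner_smul_left,
    real_inner_self_eq_norm_sq, S.norm₀, real_inner_comm (expOp ℝ g₀) (expOp ℝ g₁), S.orth,
    real_inner_comm]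
  simp

theorem inner_projC₁ (S : SpectralPair v ω₀ ω₁ g₀ g₁) (f : L2 ℝ) :
    ⟪projC g₀ g₁ f, expOp ℝ g₁⟫_ℝ = 0 := by
  rw [projC_apply, inner_sub_left, inner_sub_left, inner_smul_left, inner_smul_left,
    real_inner_self_eq_norm_sq, S.norm₁, S.orth, real_inner_comm]
  simp

theorem augOp_apply (v : ℝ →ᵇ ℝ) (ω₀ : ℝ) (g₀ g₁ g : L2 ℝ) : augOp v ω₀ g₀ g₁ g
    = formOp ℝ v (-ω₀) g + (⟪expOp ℝ g₀, expOp ℝ g⟫_ℝ • expOpAdj ℝ (expOp ℝ g₀)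
      + ⟪expOp ℝ g₁, expOp ℝ g⟫_ℝ • expOpAdj ℝ (expOp ℝ g₁)) := by
  rw [← rankOne_apply, ← rankOne_apply]; rfl

/-- Pairing with `g₀` and `g₁` annihilates the projected right side and leaves `(1 + w) ⟪ψ₀, T g⟫`
and `(ω₀ - ω₁ + 1 + w) ⟪ψ₁, T g⟫`, with nonzero factors. The augmented equation thus enforces
orthogonality by itself, and no constrained space is needed. -/
theorem augOp_eq_iff (S : SpectralPair v ω₀ ω₁ g₀ g₁) {w : ℝ} (hw : -1 < w) (g f : L2 ℝ) :
    augOp v ω₀ g₀ g₁ g + w • expOpAdj ℝ (expOp ℝ g) = expOpAdj ℝ (projC g₀ g₁ f) ↔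
      ⟪expOp ℝ g₀, expOp ℝ g⟫_ℝ = 0 ∧ ⟪expOp ℝ g₁, expOp ℝ g⟫_ℝ = 0 ∧
        formOp ℝ v (-(ω₀ + w)) g = expOpAdj ℝ (projC g₀ g₁ f) := by
  have hsub : formOp ℝ v (-(ω₀ + w)) g = formOp ℝ v (-ω₀) g + w • expOpAdj ℝ (expOp ℝ g) := by
    have := formOp_sub v (-(ω₀ + w)) (-ω₀) g
    rw [show -ω₀ - -(ω₀ + w) = w by ring] at this
    rw [← this]; abel
  have h01 := S.orth
  have h10 : ⟪expOp ℝ g₁, expOp ℝ g₀⟫_ℝ = 0 := by rw [real_inner_comm]; exact h01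
  have h00 : ⟪expOp ℝ g₀, expOp ℝ g₀⟫_ℝ = 1 := by rw [real_inner_self_eq_norm_sq, S.norm₀]; norm_num
  have h11 : ⟪expOp ℝ g₁, expOp ℝ g₁⟫_ℝ = 1 := by rw [real_inner_self_eq_norm_sq, S.norm₁]; norm_num
  constructor
  · intro h
    have e0 : ⟪expOp ℝ g₀, expOp ℝ g⟫_ℝ = 0 := by
      have := congrArg (fun k => ⟪k, g₀⟫_ℝ) h
      simp only [augOp_apply, inner_add_left, inner_smul_left, inner_expOpAdj, S.inner_projC₀,
        inner_formOp_eigen S.eq₀, h00, h10, conj_trivial] at this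
      rw [real_inner_comm (expOp ℝ g₀) (expOp ℝ g)] at this
      have h3 : (1 + w) * ⟪expOp ℝ g₀, expOp ℝ g⟫_ℝ = 0 := by linarith
      exact (mul_eq_zero.1 h3).resolve_left (by linarith)
    have e1 : ⟪expOp ℝ g₁, expOp ℝ g⟫_ℝ = 0 := by
      have := congrArg (fun k => ⟪k, g₁⟫_ℝ) h
      simp only [augOp_apply, inner_add_left, inner_smul_left, inner_expOpAdj, S.inner_projC₁,
        inner_formOp_eigen S.eq₁, h11, h01, conj_trivial] at this
      rw [real_inner_comm (expOp ℝ g₁) (expOp ℝ g)] at this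
      have h3 : (ω₀ - ω₁ + 1 + w) * ⟪expOp ℝ g₁, expOp ℝ g⟫_ℝ = 0 := by linarith
      exact (mul_eq_zero.1 h3).resolve_left (by linarith [S.lt])
    refine ⟨e0, e1, ?_⟩
    rw [augOp_apply, e0, e1, zero_smul, zero_smul, add_zero, add_zero] at h
    rw [hsub, h]
  · rintro ⟨e0, e1, h⟩
    rw [augOp_apply, e0, e1, zero_smul, zero_smul, add_zero, add_zero, ← hsub, h]

end SpectralPair

/-- `(T G)⁵`. -/
def quintic (G : L2 ℝ) : L2 ℝ := mulL (sobolevEmb ℝ G ^ 4) (expOp ℝ G)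

theorem coeFn_mulL_expOp (m : ℝ →ᵇ ℝ) (h : L2 ℝ) :
    mulL m (expOp ℝ h) =ᵐ[volume] fun x => m x * expAvg h x := by
  rw [mulL_apply]
  filter_upwards [coeFn_mulOp m (expOp ℝ h), coeFn_expOp h] with x h1 h2
  rw [h1, h2, smul_eq_mul]

theorem coeFn_quintic (G : L2 ℝ) : quintic G =ᵐ[volume] fun x => expAvg G x ^ 5 := by
  filter_upwards [coeFn_mulL_expOp (sobolevEmb ℝ G ^ 4) G] with x h
  rw [quintic, h, BoundedContinuousFunction.coe_pow, Pi.pow_apply, sobolevEmb_apply]; ring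

/-- Moves a factor between the bounded and the `L²` slot, so that equal monomials of the expansion
can be matched. -/
theorem mulL_swap (m : ℝ →ᵇ ℝ) (h k : L2 ℝ) :
    mulL (m * sobolevEmb ℝ k) (expOp ℝ h) = mulL (m * sobolevEmb ℝ h) (expOp ℝ k) := by
  refine Lp.ext ?_
  filter_upwards [coeFn_mulL_expOp (m * sobolevEmb ℝ k) h, coeFn_mulL_expOp (m * sobolevEmb ℝ h) k]
    with x h1 h2
  rw [h1, h2, BoundedContinuousFunction.mul_apply, BoundedContinuousFunction.mul_apply,
    sobolevEmb_apply, sobolevEmb_apply]; ring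

/-- The coefficients of the parts of `(ρ₀ α + ρ₁ β)⁵` that are odd in `ρ₀`, respectively `ρ₁`. -/
def quint₁ (g₀ g₁ : L2 ℝ) (x : L2 ℝ × L2 ℝ) : L2 ℝ × L2 ℝ :=
  (mulL (sobolevEmb ℝ (g₀ + x.1) ^ 4) (expOp ℝ (g₀ + x.1)),
    (5 : ℝ) • mulL (sobolevEmb ℝ (g₀ + x.1) ^ 4) (expOp ℝ (g₁ + x.2)))

/-- See `quint₁`. -/
def quint₂ (g₀ g₁ : L2 ℝ) (x : L2 ℝ × L2 ℝ) : L2 ℝ × L2 ℝ :=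
  ((10 : ℝ) • mulL (sobolevEmb ℝ (g₀ + x.1) ^ 2 * sobolevEmb ℝ (g₁ + x.2) ^ 2)
      (expOp ℝ (g₀ + x.1)),
    (10 : ℝ) • mulL (sobolevEmb ℝ (g₀ + x.1) ^ 2 * sobolevEmb ℝ (g₁ + x.2) ^ 2)
      (expOp ℝ (g₁ + x.2)))

/-- See `quint₁`. -/
def quint₃ (g₀ g₁ : L2 ℝ) (x : L2 ℝ × L2 ℝ) : L2 ℝ × L2 ℝ :=
  ((5 : ℝ) • mulL (sobolevEmb ℝ (g₁ + x.2) ^ 4) (expOp ℝ (g₀ + x.1)),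
    mulL (sobolevEmb ℝ (g₁ + x.2) ^ 4) (expOp ℝ (g₁ + x.2)))

/-- The full nonlinearity, split into the two parts. -/
def quintPair (g₀ g₁ : L2 ℝ) : ℝ × ℝ × ℝ → L2 ℝ × L2 ℝ → L2 ℝ × L2 ℝ :=
  quadForm (quint₁ g₀ g₁) (quint₂ g₀ g₁) (quint₃ g₀ g₁)

/-- The binomial theorem sorted by the parity of the exponent of `ρ₀`. The exponents sum to `5`, so
exactly one is odd; after one factor `ρ₀` or `ρ₁` is removed, only `ρ₀²` and `ρ₁²` remain. -/
theorem quintic_split (g₀ g₁ : L2 ℝ) (x : L2 ℝ × L2 ℝ) (ρ₀ ρ₁ w : ℝ) :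
    quintic (ρ₀ • (g₀ + x.1) + ρ₁ • (g₁ + x.2))
      = ρ₀ • (quintPair g₀ g₁ (ρ₁ ^ 2, ρ₀ ^ 2, w) x).1
        + ρ₁ • (quintPair g₀ g₁ (ρ₁ ^ 2, ρ₀ ^ 2, w) x).2 := by
  simp only [quintPair, quadForm, quint₁, quint₂, quint₃, quintic, Prod.fst_add, Prod.snd_add,
    Prod.smul_fst, Prod.smul_snd]
  set h := g₀ + x.1
  set k := g₁ + x.2
  have s1 := mulL_swap (sobolevEmb ℝ h ^ 3) h k
  have s2 := mulL_swap (sobolevEmb ℝ h * sobolevEmb ℝ k ^ 2) h k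
  have s3 := mulL_swap (sobolevEmb ℝ h ^ 2 * sobolevEmb ℝ k) k h
  have s4 := mulL_swap (sobolevEmb ℝ k ^ 3) k h
  set a := sobolevEmb ℝ h
  set b := sobolevEmb ℝ k
  rw [map_add, map_add, map_smul, map_smul, map_smul, map_smul]
  change mulL ((ρ₀ • a + ρ₁ • b) ^ 4) _ = _
  have e : (ρ₀ • a + ρ₁ • b) ^ 4 = ρ₀ ^ 4 • a ^ 4 + (4 * ρ₀ ^ 3 * ρ₁) • (a ^ 3 * b)
      + (6 * ρ₀ ^ 2 * ρ₁ ^ 2) • (a ^ 2 * b ^ 2) + (4 * ρ₀ * ρ₁ ^ 3) • (b ^ 3 * a)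
      + ρ₁ ^ 4 • b ^ 4 := by
    ext y
    simp only [BoundedContinuousFunction.coe_pow, BoundedContinuousFunction.coe_add,
      BoundedContinuousFunction.coe_smul, BoundedContinuousFunction.coe_mul, Pi.pow_apply,
      Pi.add_apply, Pi.mul_apply, smul_eq_mul]
    ring
  have e1 : a ^ 3 * a = a ^ 4 := by ring
  have e2 : a * b ^ 2 * b = b ^ 3 * a := by ring
  have e3 : a * b ^ 2 * a = a ^ 2 * b ^ 2 := by ring
  have e4 : a ^ 2 * b * a = a ^ 3 * b := by ring
  have e5 : a ^ 2 * b * b = a ^ 2 * b ^ 2 := by ring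
  have e6 : b ^ 3 * b = b ^ 4 := by ring
  rw [e1] at s1
  rw [e2, e3] at s2
  rw [e4, e5] at s3
  rw [e6] at s4
  rw [e]
  simp only [map_add, map_smul, add_apply, smul_apply]
  rw [s1, s2, s3, s4]
  module

/-! ### Bounds and smoothness -/

theorem boundedLip_affine {Z W W' : Type*} [NormedAddCommGroup Z] [NormedSpace ℝ Z]
    [NormedAddCommGroup W] [NormedSpace ℝ W] [NormedAddCommGroup W'] [NormedSpace ℝ W']
    {L : W →L[ℝ] W'} (hL : ∀ u, ‖L u‖ ≤ ‖u‖) {π : Z →L[ℝ] W} (hπ : ∀ x, ‖π x‖ ≤ ‖x‖) {c : W}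
    {C : ℝ} (hC : ‖c‖ + 1 ≤ C) : BoundedLip C (fun x => L (c + π x)) := fun x hx =>
  ⟨(hL _).trans ((norm_add_le _ _).trans (by linarith [hπ x])), fun y _ => by
    rw [← map_sub, add_sub_add_left_eq_sub, ← map_sub]
    refine (hL _).trans ((hπ _).trans ?_)
    have : 1 ≤ C := by linarith [norm_nonneg c]
    nlinarith [norm_nonneg (x - y)]⟩

theorem BoundedLip.mul_bcf {Z : Type*} [NormedAddCommGroup Z] [NormedSpace ℝ Z] {C D : ℝ}
    {f h : Z → ℝ →ᵇ ℝ} (hf : BoundedLip C f) (hh : BoundedLip D h) :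
    BoundedLip (2 * C * D) (fun x => f x * h x) :=
  hf.bilin hh (B := fun u v => u * v) (fun u v => norm_mul_le u v) (fun _ _ _ => sub_mul _ _ _)
    (fun _ _ _ => mul_sub _ _ _)

theorem BoundedLip.mulL {Z : Type*} [NormedAddCommGroup Z] [NormedSpace ℝ Z] {C D : ℝ}
    {f : Z → ℝ →ᵇ ℝ} {h : Z → L2 ℝ} (hf : BoundedLip C f) (hh : BoundedLip D h) :
    BoundedLip (2 * C * D) (fun x => QuinticNLS.mulL (f x) (h x)) :=
  hf.bilin hh (B := fun u v => QuinticNLS.mulL u v)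
    (fun u v => (QuinticNLS.mulL u).le_of_opNorm_le (norm_mulOp_le u) v)
    (fun _ _ _ => by rw [map_sub]; rfl) (fun _ _ _ => map_sub _ _ _)

theorem BoundedLip.const_smul {Z W : Type*} [NormedAddCommGroup Z] [NormedAddCommGroup W]
    [NormedSpace ℝ W] {C : ℝ} {f : Z → W} (hf : BoundedLip C f) {k : ℝ} (hk : 0 ≤ k) :
    BoundedLip (k * C) (fun x => k • f x) := fun x hx => by
  refine ⟨?_, fun y hy => ?_⟩
  · rw [norm_smul, Real.norm_of_nonneg hk]; exact mul_le_mul_of_nonneg_left (hf x hx).1 hk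
  · rw [← smul_sub, norm_smul, Real.norm_of_nonneg hk, mul_assoc]
    exact mul_le_mul_of_nonneg_left ((hf x hx).2 y hy) hk

theorem boundedLip_parts {c : ℝ} (h₀ : ‖g₀‖ + 1 ≤ c) (h₁ : ‖g₁‖ + 1 ≤ c) :
    BoundedLip c (fun x : L2 ℝ × L2 ℝ => sobolevEmb ℝ (g₀ + x.1)) ∧
    BoundedLip c (fun x : L2 ℝ × L2 ℝ => sobolevEmb ℝ (g₁ + x.2)) ∧
    BoundedLip c (fun x : L2 ℝ × L2 ℝ => expOp ℝ (g₀ + x.1)) ∧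
    BoundedLip c (fun x : L2 ℝ × L2 ℝ => expOp ℝ (g₁ + x.2)) :=
  ⟨boundedLip_affine (L := sobolevEmb ℝ) norm_sobolevEmb_le
      (π := ContinuousLinearMap.fst ℝ (L2 ℝ) (L2 ℝ)) norm_fst_le h₀,
    boundedLip_affine (L := sobolevEmb ℝ) norm_sobolevEmb_le
      (π := ContinuousLinearMap.snd ℝ (L2 ℝ) (L2 ℝ)) norm_snd_le h₁,
    boundedLip_affine (L := expOp ℝ) norm_expOp_le
      (π := ContinuousLinearMap.fst ℝ (L2 ℝ) (L2 ℝ)) norm_fst_le h₀,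
    boundedLip_affine (L := expOp ℝ) norm_expOp_le
      (π := ContinuousLinearMap.snd ℝ (L2 ℝ) (L2 ℝ)) norm_snd_le h₁⟩

/-- Fourth-order products cost `8 c⁴`, the `L²` factor raises this to `16 c⁵`, and the largest
binomial coefficient is `10`. -/
theorem boundedLip_quint {c : ℝ} (h₀ : ‖g₀‖ + 1 ≤ c) (h₁ : ‖g₁‖ + 1 ≤ c) :
    BoundedLip (160 * c ^ 5) (quint₁ g₀ g₁) ∧ BoundedLip (160 * c ^ 5) (quint₂ g₀ g₁) ∧
      BoundedLip (160 * c ^ 5) (quint₃ g₀ g₁) := by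
  obtain ⟨a, b, A, B⟩ := boundedLip_parts h₀ h₁
  have hc : 0 ≤ c := (by positivity : (0 : ℝ) ≤ ‖g₀‖ + 1).trans h₀
  have hc5 : 0 ≤ c ^ 5 := by positivity
  have aa : BoundedLip (8 * c ^ 4) (fun x : L2 ℝ × L2 ℝ => sobolevEmb ℝ (g₀ + x.1) ^ 4) := by
    have := (a.mul_bcf a).mul_bcf (a.mul_bcf a)
    convert this using 1
    · ring
    · ext1 x; ring
  have bb : BoundedLip (8 * c ^ 4) (fun x : L2 ℝ × L2 ℝ => sobolevEmb ℝ (g₁ + x.2) ^ 4) := by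
    have := (b.mul_bcf b).mul_bcf (b.mul_bcf b)
    convert this using 1
    · ring
    · ext1 x; ring
  have ab : BoundedLip (8 * c ^ 4) (fun x : L2 ℝ × L2 ℝ =>
      sobolevEmb ℝ (g₀ + x.1) ^ 2 * sobolevEmb ℝ (g₁ + x.2) ^ 2) := by
    have := (a.mul_bcf a).mul_bcf (b.mul_bcf b)
    convert this using 1
    · ring
    · ext1 x; ring
  refine ⟨?_, ?_, ?_⟩
  · exact ((aa.mulL A).mono (by linarith)).prodMk
      (((aa.mulL B).const_smul (k := 5) (by norm_num)).mono (by linarith))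
  · exact (((ab.mulL A).const_smul (k := 10) (by norm_num)).mono (by linarith)).prodMk
      (((ab.mulL B).const_smul (k := 10) (by norm_num)).mono (by linarith))
  · exact (((bb.mulL A).const_smul (k := 5) (by norm_num)).mono (by linarith)).prodMk
      ((bb.mulL B).mono (by linarith))

theorem contDiff_quint (g₀ g₁ : L2 ℝ) {n : WithTop ℕ∞} :
    ContDiff ℝ n (quint₁ g₀ g₁) ∧ ContDiff ℝ n (quint₂ g₀ g₁) ∧ ContDiff ℝ n (quint₃ g₀ g₁) := by
  have a : ContDiff ℝ n (fun x : L2 ℝ × L2 ℝ => sobolevEmb ℝ (g₀ + x.1)) :=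
    (sobolevEmb ℝ).contDiff.comp (contDiff_const.add contDiff_fst)
  have b : ContDiff ℝ n (fun x : L2 ℝ × L2 ℝ => sobolevEmb ℝ (g₁ + x.2)) :=
    (sobolevEmb ℝ).contDiff.comp (contDiff_const.add contDiff_snd)
  have A : ContDiff ℝ n (fun x : L2 ℝ × L2 ℝ => expOp ℝ (g₀ + x.1)) :=
    (expOp ℝ).contDiff.comp (contDiff_const.add contDiff_fst)
  have B : ContDiff ℝ n (fun x : L2 ℝ × L2 ℝ => expOp ℝ (g₁ + x.2)) :=
    (expOp ℝ).contDiff.comp (contDiff_const.add contDiff_snd)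
  have key : ∀ {m : L2 ℝ × L2 ℝ → ℝ →ᵇ ℝ} {h : L2 ℝ × L2 ℝ → L2 ℝ}, ContDiff ℝ n m →
      ContDiff ℝ n h → ContDiff ℝ n (fun x => mulL (m x) (h x)) := fun hm hh =>
    (mulL.contDiff.comp hm).clm_apply hh
  have aa := a.pow 4
  have bb := b.pow 4
  have ab := (a.pow 2).mul (b.pow 2)
  exact ⟨(key aa A).prodMk ((key aa B).const_smul (5 : ℝ)),
    ((key ab A).const_smul (10 : ℝ)).prodMk ((key ab B).const_smul (10 : ℝ)),
    ((key bb A).const_smul (5 : ℝ)).prodMk (key bb B)⟩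

/-- The nonlinearity has a small Lipschitz constant on small balls. -/
theorem norm_quintic_sub_le {R : ℝ} (hR : 0 < R) {G G' : L2 ℝ} (hG : ‖G‖ ≤ R) (hG' : ‖G'‖ ≤ R) :
    ‖quintic G - quintic G'‖ ≤ 16 * R ^ 4 * ‖G - G'‖ := by
  have a : BoundedLip 1 (fun x : L2 ℝ => sobolevEmb ℝ x) := by
    simpa using boundedLip_affine (c := 0) (C := 1) norm_sobolevEmb_le
      (π := ContinuousLinearMap.id ℝ (L2 ℝ)) (fun _ => le_rfl) (by simp)
  have b : BoundedLip 1 (fun x : L2 ℝ => expOp ℝ x) := by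
    simpa using boundedLip_affine (c := 0) (C := 1) norm_expOp_le
      (π := ContinuousLinearMap.id ℝ (L2 ℝ)) (fun _ => le_rfl) (by simp)
  have q : BoundedLip 16 quintic := by
    have := ((a.mul_bcf a).mul_bcf (a.mul_bcf a)).mulL b
    convert this using 1
    · norm_num
    · ext1 x
      rw [quintic]; congr 2; ring
  -- Homogeneity of degree five reduces to the unit ball, where the constant is `16`.
  have hom : ∀ k : L2 ℝ, quintic k = R ^ 5 • quintic (R⁻¹ • k) := fun k => by
    simp only [quintic, map_smul]
    rw [smul_pow, map_smul, smul_apply, smul_smul, smul_smul, mul_assoc]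
    have : R ^ 5 * (R⁻¹ * R⁻¹ ^ 4) = 1 := by field_simp
    rw [this, one_smul]
  have hn : ∀ k : L2 ℝ, ‖k‖ ≤ R → ‖R⁻¹ • k‖ ≤ 1 := fun k hk => by
    rw [norm_smul, norm_inv, Real.norm_of_nonneg hR.le, inv_mul_le_iff₀ hR, mul_one]; exact hk
  rw [hom G, hom G', ← smul_sub, norm_smul, Real.norm_of_nonneg (by positivity)]
  have := (q _ (hn G hG)).2 _ (hn G' hG')
  rw [← smul_sub, norm_smul, norm_inv, Real.norm_of_nonneg hR.le] at this
  refine (mul_le_mul_of_nonneg_left this (by positivity)).trans (le_of_eq ?_)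
  field_simp

end QuinticNLS

namespace QuinticNLS
open Set Filter
open scoped ENNReal InnerProductSpace BoundedContinuousFunction

/-! ### The Lyapunov-Schmidt reduction -/

variable {v : ℝ →ᵇ ℝ} {ω₀ ω₁ : ℝ} {g₀ g₁ : L2 ℝ} {ψ₀ ψ₁ : ℝ → ℝ}

theorem expAvg_profile (e₀ : expAvg g₀ = ψ₀) (e₁ : expAvg g₁ = ψ₁) (ρ₀ ρ₁ : ℝ) (g : L2 ℝ) :
    expAvg (ρ₀ • g₀ + ρ₁ • g₁ + g : L2 ℝ) = profile ψ₀ ψ₁ ρ₀ ρ₁ (expAvg g) := by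
  ext x
  rw [← sobolevEmb_apply, map_add, map_add, map_smul, map_smul, profile, ← e₀, ← e₁]
  rfl

/-- The right-hand side of the equation, as a function and as an element of `L²`. -/
theorem contProj_facts (e₀ : expAvg g₀ = ψ₀) (e₁ : expAvg g₁ = ψ₁) (ρ₀ ρ₁ : ℝ) (g : L2 ℝ) :
    Continuous (contProj ψ₀ ψ₁ fun y => profile ψ₀ ψ₁ ρ₀ ρ₁ (expAvg g) y ^ 5) ∧
    ∃ h : MemLp (contProj ψ₀ ψ₁ fun y => profile ψ₀ ψ₁ ρ₀ ρ₁ (expAvg g) y ^ 5) 2 volume,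
      h.toLp = projC g₀ g₁ (quintic (ρ₀ • g₀ + ρ₁ • g₁ + g)) := by
  set G := ρ₀ • g₀ + ρ₁ • g₁ + g
  have hq : quintic G =ᵐ[volume] fun y => profile ψ₀ ψ₁ ρ₀ ρ₁ (expAvg g) y ^ 5 := by
    have := coeFn_quintic G
    rwa [expAvg_profile e₀ e₁] at this
  have hae : projC g₀ g₁ (quintic G)
      =ᵐ[volume] contProj ψ₀ ψ₁ fun y => profile ψ₀ ψ₁ ρ₀ ρ₁ (expAvg g) y ^ 5 := by
    rw [projC_apply, inner_expOp_eq_integral e₀ hq, inner_expOp_eq_integral e₁ hq]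
    set a := ∫ x, ψ₀ x * profile ψ₀ ψ₁ ρ₀ ρ₁ (expAvg g) x ^ 5
    set b := ∫ x, ψ₁ x * profile ψ₀ ψ₁ ρ₀ ρ₁ (expAvg g) x ^ 5
    filter_upwards [hq, coeFn_expOp g₀, coeFn_expOp g₁,
      Lp.coeFn_sub (quintic G - a • expOp ℝ g₀) (b • expOp ℝ g₁),
      Lp.coeFn_sub (quintic G) (a • expOp ℝ g₀), Lp.coeFn_smul a (expOp ℝ g₀),
      Lp.coeFn_smul b (expOp ℝ g₁)] with x h1 h2 h3 h4 h5 h6 h7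
    rw [h4, Pi.sub_apply, h5, Pi.sub_apply, h6, h7, Pi.smul_apply, Pi.smul_apply, h1, h2, h3, e₀, e₁]
    rfl
  have hm := (Lp.memLp (projC g₀ g₁ (quintic G))).ae_eq hae
  refine ⟨?_, hm, Lp.ext (hm.coeFn_toLp.trans hae.symm)⟩
  have c0 : Continuous ψ₀ := e₀ ▸ continuous_expAvg (Lp.memLp g₀)
  have c1 : Continuous ψ₁ := e₁ ▸ continuous_expAvg (Lp.memLp g₁)
  have c2 : Continuous (expAvg g) := continuous_expAvg (Lp.memLp g)
  unfold contProj profile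
  fun_prop

theorem SpectralPair.solvesContEq_iff (S : SpectralPair v ω₀ ω₁ g₀ g₁) (e₀ : expAvg g₀ = ψ₀)
    (e₁ : expAvg g₁ = ψ₁) {r ρ₀ ρ₁ w : ℝ} (hw : -1 < w) (hr : 0 < r) (ξ : ℝ → ℝ) :
    SolvesContEq v ψ₀ ψ₁ r ρ₀ ρ₁ (ω₀ + w) ξ ↔ ∃ g : L2 ℝ, expAvg g = ξ ∧ ‖g‖ < r ∧
      augOp v ω₀ g₀ g₁ g + w • expOpAdj ℝ (expOp ℝ g)
        = expOpAdj ℝ (projC g₀ g₁ (quintic (ρ₀ • g₀ + ρ₁ • g₁ + g))) := by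
  constructor
  · intro h
    have hd := fun x => (h.isH2.contDiff.differentiable (by simp) x).hasDerivAt
    -- `ξ + ξ'` is a preimage of `ξ` under `T` available from `H¹` alone. It shows that the right
    -- side is continuous and square integrable before the equation is used.
    have hs : MemLp (fun x => ξ x + deriv ξ x) 2 := h.isH2.memLp.add h.isH2.memLp_deriv
    have hk : expAvg (hs.toLp : L2 ℝ) = ξ := by
      rw [expAvg_congr hs.coeFn_toLp, expAvg_add_deriv hd h.isH2.memLp h.isH2.memLp_deriv]
    obtain ⟨hc, hm, -⟩ := contProj_facts e₀ e₁ ρ₀ ρ₁ (hs.toLp : L2 ℝ)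
    rw [hk] at hc hm
    obtain ⟨g, hg, hf, -, hT, hn⟩ := exists_preimage_of_source h.isH2.contDiff h.isH2.memLp hc hm
      h.eqn
    obtain ⟨-, hm', hP⟩ := contProj_facts e₀ e₁ ρ₀ ρ₁ g
    have hTξ : expOp ℝ g =ᵐ[volume] ξ := by rw [hT]; exact h.isH2.memLp.coeFn_toLp
    refine ⟨g, hg, ?_, ?_⟩
    · have := h.small
      rw [hn] at this
      exact lt_of_pow_lt_pow_left₀ 2 hr.le this
    · rw [S.augOp_eq_iff hw, inner_expOp_eq_integral e₀ hTξ, inner_expOp_eq_integral e₁ hTξ]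
      refine ⟨h.orth₀, h.orth₁, ?_⟩
      rw [hf, ← hP]
      congr 2
      rw [hg]
  · rintro ⟨g, rfl, hgr, hg⟩
    obtain ⟨hc, hm, hP⟩ := contProj_facts e₀ e₁ ρ₀ ρ₁ g
    obtain ⟨o0, o1, hf⟩ := (S.augOp_eq_iff hw g _).1 hg
    rw [← hP] at hf
    obtain ⟨r1, r2, r3⟩ := solves_of_formOp hc hm hf
    refine ⟨r1, ?_, ?_, ?_, r2⟩
    · rw [← o0, inner_expOp_eq_integral e₀ (coeFn_expOp g)]
    · rw [← o1, inner_expOp_eq_integral e₁ (coeFn_expOp g)]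
    · rw [r3]; exact pow_lt_pow_left₀ hgr (norm_nonneg _) two_ne_zero

/-- `A` inverts the augmented operator, with norm at most `N`. -/
structure IsAugInv (v : ℝ →ᵇ ℝ) (ω₀ : ℝ) (g₀ g₁ : L2 ℝ) (A : L2 ℝ →L[ℝ] L2 ℝ) (N : ℝ) : Prop where
  left : ∀ g, A (augOp v ω₀ g₀ g₁ g) = g
  right : ∀ g, augOp v ω₀ g₀ g₁ (A g) = g
  bound : ∀ g, ‖A g‖ ≤ N * ‖g‖

theorem SpectralPair.exists_augInv (S : SpectralPair v ω₀ ω₁ g₀ g₁) {K κ : ℝ} (hK : ‖v‖ ≤ K)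
    (hκ : 0 < κ) (hω : κ ≤ ω₁) :
    ∃ A, IsAugInv v ω₀ g₀ g₁ A ((min 1 κ + K + 1) / min 1 κ) := by
  have hm : 0 < min 1 κ := lt_min one_pos hκ
  have hK0 : 0 ≤ K := (norm_nonneg _).trans hK
  have hc := S.coercive hK hκ hω
  have hpos : 0 < min 1 κ / (min 1 κ + K + 1) := by positivity
  let E := equivOfBijective (augOp v ω₀ g₀ g₁) (bijective_of_coercive hpos hc)
  refine ⟨E.symm, fun g => E.symm_apply_apply g, fun g => E.apply_symm_apply g, fun g => ?_⟩
  have := norm_le_of_coercive (𝕜 := ℝ) hc (E.symm g)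
  have h2 : augOp v ω₀ g₀ g₁ (E.symm g) = g := E.apply_symm_apply g
  rw [h2, div_mul_eq_mul_div, div_le_iff₀ (by positivity)] at this
  rw [div_mul_eq_mul_div, le_div_iff₀ hm]
  show ‖E.symm g‖ * min 1 κ ≤ _
  linarith

/-- Solutions in a small ball are unique. -/
theorem SpectralPair.eq_of_solves (S : SpectralPair v ω₀ ω₁ g₀ g₁) {A : L2 ℝ →L[ℝ] L2 ℝ} {N : ℝ}
    (hA : IsAugInv v ω₀ g₀ g₁ A N) (hN : 0 ≤ N) {R w : ℝ} (hR : 0 < R)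
    (hsmall : N * (48 * R ^ 4 + |w|) < 1) {k g g' : L2 ℝ} (hg : ‖k + g‖ ≤ R) (hg' : ‖k + g'‖ ≤ R)
    (h : augOp v ω₀ g₀ g₁ g + w • expOpAdj ℝ (expOp ℝ g)
        = expOpAdj ℝ (projC g₀ g₁ (quintic (k + g))))
    (h' : augOp v ω₀ g₀ g₁ g' + w • expOpAdj ℝ (expOp ℝ g')
        = expOpAdj ℝ (projC g₀ g₁ (quintic (k + g')))) : g = g' := by
  have e : augOp v ω₀ g₀ g₁ (g - g')
      = expOpAdj ℝ (projC g₀ g₁ (quintic (k + g) - quintic (k + g')))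
        - w • expOpAdj ℝ (expOp ℝ (g - g')) := by
    simp only [map_sub]
    rw [← h, ← h']
    module
  -- `48` is the bound `3` for the projection times the `16` of the nonlinearity.
  have b1 : ‖expOpAdj ℝ (projC g₀ g₁ (quintic (k + g) - quintic (k + g')))‖
      ≤ 48 * R ^ 4 * ‖g - g'‖ := by
    refine (norm_expOpAdj_le _).trans ((S.norm_projC_le _).trans ?_)
    have := norm_quintic_sub_le hR hg hg'
    rw [add_sub_add_left_eq_sub] at this
    linarith
  have b2 : ‖w • expOpAdj ℝ (expOp ℝ (g - g'))‖ ≤ |w| * ‖g - g'‖ := by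
    rw [norm_smul]
    exact mul_le_mul_of_nonneg_left ((norm_expOpAdj_le _).trans (norm_expOp_le _)) (abs_nonneg _)
  have b3 : ‖g - g'‖ ≤ N * (48 * R ^ 4 + |w|) * ‖g - g'‖ := by
    conv_lhs => rw [← hA.left (g - g'), e]
    refine (hA.bound _).trans ?_
    rw [mul_assoc]
    refine mul_le_mul_of_nonneg_left ((norm_sub_le _ _).trans ?_) hN
    linarith
  by_contra hne
  have hpos : 0 < ‖g - g'‖ := norm_pos_iff.2 (sub_ne_zero.2 hne)
  nlinarith

/-- The solution operator `A T* P_c`. -/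
def solveOp (g₀ g₁ : L2 ℝ) (A : L2 ℝ →L[ℝ] L2 ℝ) : L2 ℝ →L[ℝ] L2 ℝ :=
  A.comp ((expOpAdj ℝ).comp (projC g₀ g₁))

/-- The diagonal action of an operator on pairs. -/
def diag (B : L2 ℝ →L[ℝ] L2 ℝ) : L2 ℝ × L2 ℝ →L[ℝ] L2 ℝ × L2 ℝ := B.prodMap B

theorem diag_apply (B : L2 ℝ →L[ℝ] L2 ℝ) (x : L2 ℝ × L2 ℝ) : diag B x = (B x.1, B x.2) := rfl

theorem norm_diag_le {B : L2 ℝ →L[ℝ] L2 ℝ} {N : ℝ} (hN : 0 ≤ N) (h : ∀ g, ‖B g‖ ≤ N * ‖g‖) :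
    ‖diag B‖ ≤ N := by
  refine ContinuousLinearMap.opNorm_le_bound _ hN fun x => ?_
  rw [diag_apply, norm_prod_le_iff]
  exact ⟨(h _).trans (mul_le_mul_of_nonneg_left (norm_fst_le x) hN),
    (h _).trans (mul_le_mul_of_nonneg_left (norm_snd_le x) hN)⟩

theorem BoundedLip.clm_of_le {Z W W' : Type*} [NormedAddCommGroup Z] [NormedSpace ℝ Z]
    [NormedAddCommGroup W] [NormedSpace ℝ W] [NormedAddCommGroup W'] [NormedSpace ℝ W'] {C N D : ℝ}
    {f : Z → W} (h : BoundedLip C f) {L : W →L[ℝ] W'} (hL : ‖L‖ ≤ N) (hD : N * C ≤ D) :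
    BoundedLip D (fun x => L (f x)) :=
  (h.clm L).mono ((mul_le_mul_of_nonneg_right hL h.nonneg).trans hD)

/-- Applying `A` to the augmented equation yields the fixed point problem; the shift `w T* T`, moved
to the right, becomes `M₄` with its minus sign. -/
theorem SpectralPair.smallFamily (S : SpectralPair v ω₀ ω₁ g₀ g₁) {A : L2 ℝ →L[ℝ] L2 ℝ} {N : ℝ}
    (hA : IsAugInv v ω₀ g₀ g₁ A N) (hN : 0 ≤ N) {c C e : ℝ} (h₀ : ‖g₀‖ + 1 ≤ c)
    (h₁ : ‖g₁‖ + 1 ≤ c) (hC : (3 * N + 1) * (160 * c ^ 5) ≤ C) (he : 0 < e) (he1 : e ≤ 1)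
    (hCe : 8 * C * e ≤ 1) :
    SmallFamily (fun x => diag (solveOp g₀ g₁ A) (quint₁ g₀ g₁ x))
      (fun x => diag (solveOp g₀ g₁ A) (quint₂ g₀ g₁ x))
      (fun x => diag (solveOp g₀ g₁ A) (quint₃ g₀ g₁ x))
      (-diag (A.comp ((expOpAdj ℝ).comp (expOp ℝ)))) C e := by
  have hc : 1 ≤ c := by linarith [norm_nonneg g₀]
  have hc5 : 1 ≤ c ^ 5 := one_le_pow₀ hc
  have hσ : ‖diag (solveOp g₀ g₁ A)‖ ≤ 3 * N := norm_diag_le (by positivity) fun g => by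
    refine (hA.bound _).trans ?_
    exact (mul_le_mul_of_nonneg_left ((norm_expOpAdj_le (projC g₀ g₁ g)).trans
      (S.norm_projC_le g)) hN).trans (le_of_eq (by ring))
  have hN5 : 0 ≤ N * c ^ 5 := by positivity
  have hCC : 3 * N * (160 * c ^ 5) ≤ C := by linarith
  obtain ⟨b1, b2, b3⟩ := boundedLip_quint h₀ h₁
  obtain ⟨d1, d2, d3⟩ := contDiff_quint g₀ g₁ (n := ⊤)
  refine ⟨b1.clm_of_le hσ hCC, b2.clm_of_le hσ hCC, b3.clm_of_le hσ hCC, ?_,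
    (diag _).contDiff.comp d1, (diag _).contDiff.comp d2, (diag _).contDiff.comp d3, he, he1, hCe⟩
  rw [norm_neg]
  refine (norm_diag_le hN fun g => ?_).trans (?_ : N ≤ C)
  · exact (hA.bound _).trans (mul_le_mul_of_nonneg_left
      ((norm_expOpAdj_le _).trans (norm_expOp_le _)) hN)
  · nlinarith

/-- The preimage under `T` of the reduction map. -/
def reductionPre {C e : ℝ} {A : L2 ℝ →L[ℝ] L2 ℝ}
    (H : SmallFamily (fun x => diag (solveOp g₀ g₁ A) (quint₁ g₀ g₁ x))
      (fun x => diag (solveOp g₀ g₁ A) (quint₂ g₀ g₁ x))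
      (fun x => diag (solveOp g₀ g₁ A) (quint₃ g₀ g₁ x))
      (-diag (A.comp ((expOpAdj ℝ).comp (expOp ℝ)))) C e) (ρ₀ ρ₁ w : ℝ) : L2 ℝ :=
  ρ₀ • (H.sol (ρ₁ ^ 2, ρ₀ ^ 2, w)).1 + ρ₁ • (H.sol (ρ₁ ^ 2, ρ₀ ^ 2, w)).2

section Reduction

variable {C e : ℝ} {A : L2 ℝ →L[ℝ] L2 ℝ}
  (H : SmallFamily (fun x => diag (solveOp g₀ g₁ A) (quint₁ g₀ g₁ x))
      (fun x => diag (solveOp g₀ g₁ A) (quint₂ g₀ g₁ x))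
      (fun x => diag (solveOp g₀ g₁ A) (quint₃ g₀ g₁ x))
      (-diag (A.comp ((expOpAdj ℝ).comp (expOp ℝ)))) C e)

theorem quintic_reductionPre (ρ₀ ρ₁ w : ℝ) :
    quintic (ρ₀ • g₀ + ρ₁ • g₁ + reductionPre H ρ₀ ρ₁ w)
      = ρ₀ • (quintPair g₀ g₁ (ρ₁ ^ 2, ρ₀ ^ 2, w) (H.sol (ρ₁ ^ 2, ρ₀ ^ 2, w))).1
        + ρ₁ • (quintPair g₀ g₁ (ρ₁ ^ 2, ρ₀ ^ 2, w) (H.sol (ρ₁ ^ 2, ρ₀ ^ 2, w))).2 := by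
  rw [← quintic_split]
  congr 1
  unfold reductionPre; module

/-- Each component solves the linear equation with its own half of the nonlinearity; the combination
with weights `ρ₀`, `ρ₁` reassembles the fifth power. -/
theorem reductionPre_solves {N : ℝ} (hA : IsAugInv v ω₀ g₀ g₁ A N) {ρ₀ ρ₁ w : ℝ}
    (hp : ‖((ρ₁ ^ 2, ρ₀ ^ 2, w) : ℝ × ℝ × ℝ)‖ ≤ e) :
    augOp v ω₀ g₀ g₁ (reductionPre H ρ₀ ρ₁ w)
        + w • expOpAdj ℝ (expOp ℝ (reductionPre H ρ₀ ρ₁ w))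
      = expOpAdj ℝ (projC g₀ g₁ (quintic (ρ₀ • g₀ + ρ₁ • g₁ + reductionPre H ρ₀ ρ₁ w))) := by
  have hfix := (H.sol_spec hp).2
  set p : ℝ × ℝ × ℝ := (ρ₁ ^ 2, ρ₀ ^ 2, w) with hpd
  set x := H.sol p with hx
  have hlin : famMap (fun x => diag (solveOp g₀ g₁ A) (quint₁ g₀ g₁ x))
      (fun x => diag (solveOp g₀ g₁ A) (quint₂ g₀ g₁ x))
      (fun x => diag (solveOp g₀ g₁ A) (quint₃ g₀ g₁ x))
      (-diag (A.comp ((expOpAdj ℝ).comp (expOp ℝ)))) p x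
      = diag (solveOp g₀ g₁ A) (quintPair g₀ g₁ p x)
        - w • diag (A.comp ((expOpAdj ℝ).comp (expOp ℝ))) x := by
    simp only [famMap, quadForm, quintPair, map_add, map_smul, hpd, neg_apply, smul_neg,
      sub_eq_add_neg]
  rw [hlin] at hfix
  have f1 : A (expOpAdj ℝ (projC g₀ g₁ (quintPair g₀ g₁ p x).1))
      - w • A (expOpAdj ℝ (expOp ℝ x.1)) = x.1 := congrArg Prod.fst hfix
  have f2 : A (expOpAdj ℝ (projC g₀ g₁ (quintPair g₀ g₁ p x).2))
      - w • A (expOpAdj ℝ (expOp ℝ x.2)) = x.2 := congrArg Prod.snd hfix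
  have k1 : augOp v ω₀ g₀ g₁ x.1 = expOpAdj ℝ (projC g₀ g₁ (quintPair g₀ g₁ p x).1)
      - w • expOpAdj ℝ (expOp ℝ x.1) := by
    conv_lhs => rw [← f1]
    rw [map_sub, map_smul, hA.right, hA.right]
  have k2 : augOp v ω₀ g₀ g₁ x.2 = expOpAdj ℝ (projC g₀ g₁ (quintPair g₀ g₁ p x).2)
      - w • expOpAdj ℝ (expOp ℝ x.2) := by
    conv_lhs => rw [← f2]
    rw [map_sub, map_smul, hA.right, hA.right]
  rw [quintic_reductionPre]
  simp only [reductionPre, map_add, map_smul]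
  rw [k1, k2]
  module

/-- The reduction map exists and is unique in the ball of radius `2 ε`. -/
theorem SpectralPair.isReductionMap (S : SpectralPair v ω₀ ω₁ g₀ g₁) (e₀ : expAvg g₀ = ψ₀)
    (e₁ : expAvg g₁ = ψ₁) {N c : ℝ} (hA : IsAugInv v ω₀ g₀ g₁ A N) (hN : 0 ≤ N)
    (h₀ : ‖g₀‖ + 1 ≤ c) (h₁ : ‖g₁‖ + 1 ≤ c) (hR : 2 * e * c ≤ 1)
    (hsmall : N * (96 * c + 1) * e < 1) :
    IsReductionMap v ψ₀ ψ₁ ω₀ e (2 * e)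
      (fun ρ₀ ρ₁ ω => expAvg (reductionPre H ρ₀ ρ₁ (ω - ω₀))) := by
  rintro ρ₀ ρ₁ ω ⟨hρ₀, hρ₁, hω⟩
  have he := H.pos
  have he1 := H.le_one
  have hsq : ∀ {ρ : ℝ}, |ρ| < e → |ρ ^ 2| < e := fun {ρ} h => by
    rw [abs_pow]; nlinarith [abs_nonneg ρ]
  have hp : ‖((ρ₁ ^ 2, ρ₀ ^ 2, ω - ω₀) : ℝ × ℝ × ℝ)‖ ≤ e :=
    (norm_triple_lt.2 ⟨hsq hρ₁, hsq hρ₀, hω⟩).le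
  have hw : -1 < ω - ω₀ := by linarith [(abs_lt.1 hω).1]
  have hωe : ω = ω₀ + (ω - ω₀) := by ring
  have hn : ∀ {x y : L2 ℝ} {B : ℝ}, ‖x‖ ≤ B → ‖y‖ ≤ B → ‖ρ₀ • x + ρ₁ • y‖ ≤ 2 * e * B := by
    intro x y B hx hy
    refine (norm_add_le _ _).trans ?_
    rw [norm_smul, norm_smul]
    have a1 := mul_le_mul hρ₀.le hx (norm_nonneg _) he.le
    have a2 := mul_le_mul hρ₁.le hy (norm_nonneg _) he.le
    simp only [Real.norm_eq_abs]
    linarith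
  have hpre : ‖reductionPre H ρ₀ ρ₁ (ω - ω₀)‖ < 2 * e := by
    have h1 := H.sol_lt_one hp
    have h2 := hn (norm_fst_le (H.sol (ρ₁ ^ 2, ρ₀ ^ 2, ω - ω₀)))
      (norm_snd_le (H.sol (ρ₁ ^ 2, ρ₀ ^ 2, ω - ω₀)))
    refine lt_of_le_of_lt h2 ?_
    nlinarith
  have hsol := reductionPre_solves H hA hp
  constructor
  · rw [hωe, S.solvesContEq_iff e₀ e₁ hw (by linarith)]
    exact ⟨_, by simp, hpre, hsol⟩
  · intro ξ hξ
    rw [hωe, S.solvesContEq_iff e₀ e₁ hw (by linarith)] at hξ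
    obtain ⟨g, rfl, hg, hgs⟩ := hξ
    have hk : ∀ g : L2 ℝ, ‖g‖ < 2 * e → ‖(ρ₀ • g₀ + ρ₁ • g₁) + g‖ ≤ 2 * e * c := fun g hg => by
      refine (norm_add_le _ _).trans ?_
      have := hn (B := c - 1) (by linarith : ‖g₀‖ ≤ c - 1) (by linarith : ‖g₁‖ ≤ c - 1)
      linarith
    have hc : 1 ≤ c := by linarith [norm_nonneg g₀]
    have hR0 : 0 < 2 * e * c := by positivity
    -- Uniqueness of the pair in the unit ball does not suffice, since a competitor `g` comes
    -- without a splitting. It follows from the contraction estimate for the full profile in the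
    -- ball of radius `2 e c`.
    have : g = reductionPre H ρ₀ ρ₁ (ω - ω₀) := by
      refine S.eq_of_solves hA hN hR0 ?_ (hk g hg) (hk _ hpre) hgs hsol
      refine lt_of_le_of_lt ?_ hsmall
      rw [mul_assoc N]
      refine mul_le_mul_of_nonneg_left ?_ hN
      have := pow_le_of_le_one hR0.le hR (n := 4) (by norm_num)
      linarith
    rw [this]

end Reduction
end QuinticNLS

namespace QuinticNLS
open Set Filter
open scoped ENNReal InnerProductSpace BoundedContinuousFunction

/-! ### Symmetry of the reduction -/

section Reflection

variable {ψ₀ ψ₁ : ℝ → ℝ}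

theorem profile_reflect (E₀ : Function.Even ψ₀) (O₁ : Function.Odd ψ₁) (ρ₀ ρ₁ : ℝ) (ξ : ℝ → ℝ)
    (x : ℝ) : profile ψ₀ ψ₁ ρ₀ (-ρ₁) (fun y => ξ (-y)) x = profile ψ₀ ψ₁ ρ₀ ρ₁ ξ (-x) := by
  simp only [profile, E₀ x, O₁ x]; ring

theorem integral_mul_comp_neg_of_even (E₀ : Function.Even ψ₀) (f : ℝ → ℝ) :
    ∫ y, ψ₀ y * f (-y) = ∫ y, ψ₀ y * f y := by
  rw [← integral_neg_eq_self (fun y => ψ₀ y * f y) volume]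
  simp only [E₀ _]

theorem integral_mul_comp_neg_of_odd (O₁ : Function.Odd ψ₁) (f : ℝ → ℝ) :
    ∫ y, ψ₁ y * f (-y) = -∫ y, ψ₁ y * f y := by
  rw [← integral_neg_eq_self (fun y => ψ₁ y * f y) volume, ← integral_neg]
  simp only [O₁ _, neg_mul, neg_neg]

theorem contProj_reflect (E₀ : Function.Even ψ₀) (O₁ : Function.Odd ψ₁) (f : ℝ → ℝ) (x : ℝ) :
    contProj ψ₀ ψ₁ (fun y => f (-y)) x = contProj ψ₀ ψ₁ f (-x) := by
  simp only [contProj, integral_mul_comp_neg_of_even E₀, integral_mul_comp_neg_of_odd O₁, E₀ x,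
    O₁ x]
  ring

theorem SolvesContEq.reflect {V : ℝ → ℝ} {r ρ₀ ρ₁ ω : ℝ} {ξ : ℝ → ℝ}
    (h : SolvesContEq V ψ₀ ψ₁ r ρ₀ ρ₁ ω ξ) (hV : Function.Even V) (E₀ : Function.Even ψ₀)
    (O₁ : Function.Odd ψ₁) : SolvesContEq V ψ₀ ψ₁ r ρ₀ (-ρ₁) ω (fun x => ξ (-x)) := by
  have hd : deriv (fun x => ξ (-x)) = fun x => -deriv ξ (-x) := funext fun x => deriv_comp_neg ξ x
  have hd2 : iteratedDeriv 2 (fun x => ξ (-x)) = fun x => iteratedDeriv 2 ξ (-x) := by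
    ext x; rw [iteratedDeriv_comp_neg]; simp
  refine ⟨⟨h.isH2.contDiff.comp contDiff_neg, memLp_neg_iff h.isH2.memLp, ?_, ?_⟩, ?_, ?_, ?_, ?_⟩
  · rw [hd]; exact (memLp_neg_iff h.isH2.memLp_deriv).neg
  · rw [hd2]; exact memLp_neg_iff h.isH2.memLp_deriv2
  · rw [integral_mul_comp_neg_of_even E₀, h.orth₀]
  · rw [integral_mul_comp_neg_of_odd O₁, h.orth₁, neg_zero]
  · rw [hd]
    simp only [neg_sq]
    rw [integral_neg_eq_self (fun x => ξ x ^ 2), integral_neg_eq_self (fun x => deriv ξ x ^ 2)]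
    exact h.small
  · intro x
    simp only [hd2, profile_reflect E₀ O₁]
    rw [contProj_reflect E₀ O₁ (fun y => profile ψ₀ ψ₁ ρ₀ ρ₁ ξ y ^ 5), ← h.eqn (-x), hV x]

/-- The reflected `η` solves the equation with `-ρ₁`, so uniqueness turns the symmetry of the
equation into one of the reduction map. -/
theorem IsReductionMap.reflect {V : ℝ → ℝ} {ω₀ ε r ρ₀ ρ₁ ω : ℝ} {η : ℝ → ℝ → ℝ → ℝ → ℝ}
    (h : IsReductionMap V ψ₀ ψ₁ ω₀ ε r η) (hV : Function.Even V) (E₀ : Function.Even ψ₀)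
    (O₁ : Function.Odd ψ₁) (hb : InBox ε ω₀ ρ₀ ρ₁ ω) (x : ℝ) :
    profile ψ₀ ψ₁ ρ₀ (-ρ₁) (η ρ₀ (-ρ₁) ω) x = profile ψ₀ ψ₁ ρ₀ ρ₁ (η ρ₀ ρ₁ ω) (-x) := by
  have hb' : InBox ε ω₀ ρ₀ (-ρ₁) ω := ⟨hb.1, by rw [abs_neg]; exact hb.2.1, hb.2.2⟩
  have := (h _ _ _ hb').2 _ ((h _ _ _ hb).1.reflect hV E₀ O₁)
  rw [← this, profile_reflect E₀ O₁]

theorem IsReductionMap.pairing_even {V : ℝ → ℝ} {ω₀ ε r ρ₀ ρ₁ ω : ℝ} {η : ℝ → ℝ → ℝ → ℝ → ℝ}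
    (h : IsReductionMap V ψ₀ ψ₁ ω₀ ε r η) (hV : Function.Even V) (E₀ : Function.Even ψ₀)
    (O₁ : Function.Odd ψ₁) (hb : InBox ε ω₀ ρ₀ ρ₁ ω) :
    quinticPairing ψ₀ ψ₀ ψ₁ η ρ₀ (-ρ₁) ω = quinticPairing ψ₀ ψ₀ ψ₁ η ρ₀ ρ₁ ω := by
  simp only [quinticPairing, h.reflect hV E₀ O₁ hb]
  exact integral_mul_comp_neg_of_even E₀ (fun x => profile ψ₀ ψ₁ ρ₀ ρ₁ (η ρ₀ ρ₁ ω) x ^ 5)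

theorem IsReductionMap.pairing_odd {V : ℝ → ℝ} {ω₀ ε r ρ₀ ρ₁ ω : ℝ} {η : ℝ → ℝ → ℝ → ℝ → ℝ}
    (h : IsReductionMap V ψ₀ ψ₁ ω₀ ε r η) (hV : Function.Even V) (E₀ : Function.Even ψ₀)
    (O₁ : Function.Odd ψ₁) (hb : InBox ε ω₀ ρ₀ ρ₁ ω) :
    quinticPairing ψ₁ ψ₀ ψ₁ η ρ₀ (-ρ₁) ω = -quinticPairing ψ₁ ψ₀ ψ₁ η ρ₀ ρ₁ ω := by
  simp only [quinticPairing, h.reflect hV E₀ O₁ hb]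
  exact integral_mul_comp_neg_of_odd O₁ (fun x => profile ψ₀ ψ₁ ρ₀ ρ₁ (η ρ₀ ρ₁ ω) x ^ 5)

end Reflection

/-! ### The reduced system -/

variable {v : ℝ →ᵇ ℝ} {ω₀ ω₁ : ℝ} {g₀ g₁ : L2 ℝ} {ψ₀ ψ₁ : ℝ → ℝ}

/-- `x ↦ ⟪ψ, x.1⟫`. -/
def pairFst (ψ : L2 ℝ) : L2 ℝ × L2 ℝ →L[ℝ] ℝ := (innerSL ℝ ψ).comp (.fst ℝ _ _)

/-- `x ↦ ⟪ψ, x.2⟫`. -/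
def pairSnd (ψ : L2 ℝ) : L2 ℝ × L2 ℝ →L[ℝ] ℝ := (innerSL ℝ ψ).comp (.snd ℝ _ _)

theorem pairFst_apply (ψ : L2 ℝ) (x : L2 ℝ × L2 ℝ) : pairFst ψ x = ⟪ψ, x.1⟫_ℝ := rfl

theorem pairSnd_apply (ψ : L2 ℝ) (x : L2 ℝ × L2 ℝ) : pairSnd ψ x = ⟪ψ, x.2⟫_ℝ := rfl

theorem norm_pairFst_le {ψ : L2 ℝ} (h : ‖ψ‖ = 1) : ‖pairFst ψ‖ ≤ 1 :=
  ContinuousLinearMap.opNorm_le_bound _ zero_le_one fun x => by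
    rw [pairFst_apply]
    refine (norm_inner_le_norm _ _).trans ?_
    rw [h]; exact mul_le_mul_of_nonneg_left (norm_fst_le x) zero_le_one

theorem norm_pairSnd_le {ψ : L2 ℝ} (h : ‖ψ‖ = 1) : ‖pairSnd ψ‖ ≤ 1 :=
  ContinuousLinearMap.opNorm_le_bound _ zero_le_one fun x => by
    rw [pairSnd_apply]
    refine (norm_inner_le_norm _ _).trans ?_
    rw [h]; exact mul_le_mul_of_nonneg_left (norm_snd_le x) zero_le_one

/-- A component of the nonlinearity at the reduced solution. -/
def redPart {C e : ℝ} {M₁ M₂ M₃ : L2 ℝ × L2 ℝ → L2 ℝ × L2 ℝ} {M₄ : L2 ℝ × L2 ℝ →L[ℝ] L2 ℝ × L2 ℝ}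
    (H : SmallFamily M₁ M₂ M₃ M₄ C e) (g₀ g₁ : L2 ℝ) (L : L2 ℝ × L2 ℝ →L[ℝ] ℝ) (k : ℝ)
    (p : ℝ × ℝ × ℝ) : ℝ :=
  p.2.2 + k - L (quintPair g₀ g₁ p (H.sol p))

theorem SmallFamily.redFun_redPart {C e c : ℝ} {M₁ M₂ M₃ : L2 ℝ × L2 ℝ → L2 ℝ × L2 ℝ}
    {M₄ : L2 ℝ × L2 ℝ →L[ℝ] L2 ℝ × L2 ℝ} (H : SmallFamily M₁ M₂ M₃ M₄ C e) (h₀ : ‖g₀‖ + 1 ≤ c)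
    (h₁ : ‖g₁‖ + 1 ≤ c) (hC : 160 * c ^ 5 ≤ C) {L : L2 ℝ × L2 ℝ →L[ℝ] ℝ} (hL : ‖L‖ ≤ 1) (k : ℝ) :
    RedFun (L (quint₁ g₀ g₁ 0)) (L (quint₂ g₀ g₁ 0)) (L (quint₃ g₀ g₁ 0)) k
      (72 * C ^ 2 + 36 * C ^ 3) e (redPart H g₀ g₁ L k) ∧
    |L (quint₁ g₀ g₁ 0)| ≤ C ∧ |L (quint₂ g₀ g₁ 0)| ≤ C ∧ |L (quint₃ g₀ g₁ 0)| ≤ C := by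
  obtain ⟨b1, b2, b3⟩ := boundedLip_quint h₀ h₁
  obtain ⟨d1, d2, d3⟩ := contDiff_quint g₀ g₁ (n := ⊤)
  have c1 := b1.clm_of_le hL (by linarith : 1 * (160 * c ^ 5) ≤ C)
  have c2 := b2.clm_of_le hL (by linarith : 1 * (160 * c ^ 5) ≤ C)
  have c3 := b3.clm_of_le hL (by linarith : 1 * (160 * c ^ 5) ≤ C)
  refine ⟨?_, (c1 0 (by simp)).1, (c2 0 (by simp)).1, (c3 0 (by simp)).1⟩
  have := H.redFun c1 c2 c3 (L.contDiff.comp d1) (L.contDiff.comp d2) (L.contDiff.comp d3) k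
  convert this using 1
  ext p
  simp only [redPart, quintPair, quadForm, map_add, map_smul]

theorem inner_expOp_mulL (g h : L2 ℝ) (m : ℝ →ᵇ ℝ) :
    ⟪expOp ℝ g, mulL m (expOp ℝ h)⟫_ℝ = ∫ x, expAvg g x * (m x * expAvg h x) :=
  inner_expOp_eq_integral rfl (coeFn_mulL_expOp m h)

theorem pairFst_quint_zero (e₀ : expAvg g₀ = ψ₀) (e₁ : expAvg g₁ = ψ₁) :
    pairFst (expOp ℝ g₀) (quint₁ g₀ g₁ 0) = coef ψ₀ ψ₁ 6 0 ∧
    pairFst (expOp ℝ g₀) (quint₂ g₀ g₁ 0) = 10 * coef ψ₀ ψ₁ 4 2 ∧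
    pairFst (expOp ℝ g₀) (quint₃ g₀ g₁ 0) = 5 * coef ψ₀ ψ₁ 2 4 := by
  simp only [pairFst_apply, quint₁, quint₂, quint₃, Prod.fst_zero, Prod.snd_zero, add_zero,
    inner_smul_right, inner_expOp_mulL, BoundedContinuousFunction.mul_apply,
    BoundedContinuousFunction.coe_pow, Pi.pow_apply, sobolevEmb_apply, e₀, e₁, coef]
  refine ⟨?_, ?_, ?_⟩
  · congr 1; ext x; ring
  · congr 2; ext x; ring
  · congr 2; ext x; ring

theorem pairSnd_quint_zero (e₀ : expAvg g₀ = ψ₀) (e₁ : expAvg g₁ = ψ₁) :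
    pairSnd (expOp ℝ g₁) (quint₁ g₀ g₁ 0) = 5 * coef ψ₀ ψ₁ 4 2 ∧
    pairSnd (expOp ℝ g₁) (quint₂ g₀ g₁ 0) = 10 * coef ψ₀ ψ₁ 2 4 := by
  simp only [pairSnd_apply, quint₁, quint₂, Prod.fst_zero, Prod.snd_zero, add_zero,
    inner_smul_right, inner_expOp_mulL, BoundedContinuousFunction.mul_apply,
    BoundedContinuousFunction.coe_pow, Pi.pow_apply, sobolevEmb_apply, e₀, e₁, coef]
  refine ⟨?_, ?_⟩
  · congr 2; ext x; ring
  · congr 2; ext x; ring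

section Reduced

variable {C e : ℝ} {A : L2 ℝ →L[ℝ] L2 ℝ}
  (H : SmallFamily (fun x => diag (solveOp g₀ g₁ A) (quint₁ g₀ g₁ x))
      (fun x => diag (solveOp g₀ g₁ A) (quint₂ g₀ g₁ x))
      (fun x => diag (solveOp g₀ g₁ A) (quint₃ g₀ g₁ x))
      (-diag (A.comp ((expOpAdj ℝ).comp (expOp ℝ)))) C e)

theorem SpectralPair.redPair (S : SpectralPair v ω₀ ω₁ g₀ g₁) (e₀ : expAvg g₀ = ψ₀)
    (e₁ : expAvg g₁ = ψ₁) {a₀ c : ℝ} (ha : 0 < a₀) (hI : InteractionBounds a₀ ψ₀ ψ₁)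
    (h₀ : ‖g₀‖ + 1 ≤ c) (h₁ : ‖g₁‖ + 1 ≤ c) (hC : 160 * c ^ 5 ≤ C) :
    RedPair a₀ C (72 * C ^ 2 + 36 * C ^ 3) e (coef ψ₀ ψ₁ 6 0) (coef ψ₀ ψ₁ 4 2) (coef ψ₀ ψ₁ 2 4)
      (pairSnd (expOp ℝ g₁) (quint₃ g₀ g₁ 0)) (ω₀ - ω₁)
      (redPart H g₀ g₁ (pairFst (expOp ℝ g₀)) 0)
      (redPart H g₀ g₁ (pairSnd (expOp ℝ g₁)) (ω₀ - ω₁)) := by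
  obtain ⟨f0, fA, fB, fD⟩ := H.redFun_redPart h₀ h₁ hC (norm_pairFst_le S.norm₀) 0
  obtain ⟨f1, -, -, -⟩ := H.redFun_redPart h₀ h₁ hC (norm_pairSnd_le S.norm₁) (ω₀ - ω₁)
  obtain ⟨v1, v2, v3⟩ := pairFst_quint_zero e₀ e₁
  obtain ⟨w1, w2⟩ := pairSnd_quint_zero e₀ e₁
  rw [v1, v2, v3] at f0
  rw [w1, w2] at f1
  rw [v1] at fA
  rw [v2, abs_mul, abs_of_pos (by norm_num : (0 : ℝ) < 10)] at fB
  rw [v3, abs_mul, abs_of_pos (by norm_num : (0 : ℝ) < 5)] at fD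
  have hC0 := H.h₁.nonneg
  exact ⟨f0, f1, fA, by linarith [abs_nonneg (coef ψ₀ ψ₁ 4 2)],
    by linarith [abs_nonneg (coef ψ₀ ψ₁ 2 4)], ha, hI.1, hI.2, by positivity⟩

theorem quinticPairing_eq (e₀ : expAvg g₀ = ψ₀) (e₁ : expAvg g₁ = ψ₁) {g : L2 ℝ} {ψ : ℝ → ℝ}
    (hψ : expAvg g = ψ) (ρ₀ ρ₁ ω : ℝ) :
    quinticPairing ψ ψ₀ ψ₁ (fun ρ₀ ρ₁ ω => expAvg (reductionPre H ρ₀ ρ₁ (ω - ω₀))) ρ₀ ρ₁ ω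
      = ρ₀ * pairFst (expOp ℝ g) (quintPair g₀ g₁ (ρ₁ ^ 2, ρ₀ ^ 2, ω - ω₀)
          (H.sol (ρ₁ ^ 2, ρ₀ ^ 2, ω - ω₀)))
        + ρ₁ * pairSnd (expOp ℝ g) (quintPair g₀ g₁ (ρ₁ ^ 2, ρ₀ ^ 2, ω - ω₀)
          (H.sol (ρ₁ ^ 2, ρ₀ ^ 2, ω - ω₀))) := by
  have h := coeFn_quintic (ρ₀ • g₀ + ρ₁ • g₁ + reductionPre H ρ₀ ρ₁ (ω - ω₀))
  rw [expAvg_profile e₀ e₁] at h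
  have h2 := inner_expOp_eq_integral hψ h
  rw [quinticPairing, ← h2, quintic_reductionPre, inner_add_right, inner_smul_right,
    inner_smul_right]
  rfl

variable {r : ℝ}

/-- The pairing is `ρ₀ a + ρ₁ b` with `a`, `b` functions of `ρ₁²`. Evenness in `ρ₁` removes `ρ₁ b`,
and a factor `ρ₀` comes out. -/
theorem redF_eq (hη : IsReductionMap v ψ₀ ψ₁ ω₀ e r
    (fun ρ₀ ρ₁ ω => expAvg (reductionPre H ρ₀ ρ₁ (ω - ω₀)))) (e₀ : expAvg g₀ = ψ₀)
    (e₁ : expAvg g₁ = ψ₁) (hV : Function.Even v) (E₀ : Function.Even ψ₀) (O₁ : Function.Odd ψ₁)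
    {ρ₀ ρ₁ ω : ℝ} (hb : InBox e ω₀ ρ₀ ρ₁ ω) :
    redF ψ₀ ψ₁ ω₀ (fun ρ₀ ρ₁ ω => expAvg (reductionPre H ρ₀ ρ₁ (ω - ω₀))) ρ₀ ρ₁ ω
      = ρ₀ * redPart H g₀ g₁ (pairFst (expOp ℝ g₀)) 0 (ρ₁ ^ 2, ρ₀ ^ 2, ω - ω₀) := by
  have h1 := hη.pairing_even hV E₀ O₁ hb
  rw [quinticPairing_eq H e₀ e₁ e₀, quinticPairing_eq H e₀ e₁ e₀, neg_sq] at h1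
  rw [redF, quinticPairing_eq H e₀ e₁ e₀, redPart]
  linarith

/-- Here oddness in `ρ₁` removes the term with `ρ₀`, so that division by `ρ₁` is exact. -/
theorem pairing_one_eq (hη : IsReductionMap v ψ₀ ψ₁ ω₀ e r
    (fun ρ₀ ρ₁ ω => expAvg (reductionPre H ρ₀ ρ₁ (ω - ω₀)))) (e₀ : expAvg g₀ = ψ₀)
    (e₁ : expAvg g₁ = ψ₁) (hV : Function.Even v) (E₀ : Function.Even ψ₀) (O₁ : Function.Odd ψ₁)
    {ρ₀ ρ₁ ω : ℝ} (hb : InBox e ω₀ ρ₀ ρ₁ ω) :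
    quinticPairing ψ₁ ψ₀ ψ₁ (fun ρ₀ ρ₁ ω => expAvg (reductionPre H ρ₀ ρ₁ (ω - ω₀))) ρ₀ ρ₁ ω
      = ρ₁ * (ω - ω₁ - redPart H g₀ g₁ (pairSnd (expOp ℝ g₁)) (ω₀ - ω₁)
        (ρ₁ ^ 2, ρ₀ ^ 2, ω - ω₀)) := by
  have h1 := hη.pairing_odd hV E₀ O₁ hb
  rw [quinticPairing_eq H e₀ e₁ e₁, quinticPairing_eq H e₀ e₁ e₁, neg_sq] at h1
  rw [quinticPairing_eq H e₀ e₁ e₁, redPart]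
  linarith

theorem norm_params_lt {ρ₀ ρ₁ ω : ℝ} (he1 : e ≤ 1) (hb : InBox e ω₀ ρ₀ ρ₁ ω) :
    ‖((ρ₁ ^ 2, ρ₀ ^ 2, ω - ω₀) : ℝ × ℝ × ℝ)‖ < e := by
  obtain ⟨h1, h2, h3⟩ := hb
  have hsq : ∀ {ρ : ℝ}, |ρ| < e → |ρ ^ 2| < e := fun {ρ} h => by
    rw [abs_pow]; nlinarith [abs_nonneg ρ]
  exact norm_triple_lt.2 ⟨hsq h2, hsq h1, h3⟩

/-- Near `ρ₁ = 0` the pairing is `s h(s)`, whose derivative at `0` is `h(0)`; both branches of the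
definition give the same formula. -/
theorem redG_eq (hη : IsReductionMap v ψ₀ ψ₁ ω₀ e r
    (fun ρ₀ ρ₁ ω => expAvg (reductionPre H ρ₀ ρ₁ (ω - ω₀)))) (e₀ : expAvg g₀ = ψ₀)
    (e₁ : expAvg g₁ = ψ₁) (hV : Function.Even v) (E₀ : Function.Even ψ₀) (O₁ : Function.Odd ψ₁)
    (hsm : ∀ p : ℝ × ℝ × ℝ, ‖p‖ < e →
      DifferentiableAt ℝ (redPart H g₀ g₁ (pairSnd (expOp ℝ g₁)) (ω₀ - ω₁)) p)
    {ρ₀ ρ₁ ω : ℝ} (hb : InBox e ω₀ ρ₀ ρ₁ ω) :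
    redG ψ₀ ψ₁ ω₁ (fun ρ₀ ρ₁ ω => expAvg (reductionPre H ρ₀ ρ₁ (ω - ω₀))) ρ₀ ρ₁ ω
      = redPart H g₀ g₁ (pairSnd (expOp ℝ g₁)) (ω₀ - ω₁) (ρ₁ ^ 2, ρ₀ ^ 2, ω - ω₀) := by
  rw [redG]
  split_ifs with h0
  · subst h0
    set h : ℝ → ℝ := fun s => ω - ω₁ - redPart H g₀ g₁ (pairSnd (expOp ℝ g₁)) (ω₀ - ω₁)
        (s ^ 2, ρ₀ ^ 2, ω - ω₀) with hh
    have hev : (fun s => quinticPairing ψ₁ ψ₀ ψ₁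
        (fun ρ₀ ρ₁ ω => expAvg (reductionPre H ρ₀ ρ₁ (ω - ω₀))) ρ₀ s ω)
        =ᶠ[𝓝 0] fun s => s * h s := by
      have : ∀ᶠ s : ℝ in 𝓝 0, |s| < e :=
        (continuous_abs.tendsto 0).eventually_lt_const (by rw [abs_zero]; exact H.pos)
      filter_upwards [this] with s hs
      exact pairing_one_eq H hη e₀ e₁ hV E₀ O₁ ⟨hb.1, hs, hb.2.2⟩
    have hp := norm_params_lt H.le_one hb
    have hd : DifferentiableAt ℝ h 0 := by
      have h1 : DifferentiableAt ℝ (fun s : ℝ => ((s ^ 2, ρ₀ ^ 2, ω - ω₀) : ℝ × ℝ × ℝ)) 0 := by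
        fun_prop
      exact (DifferentiableAt.comp (f := fun s : ℝ => ((s ^ 2, ρ₀ ^ 2, ω - ω₀) : ℝ × ℝ × ℝ)) 0
        (hsm _ hp) h1).const_sub _
    have hmul : deriv (fun s => s * h s) 0 = 1 * h 0 + 0 * deriv h 0 :=
      ((hasDerivAt_id' (0 : ℝ)).mul hd.hasDerivAt).deriv
    rw [hev.deriv_eq, hmul]
    simp only [hh]
    ring
  · rw [pairing_one_eq H hη e₀ e₁ hV E₀ O₁ hb, ← mul_assoc, one_div, inv_mul_cancel₀ h0]
    ring

end Reduced
end QuinticNLS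

namespace QuinticNLS
open Set Filter
open scoped ContDiff

/-! ### Functions of the square of the parameter -/

/-- First-order Taylor expansion of `k` evaluated at `t²`. Analyticity makes `k'` differentiable at
`0`, which justifies the second derivative. -/
theorem comp_sq_facts {k : ℝ → ℝ} (hk : ContDiffAt ℝ ω k 0) :
    (∀ᶠ t in 𝓝 (0 : ℝ), ContDiffAt ℝ ω (fun t => k (t ^ 2)) t) ∧
    deriv (fun t => k (t ^ 2)) 0 = 0 ∧
    iteratedDeriv 2 (fun t => k (t ^ 2)) 0 = 2 * deriv k 0 ∧
    (fun t => k (t ^ 2) - (k 0 + iteratedDeriv 2 (fun t => k (t ^ 2)) 0 / 2 * t ^ 2)) =o[𝓝 0]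
      (fun t : ℝ => t ^ 2) := by
  have hsq : Tendsto (fun t : ℝ => t ^ 2) (𝓝 0) (𝓝 0) := by
    simpa using (continuous_pow 2).tendsto (0 : ℝ)
  have hev : ∀ᶠ t in 𝓝 (0 : ℝ), ContDiffAt ℝ ω k (t ^ 2) := hsq.eventually (hk.eventually (by simp))
  have hd : ∀ᶠ t in 𝓝 (0 : ℝ), deriv (fun t => k (t ^ 2)) t = deriv k (t ^ 2) * (2 * t) := by
    filter_upwards [hev] with t ht
    have h1 : HasDerivAt (fun t : ℝ => t ^ 2) (2 * t) t := by simpa using hasDerivAt_pow 2 t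
    have h2 := (ht.differentiableAt (by simp)).hasDerivAt
    exact (HasDerivAt.comp (h₂ := k) (h := fun t : ℝ => t ^ 2) t h2 h1).deriv
  have h2 : iteratedDeriv 2 (fun t => k (t ^ 2)) 0 = 2 * deriv k 0 := by
    rw [iteratedDeriv_succ, iteratedDeriv_one, Filter.EventuallyEq.deriv_eq hd]
    have a1 : AnalyticAt ℝ (deriv k) ((0 : ℝ) ^ 2) := by
      have : AnalyticAt ℝ k ((0 : ℝ) ^ 2) := by
        rw [zero_pow two_ne_zero]; exact hk.analyticAt
      exact this.deriv
    have a2 : DifferentiableAt ℝ (fun t : ℝ => deriv k (t ^ 2)) 0 :=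
      DifferentiableAt.comp (f := fun t : ℝ => t ^ 2) 0 a1.differentiableAt (by fun_prop)
    have a3 : HasDerivAt (fun t : ℝ => 2 * t) 2 0 := by
      simpa using (hasDerivAt_id (0 : ℝ)).const_mul 2
    have := (a2.hasDerivAt.mul a3).deriv
    refine this.trans ?_
    simp; ring
  refine ⟨?_, by rw [hd.self_of_nhds]; simp, h2, ?_⟩
  · filter_upwards [hev] with t ht
    exact ContDiffAt.comp (f := fun t : ℝ => t ^ 2) t ht (by fun_prop)
  · rw [h2]
    have h3 := ((hk.differentiableAt (by simp)).hasDerivAt.isLittleO).comp_tendsto hsq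
    refine h3.congr (fun t => ?_) (fun t => ?_)
    · simp; ring
    · simp

/-! ### From the reduced functions to the reduced system -/

theorem hasDerivAt_comp_of_fderiv {f : ℝ × ℝ × ℝ → ℝ} {p : ℝ × ℝ × ℝ}
    (hf : DifferentiableAt ℝ f p) {γ : ℝ → ℝ × ℝ × ℝ} {t : ℝ} (hγt : γ t = p) {γ' : ℝ × ℝ × ℝ}
    (hγ : HasDerivAt γ γ' t) : HasDerivAt (fun t => f (γ t)) (fderiv ℝ f p γ') t := by
  subst hγt
  exact hf.hasFDerivAt.comp_hasDerivAt t hγ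

/-- Smallness of the box in terms of the constants of the reduced equations. -/
structure SmallBox (a₀ M C e : ℝ) : Prop where
  pos : 0 < e
  le_one : e ≤ 1
  M_nonneg : 0 ≤ M
  C_nonneg : 0 ≤ C
  small₁ : 1000 * (M + C + 1) ^ 2 * e ≤ 1
  small₂ : 1000 * (M + C + 1) ^ 2 * e ≤ a₀

/-- Since `s = ρ₀²`, the scales are `e²` for uniqueness and `e² / 2` for existence. The factor
`1000` is a generous margin for all the products involved. -/
theorem SmallBox.facts {a₀ M C e : ℝ} (h : SmallBox a₀ M C e) :
    (M + C) * (e ^ 2 / 2) ^ 2 < e / 2 ∧ 2 * (C * (e ^ 2) ^ 4) ≤ 1 ∧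
    2 * (C * (e ^ 2 / 2) ^ 4) ≤ 1 ∧
    2 * C * (1 + 2 * (2 * M + C)) * (e ^ 2) ^ 2 < a₀ ∧ 4 * C * (e ^ 2 / 2) ^ 2 ≤ a₀ ∧
    16 * C * (e ^ 2) ^ 2 ≤ 1 ∧ 16 * C * (e ^ 2) ^ 2 * (32 * M + 6) ≤ a₀ := by
  obtain ⟨h0, h1, hM, hC, s1, s2⟩ := h
  set X := M + C + 1 with hX
  have hX1 : 1 ≤ X := by linarith
  have hCX : C ≤ X := by linarith
  have hMX : M ≤ X := by linarith
  have hXX : X ≤ X ^ 2 := by nlinarith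
  have e4 : e ^ 4 ≤ e := pow_le_of_le_one h0.le h1 (by norm_num)
  have e8 : e ^ 8 ≤ e := pow_le_of_le_one h0.le h1 (by norm_num)
  have e3 : e ^ 3 ≤ 1 := pow_le_one₀ h0.le h1
  have hXe : X * e ≤ X ^ 2 * e := mul_le_mul_of_nonneg_right hXX h0.le
  have hXp : 0 < X ^ 2 * e := by positivity
  have c4 : C * e ^ 4 ≤ X * e := mul_le_mul hCX e4 (by positivity) (by linarith)
  have c8 : C * e ^ 8 ≤ X * e := mul_le_mul hCX e8 (by positivity) (by linarith)
  have p4 : (e ^ 2) ^ 2 = e ^ 4 := by ring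
  have p8 : (e ^ 2) ^ 4 = e ^ 8 := by ring
  have q4 : (e ^ 2 / 2) ^ 2 = e ^ 4 / 4 := by ring
  have q8 : (e ^ 2 / 2) ^ 4 = e ^ 8 / 16 := by ring
  have c0 : 0 ≤ C * e ^ 8 := by positivity
  rw [p4, p8, q4, q8]
  refine ⟨?_, by linarith, by linarith, ?_, by linarith, by linarith, ?_⟩
  · have t1 : (M + C) * e ^ 4 ≤ X * e ^ 4 :=
      mul_le_mul_of_nonneg_right (by linarith) (by positivity)
    have t2 : X * e * e ^ 3 ≤ 1 * e ^ 3 * 1 := by nlinarith [pow_pos h0 3]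
    have t3 : X * e ^ 4 ≤ X * e * 1 * e := by
      have : e ^ 4 ≤ e ^ 2 := pow_le_pow_of_le_one h0.le h1 (by norm_num)
      nlinarith
    have t4 : X * e * e ≤ 1 * e := mul_le_mul_of_nonneg_right (by linarith) h0.le
    linarith
  · have t1 : C * e ^ 4 * (1 + 2 * (2 * M + C)) ≤ X * e * (5 * X) :=
      mul_le_mul c4 (by linarith) (by positivity) (by positivity)
    have : X * e * (5 * X) = 5 * (X ^ 2 * e) := by ring
    linarith
  · have t1 : C * e ^ 4 * (32 * M + 6) ≤ X * e * (38 * X) :=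
      mul_le_mul c4 (by linarith) (by positivity) (by positivity)
    have : X * e * (38 * X) = 38 * (X ^ 2 * e) := by ring
    linarith

/-- The constant of the final estimates. -/
def branchConst (a₀ M C : ℝ) : ℝ :=
  16 * C * ((4 + 20 * M) * (1 + 10 * M / a₀) / a₀)
    + 32 * C * ((32 * M + 2 + (4 + 12 * M) * (60 * M ^ 2 / a₀)) / a₀) + 1

section Main

variable {a₀ M C e A B D E d ω₀ : ℝ} {f g : ℝ × ℝ × ℝ → ℝ} {F G : ℝ → ℝ → ℝ → ℝ}

/-- `F = ρ₀ f` and `G = g` in the variables `ρ₁²`, `ρ₀²`, `ω - ω₀`. -/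
structure ReducesTo (e ω₀ : ℝ) (f g : ℝ × ℝ × ℝ → ℝ) (F G : ℝ → ℝ → ℝ → ℝ) : Prop where
  F_eq : ∀ ρ₀ ρ₁ z, InBox e ω₀ ρ₀ ρ₁ z → F ρ₀ ρ₁ z = ρ₀ * f (ρ₁ ^ 2, ρ₀ ^ 2, z - ω₀)
  G_eq : ∀ ρ₀ ρ₁ z, InBox e ω₀ ρ₀ ρ₁ z → G ρ₀ ρ₁ z = g (ρ₁ ^ 2, ρ₀ ^ 2, z - ω₀)

theorem eventually_inBox {ρ₀ ρ₁ z : ℝ} (h : InBox e ω₀ ρ₀ ρ₁ z) :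
    ∀ᶠ p : ℝ × ℝ × ℝ in 𝓝 (ρ₀, ρ₁, z), InBox e ω₀ p.1 p.2.1 p.2.2 := by
  have h1 : Continuous fun p : ℝ × ℝ × ℝ => |p.1| := by fun_prop
  have h2 : Continuous fun p : ℝ × ℝ × ℝ => |p.2.1| := by fun_prop
  have h3 : Continuous fun p : ℝ × ℝ × ℝ => |p.2.2 - ω₀| := by fun_prop
  exact ((h1.tendsto (ρ₀, ρ₁, z)).eventually_lt_const h.1).and
    (((h2.tendsto (ρ₀, ρ₁, z)).eventually_lt_const h.2.1).and
      ((h3.tendsto (ρ₀, ρ₁, z)).eventually_lt_const h.2.2))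

/-! ### The bifurcation point, its nondegeneracy and the branch. -/

namespace RedPair

/-- The bifurcation point. -/
theorem exists_bifurcation (H : RedPair a₀ M C e A B D E d f g) (hs : SmallBox a₀ M C e)
    (hF : ReducesTo e ω₀ f g F G) (hd : 0 < d) (hde : d < a₀ * (e ^ 2 / 2) ^ 2 / 2) :
    ∃ ρs ωs, IsBifurcationPoint F G ω₀ e ρs ωs ∧
      ∀ ρ z, IsBifurcationPoint F G ω₀ e ρ z → ρ = ρs ∧ z = ωs := by
  obtain ⟨c1, c2, c3, c4, c5, c6, c7⟩ := hs.facts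
  have h0 := hs.pos
  have h1 := hs.le_one
  have he2 : e ^ 2 ≤ e := pow_le_of_le_one h0.le h1 two_ne_zero
  -- Existence with `s ≤ e² / 2` leaves the root strictly inside the range `s < e²` of uniqueness,
  -- so `√s < e`.
  obtain ⟨s, w, hs0, hst, hw, hf0, hg0⟩ := H.exists_zero (t := e ^ 2 / 2) (b := e / 2)
    (by positivity) (by linarith) (by linarith) c3 c1 (by linarith) c5 hd hde
  have hρ2 : Real.sqrt s ^ 2 = s := Real.sq_sqrt hs0.le
  have hρ0 : 0 < Real.sqrt s := Real.sqrt_pos.2 hs0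
  have hρe : Real.sqrt s < e := by
    rw [Real.sqrt_lt' h0]; nlinarith [pow_pos h0 2]
  have hwe : |ω₀ + w - ω₀| < e := by rw [add_sub_cancel_left]; linarith
  have hbox : InBox e ω₀ (Real.sqrt s) 0 (ω₀ + w) :=
    ⟨by rwa [abs_of_pos hρ0], by rwa [abs_zero], hwe⟩
  refine ⟨Real.sqrt s, ω₀ + w, ⟨hρ0, hρe, hwe, ?_, ?_⟩, fun ρ z hb => ?_⟩
  · rw [hF.F_eq _ _ _ hbox, hρ2, add_sub_cancel_left, zero_pow two_ne_zero, hf0, mul_zero]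
  · rw [hF.G_eq _ _ _ hbox, hρ2, add_sub_cancel_left, zero_pow two_ne_zero, hg0]
  · obtain ⟨b1, b2, b3, b4, b5⟩ := hb
    have hbox' : InBox e ω₀ ρ 0 z := ⟨by rwa [abs_of_pos b1], by rwa [abs_zero], b3⟩
    rw [hF.F_eq _ _ _ hbox', zero_pow two_ne_zero] at b4
    rw [hF.G_eq _ _ _ hbox', zero_pow two_ne_zero] at b5
    have b4' := (mul_eq_zero.1 b4).resolve_left b1.ne'
    have hρs : ρ ^ 2 < e ^ 2 := pow_lt_pow_left₀ b2 b1.le two_ne_zero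
    obtain ⟨u1, u2⟩ := H.unique (t := e ^ 2) (by linarith) he2 c2 c4 (by positivity) hρs hs0
      (by linarith [pow_pos h0 2]) b3 (by linarith) b4' hf0 b5 hg0
    refine ⟨?_, by linarith⟩
    rw [← u1, Real.sqrt_sq b1.le]

/-- Smoothness and nondegeneracy at the bifurcation point. -/
theorem smooth_and_rank (H : RedPair a₀ M C e A B D E d f g) (hs : SmallBox a₀ M C e)
    (hF : ReducesTo e ω₀ f g F G) {ρs ωs : ℝ} (hb : IsBifurcationPoint F G ω₀ e ρs ωs) :
    ContDiffAt ℝ (⊤ : ℕ∞) (fun p : ℝ × ℝ × ℝ => F p.1 p.2.1 p.2.2) (ρs, 0, ωs) ∧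
    ContDiffAt ℝ (⊤ : ℕ∞) (fun p : ℝ × ℝ × ℝ => G p.1 p.2.1 p.2.2) (ρs, 0, ωs) ∧
    (jacobian F G ρs 0 ωs).rank = 2 := by
  obtain ⟨-, -, -, -, -, c6, c7⟩ := hs.facts
  have h0 := hs.pos
  have h1 := hs.le_one
  have hM := hs.M_nonneg
  have hC := hs.C_nonneg
  obtain ⟨b1, b2, b3, b4, b5⟩ := hb
  have hbox : InBox e ω₀ ρs 0 ωs := ⟨by rwa [abs_of_pos b1], by rwa [abs_zero], b3⟩
  have hev := eventually_inBox hbox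
  have hse2 : ρs ^ 2 < e ^ 2 := pow_lt_pow_left₀ b2 b1.le two_ne_zero
  have he2 : e ^ 2 ≤ e := pow_le_of_le_one h0.le h1 two_ne_zero
  have hs0 : 0 < ρs ^ 2 := by positivity
  set p : ℝ × ℝ × ℝ := (0, ρs ^ 2, ωs - ω₀) with hp
  have hpe : ‖p‖ < e := norm_triple_lt.2 ⟨by simpa using h0, by rw [abs_of_pos hs0]; linarith, b3⟩
  rw [hF.F_eq _ _ _ hbox, zero_pow two_ne_zero] at b4
  rw [hF.G_eq _ _ _ hbox, zero_pow two_ne_zero] at b5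
  have hf0 : f p = 0 := (mul_eq_zero.1 b4).resolve_left b1.ne'
  have hcf := H.hf.smooth p hpe
  have hcg := H.hg.smooth p hpe
  have hmap : ContDiffAt ℝ ω (fun q : ℝ × ℝ × ℝ => ((q.2.1 ^ 2, q.1 ^ 2, q.2.2 - ω₀) : ℝ × ℝ × ℝ))
      (ρs, 0, ωs) := by fun_prop
  have hp' : ((0 : ℝ) ^ 2, ρs ^ 2, ωs - ω₀) = p := by rw [hp, zero_pow two_ne_zero]
  refine ⟨?_, ?_, ?_⟩
  · refine ContDiffAt.of_le (n := ω) ?_ le_top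
    have h2 : ContDiffAt ℝ ω (fun q : ℝ × ℝ × ℝ => q.1 * f (q.2.1 ^ 2, q.1 ^ 2, q.2.2 - ω₀))
        (ρs, 0, ωs) :=
      contDiffAt_fst.mul (ContDiffAt.comp (f := fun q : ℝ × ℝ × ℝ =>
        ((q.2.1 ^ 2, q.1 ^ 2, q.2.2 - ω₀) : ℝ × ℝ × ℝ)) _ (by simpa only [hp'] using hcf) hmap)
    exact h2.congr_of_eventuallyEq (hev.mono fun q hq => hF.F_eq _ _ _ hq)
  · refine ContDiffAt.of_le (n := ω) ?_ le_top
    have h2 : ContDiffAt ℝ ω (fun q : ℝ × ℝ × ℝ => g (q.2.1 ^ 2, q.1 ^ 2, q.2.2 - ω₀))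
        (ρs, 0, ωs) :=
      ContDiffAt.comp (f := fun q : ℝ × ℝ × ℝ =>
        ((q.2.1 ^ 2, q.1 ^ 2, q.2.2 - ω₀) : ℝ × ℝ × ℝ)) _ (by simpa only [hp'] using hcg) hmap
    exact h2.congr_of_eventuallyEq (hev.mono fun q hq => hF.G_eq _ _ _ hq)
  · have hω : (ω : ℕ∞ω) ≠ 0 := by simp
    have hfd := hcf.differentiableAt hω
    have hgd := hcg.differentiableAt hω
    have hdet := (H.exists_branch (s := ρs ^ 2) (w := ωs - ω₀) hs0 (by linarith) (by linarith) b3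
      (by
        have : (ρs ^ 2) ^ 2 ≤ (e ^ 2) ^ 2 := pow_le_pow_left₀ hs0.le hse2.le 2
        have := mul_le_mul_of_nonneg_left this (by positivity : 0 ≤ 16 * C)
        linarith)
      (by
        have : (ρs ^ 2) ^ 2 ≤ (e ^ 2) ^ 2 := pow_le_pow_left₀ hs0.le hse2.le 2
        have := mul_le_mul_of_nonneg_left this (by positivity : 0 ≤ 16 * C)
        have := mul_le_mul_of_nonneg_right this (by positivity : 0 ≤ 32 * M + 6)
        linarith) hf0 b5).1
    have t1 : Tendsto (fun t : ℝ => ((t, 0, ωs) : ℝ × ℝ × ℝ)) (𝓝 ρs) (𝓝 (ρs, 0, ωs)) :=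
      (by fun_prop : Continuous fun t : ℝ => ((t, 0, ωs) : ℝ × ℝ × ℝ)).tendsto ρs
    have t2 : Tendsto (fun t : ℝ => ((ρs, 0, t) : ℝ × ℝ × ℝ)) (𝓝 ωs) (𝓝 (ρs, 0, ωs)) :=
      (by fun_prop : Continuous fun t : ℝ => ((ρs, 0, t) : ℝ × ℝ × ℝ)).tendsto ωs
    have γ1 : HasDerivAt (fun t : ℝ => (((0 : ℝ) ^ 2, t ^ 2, ωs - ω₀) : ℝ × ℝ × ℝ))
        ((2 * ρs) • (0, 1, 0)) ρs := by
      have h2 : HasDerivAt (fun t : ℝ => t ^ 2) (2 * ρs) ρs := by simpa using hasDerivAt_pow 2 ρs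
      refine ((hasDerivAt_const ρs ((0 : ℝ) ^ 2)).prodMk
        (h2.prodMk (hasDerivAt_const ρs (ωs - ω₀)))).congr_deriv ?_
      simp
    have γ2 : HasDerivAt (fun t : ℝ => (((0 : ℝ) ^ 2, ρs ^ 2, t - ω₀) : ℝ × ℝ × ℝ))
        (0, 0, 1) ωs :=
      (hasDerivAt_const ωs ((0 : ℝ) ^ 2)).prodMk
        ((hasDerivAt_const ωs (ρs ^ 2)).prodMk ((hasDerivAt_id ωs).sub_const ω₀))
    have f1 := hasDerivAt_comp_of_fderiv hfd hp' γ1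
    have f2 := hasDerivAt_comp_of_fderiv hfd hp' γ2
    have g1 := hasDerivAt_comp_of_fderiv hgd hp' γ1
    have g2 := hasDerivAt_comp_of_fderiv hgd hp' γ2
    rw [map_smul, smul_eq_mul] at f1 g1
    have d1 : deriv (fun s => F s 0 ωs) ρs = ρs * (2 * ρs * fderiv ℝ f p (0, 1, 0)) := by
      -- The product rule term `f p` drops out because `f` vanishes at the bifurcation point.
      have hm := (hasDerivAt_id' ρs).mul f1
      rw [hp', hf0, mul_zero, zero_add] at hm
      exact (hm.congr_of_eventuallyEq ((t1.eventually hev).mono fun t ht =>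
        hF.F_eq _ _ _ ht)).deriv
    have d2 : deriv (fun s => F ρs 0 s) ωs = ρs * fderiv ℝ f p (0, 0, 1) :=
      ((f2.const_mul ρs).congr_of_eventuallyEq ((t2.eventually hev).mono fun t ht =>
        hF.F_eq _ _ _ ht)).deriv
    have d3 : deriv (fun s => G s 0 ωs) ρs = 2 * ρs * fderiv ℝ g p (0, 1, 0) :=
      (g1.congr_of_eventuallyEq ((t1.eventually hev).mono fun t ht => hF.G_eq _ _ _ ht)).deriv
    have d4 : deriv (fun s => G ρs 0 s) ωs = fderiv ℝ g p (0, 0, 1) :=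
      (g2.congr_of_eventuallyEq ((t2.eventually hev).mono fun t ht => hF.G_eq _ _ _ ht)).deriv
    have hU : IsUnit (jacobian F G ρs 0 ωs) := by
      rw [Matrix.isUnit_iff_isUnit_det, jacobian, Matrix.det_fin_two_of, d1, d2, d3, d4,
        isUnit_iff_ne_zero]
      have : ρs * (2 * ρs * fderiv ℝ f p (0, 1, 0)) * fderiv ℝ g p (0, 0, 1)
          - ρs * fderiv ℝ f p (0, 0, 1) * (2 * ρs * fderiv ℝ g p (0, 1, 0))
          = 2 * ρs ^ 2 * (fderiv ℝ f p (0, 1, 0) * fderiv ℝ g p (0, 0, 1)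
            - fderiv ℝ f p (0, 0, 1) * fderiv ℝ g p (0, 1, 0)) := by ring
      rw [this]
      exact mul_ne_zero (by positivity) hdet
    simpa using Matrix.rank_of_isUnit _ hU

/-- The branch through the bifurcation point and its expansion. -/
theorem exists_isBranch (H : RedPair a₀ M C e A B D E d f g) (hs : SmallBox a₀ M C e)
    (hF : ReducesTo e ω₀ f g F G) {ρs ωs : ℝ} (hb : IsBifurcationPoint F G ω₀ e ρs ωs) :
    ∃ (τ : ℝ) (R Ω : ℝ → ℝ), 0 < τ ∧ IsBranch F G ω₀ e ρs ωs τ R Ω ∧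
      (∀ t ∈ Ioo (-τ) τ, 0 < R t) ∧ deriv R 0 = 0 ∧ deriv Ω 0 = 0 ∧
      (fun t => R t - (ρs + iteratedDeriv 2 R 0 / 2 * t ^ 2)) =o[𝓝 0] (fun t : ℝ => t ^ 2) ∧
      (fun t => Ω t - (ωs + iteratedDeriv 2 Ω 0 / 2 * t ^ 2)) =o[𝓝 0] (fun t : ℝ => t ^ 2) ∧
      |iteratedDeriv 2 Ω 0 - 20 * ρs ^ 2 * ((5 * B ^ 2 - A * D) / (5 * B - A))|
        ≤ branchConst a₀ M C * ρs ^ 6 ∧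
      0 < iteratedDeriv 2 Ω 0 ∧
      |iteratedDeriv 2 R 0 - 5 / ρs * ((B - D) / (5 * B - A))|
        ≤ branchConst a₀ M C * ρs ^ 3 := by
  obtain ⟨-, -, -, -, -, c6, c7⟩ := hs.facts
  have h0 := hs.pos
  have h1 := hs.le_one
  have hM := hs.M_nonneg
  have hC := hs.C_nonneg
  have ha := H.ha
  obtain ⟨b1, b2, b3, b4, b5⟩ := hb
  have hbox : InBox e ω₀ ρs 0 ωs := ⟨by rwa [abs_of_pos b1], by rwa [abs_zero], b3⟩
  have hse2 : ρs ^ 2 < e ^ 2 := pow_lt_pow_left₀ b2 b1.le two_ne_zero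
  have he2 : e ^ 2 ≤ e := pow_le_of_le_one h0.le h1 two_ne_zero
  have hs0 : 0 < ρs ^ 2 := by positivity
  rw [hF.F_eq _ _ _ hbox, zero_pow two_ne_zero] at b4
  rw [hF.G_eq _ _ _ hbox, zero_pow two_ne_zero] at b5
  obtain ⟨-, S, W, hS, hW, S0, W0, hz, eS, eW, pW⟩ :=
    H.exists_branch (s := ρs ^ 2) (w := ωs - ω₀) hs0 (by linarith) (by linarith) b3
      (by
        have : (ρs ^ 2) ^ 2 ≤ (e ^ 2) ^ 2 := pow_le_pow_left₀ hs0.le hse2.le 2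
        have := mul_le_mul_of_nonneg_left this (by positivity : 0 ≤ 16 * C)
        linarith)
      (by
        have : (ρs ^ 2) ^ 2 ≤ (e ^ 2) ^ 2 := pow_le_pow_left₀ hs0.le hse2.le 2
        have := mul_le_mul_of_nonneg_left this (by positivity : 0 ≤ 16 * C)
        have := mul_le_mul_of_nonneg_right this (by positivity : 0 ≤ 32 * M + 6)
        linarith) ((mul_eq_zero.1 b4).resolve_left b1.ne') b5
  have hω : (ω : ℕ∞ω) ≠ 0 := by simp
  have hS0 : S 0 ≠ 0 := by rw [S0]; exact hs0.ne'
  -- The branch is `ρ₀(t) = √(S(t²))`, `ω(t) = ω₀ + W(t²)`; the root is smooth since `S 0 = ρs² >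
  -- 0`.
  have hr : ContDiffAt ℝ ω (fun σ => Real.sqrt (S σ)) 0 := hS.sqrt hS0
  have hO : ContDiffAt ℝ ω (fun σ => ω₀ + W σ) 0 := contDiffAt_const.add hW
  obtain ⟨r1, r2, r3, r4⟩ := comp_sq_facts hr
  obtain ⟨o1, o2, o3, o4⟩ := comp_sq_facts hO
  have hr0 : Real.sqrt (S 0) = ρs := by rw [S0, Real.sqrt_sq b1.le]
  have hO0 : ω₀ + W 0 = ωs := by rw [W0]; ring
  have dr : deriv (fun σ => Real.sqrt (S σ)) 0 = deriv S 0 / (2 * ρs) := by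
    have := ((hS.differentiableAt hω).hasDerivAt.sqrt hS0).deriv
    rwa [hr0] at this
  have dO : deriv (fun σ => ω₀ + W σ) 0 = deriv W 0 := deriv_const_add _
  have hsq : Tendsto (fun t : ℝ => t ^ 2) (𝓝 0) (𝓝 0) := by
    simpa using (continuous_pow 2).tendsto (0 : ℝ)
  have v1 : ∀ᶠ t in 𝓝 (0 : ℝ), 0 < S (t ^ 2) :=
    hsq.eventually (hS.continuousAt.eventually_const_lt (by rw [S0]; exact hs0))
  have v2 : ∀ᶠ t in 𝓝 (0 : ℝ), S (t ^ 2) < e ^ 2 :=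
    hsq.eventually (hS.continuousAt.eventually_lt_const (by rw [S0]; exact hse2))
  have v3 : ∀ᶠ t in 𝓝 (0 : ℝ), |W (t ^ 2)| < e :=
    hsq.eventually (hW.continuousAt.abs.eventually_lt_const (by simpa only [W0] using b3))
  have v4 : ∀ᶠ t in 𝓝 (0 : ℝ), |t| < e :=
    (continuous_abs.tendsto 0).eventually_lt_const (by rwa [abs_zero])
  have hall := (((((hsq.eventually hz).and v1).and v2).and v3).and v4).and (r1.and o1)
  obtain ⟨τ, hτ, hτall⟩ := Metric.eventually_nhds_iff.1 hall
  have hmem : ∀ t ∈ Ioo (-τ) τ, dist t 0 < τ := fun t ht => by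
    rw [Real.dist_eq, sub_zero]; exact abs_lt.2 ht
  have hin : ∀ t ∈ Ioo (-τ) τ, InBox e ω₀ (Real.sqrt (S (t ^ 2))) t (ω₀ + W (t ^ 2)) := by
    intro t ht
    obtain ⟨⟨⟨⟨⟨-, w1⟩, w2⟩, w3⟩, w4⟩, -⟩ := hτall (hmem t ht)
    refine ⟨?_, w4, by rwa [add_sub_cancel_left]⟩
    rw [abs_of_nonneg (Real.sqrt_nonneg _)]
    exact (Real.sqrt_lt' h0).2 w2
  refine ⟨τ, fun t => Real.sqrt (S (t ^ 2)), fun t => ω₀ + W (t ^ 2), hτ,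
    ⟨?_, ?_, ?_, ?_, hin, ?_, ?_⟩, ?_, r2, o2, ?_, ?_, ?_, ?_, ?_⟩
  · exact fun t ht => ((hτall (hmem t ht)).2.1.of_le le_top).contDiffWithinAt
  · exact fun t ht => ((hτall (hmem t ht)).2.2.of_le le_top).contDiffWithinAt
  · simpa using hr0
  · simpa using hO0
  · intro t ht
    obtain ⟨⟨⟨⟨⟨⟨w0, -⟩, w1⟩, -⟩, -⟩, -⟩, -⟩ := hτall (hmem t ht)
    rw [hF.F_eq _ _ _ (hin t ht), Real.sq_sqrt w1.le, add_sub_cancel_left, w0, mul_zero]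
  · intro t ht
    obtain ⟨⟨⟨⟨⟨⟨-, w0⟩, w1⟩, -⟩, -⟩, -⟩, -⟩ := hτall (hmem t ht)
    rw [hF.G_eq _ _ _ (hin t ht), Real.sq_sqrt w1.le, add_sub_cancel_left, w0]
  · intro t ht
    obtain ⟨⟨⟨⟨⟨-, w1⟩, -⟩, -⟩, -⟩, -⟩ := hτall (hmem t ht)
    exact Real.sqrt_pos.2 w1
  · simpa only [hr0] using r4
  · simpa only [hO0] using o4
  -- `ω'' = 2 W'(0)` with `s = ρs²`: the coefficient `10` becomes `20`, and the error is of order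
  -- `s³ = ρs⁶`.
  · rw [o3, dO]
    have e1 : 2 * deriv W 0 - 20 * ρs ^ 2 * ((5 * B ^ 2 - A * D) / (5 * B - A))
        = 2 * (deriv W 0 - 10 * ρs ^ 2 * ((5 * B ^ 2 - A * D) / (5 * B - A))) := by ring
    rw [e1, abs_mul, abs_of_pos (by norm_num : (0 : ℝ) < 2)]
    refine (mul_le_mul_of_nonneg_left eW (by norm_num)).trans ?_
    have e2 : 2 * (ρs ^ 2 * (16 * C * (ρs ^ 2) ^ 2)
        * ((32 * M + 2 + (4 + 12 * M) * (60 * M ^ 2 / a₀)) / a₀))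
        = 32 * C * ((32 * M + 2 + (4 + 12 * M) * (60 * M ^ 2 / a₀)) / a₀) * ρs ^ 6 := by ring
    rw [e2]
    refine mul_le_mul_of_nonneg_right ?_ (by positivity)
    rw [branchConst]
    have : 0 ≤ 16 * C * ((4 + 20 * M) * (1 + 10 * M / a₀) / a₀) := by positivity
    linarith
  · rw [o3, dO]; linarith
  -- `ρ₀'' = S'(0) / ρs`; the division lowers the error from `ρs⁴` to `ρs³`.
  · rw [r3, dr]
    have e1 : 2 * (deriv S 0 / (2 * ρs)) - 5 / ρs * ((B - D) / (5 * B - A))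
        = (deriv S 0 - 5 * (B - D) / (5 * B - A)) / ρs := by
      have := b1.ne'
      rw [sub_div]
      field_simp
    rw [e1, abs_div, abs_of_pos b1, div_le_iff₀ b1]
    refine eS.trans ?_
    have e2 : 16 * C * (ρs ^ 2) ^ 2 * ((4 + 20 * M) * (1 + 10 * M / a₀) / a₀)
        = 16 * C * ((4 + 20 * M) * (1 + 10 * M / a₀) / a₀) * (ρs ^ 3 * ρs) := by ring
    rw [e2, mul_assoc (branchConst a₀ M C)]
    refine mul_le_mul_of_nonneg_right ?_ (by positivity)
    rw [branchConst]
    have : 0 ≤ 32 * C * ((32 * M + 2 + (4 + 12 * M) * (60 * M ^ 2 / a₀)) / a₀) := by positivity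
    linarith

end RedPair
end Main
end QuinticNLS

namespace QuinticNLS
open Set Filter
open scoped BoundedContinuousFunction

/-! ### Hypotheses on the potential -/

/-- The bound with weight exponent `2` and no derivative gives `|V| ≤ M / (1 + x²)`. -/
theorem SmoothDecaying.memLp {V : ℝ → ℝ} (h : SmoothDecaying V) : MemLp V 2 := by
  obtain ⟨M, hM⟩ := h.2 2 0
  have hb : ∀ x, (1 + x ^ 2) * |V x| ≤ M := fun x => by
    have := hM x
    rwa [Real.sq_sqrt (by positivity), iteratedDeriv_zero] at this
  rw [memLp_two_iff_integrable_sq h.1.continuous.aestronglyMeasurable]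
  refine (integrable_inv_one_add_sq.const_mul (M ^ 2)).mono'
    (h.1.continuous.pow 2).aestronglyMeasurable (ae_of_all _ fun x => ?_)
  have h1 : 0 < 1 + x ^ 2 := by positivity
  rw [Real.norm_eq_abs, abs_pow, ← div_eq_mul_inv, le_div_iff₀ h1]
  have h2 : ((1 + x ^ 2) * |V x|) ^ 2 ≤ M ^ 2 := pow_le_pow_left₀ (by positivity) (hb x) 2
  nlinarith [sq_nonneg x, sq_nonneg (|V x|), mul_nonneg (sq_nonneg x) (sq_nonneg (|V x|)),
    mul_nonneg (sq_nonneg (x ^ 2)) (sq_nonneg (|V x|))]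

theorem exists_bcf {V : ℝ → ℝ} (hc : Continuous V) {K : ℝ} (hK : ∀ x, |V x| ≤ K) :
    ∃ v : ℝ →ᵇ ℝ, ⇑v = V ∧ ‖v‖ ≤ K :=
  ⟨.ofNormedAddCommGroup V hc K hK, rfl,
    BoundedContinuousFunction.norm_ofNormedAddCommGroup_le _
      ((abs_nonneg _).trans (hK 0)) hK⟩

/-! ### Bound states -/

theorem IsH2.add {u w : ℝ → ℝ} (hu : IsH2 u) (hw : IsH2 w) : IsH2 (u + w) := by
  refine ⟨hu.contDiff.add hw.contDiff, hu.memLp.add hw.memLp, ?_, ?_⟩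
  · have : deriv (u + w) = deriv u + deriv w := funext fun x =>
      deriv_add (hu.contDiff.differentiable two_ne_zero x) (hw.contDiff.differentiable two_ne_zero x)
    rw [this]; exact hu.memLp_deriv.add hw.memLp_deriv
  · have : iteratedDeriv 2 (u + w) = iteratedDeriv 2 u + iteratedDeriv 2 w := funext fun x =>
      iteratedDeriv_add hu.contDiff.contDiffAt hw.contDiff.contDiffAt
    rw [this]; exact hu.memLp_deriv2.add hw.memLp_deriv2

theorem IsH2.const_smul {u : ℝ → ℝ} (hu : IsH2 u) (c : ℝ) : IsH2 (c • u) := by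
  refine ⟨hu.contDiff.const_smul c, hu.memLp.const_smul c, ?_, ?_⟩
  · have : deriv (c • u) = c • deriv u := funext fun x =>
      deriv_const_smul c (hu.contDiff.differentiable two_ne_zero x)
    rw [this]; exact hu.memLp_deriv.const_smul c
  · have : iteratedDeriv 2 (c • u) = c • iteratedDeriv 2 u := funext fun x =>
      iteratedDeriv_const_smul_field c u
    rw [this]; exact hu.memLp_deriv2.const_smul c

theorem profile_eq (ψ₀ ψ₁ : ℝ → ℝ) (ρ₀ ρ₁ : ℝ) (ξ : ℝ → ℝ) :
    profile ψ₀ ψ₁ ρ₀ ρ₁ ξ = ρ₀ • ψ₀ + ρ₁ • ψ₁ + ξ := rfl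

section Bound

variable {V ψ₀ ψ₁ ξ : ℝ → ℝ} {r r' ρ₀ ρ₁ z ω₀ ω₁ : ℝ}

/-- The two reduced equations restore the components along `ψ₀` and `ψ₁` that `P_c` removed. -/
theorem SolvesContEq.isBoundState (h : SolvesContEq V ψ₀ ψ₁ r ρ₀ ρ₁ z ξ)
    (H₀ : IsH2 ψ₀) (H₁ : IsH2 ψ₁)
    (q₀ : ∀ x, -iteratedDeriv 2 ψ₀ x + V x * ψ₀ x + ω₀ * ψ₀ x = 0)
    (q₁ : ∀ x, -iteratedDeriv 2 ψ₁ x + V x * ψ₁ x + ω₁ * ψ₁ x = 0)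
    (h₀ : ∫ x, ψ₀ x * profile ψ₀ ψ₁ ρ₀ ρ₁ ξ x ^ 5 = (z - ω₀) * ρ₀)
    (h₁ : ∫ x, ψ₁ x * profile ψ₀ ψ₁ ρ₀ ρ₁ ξ x ^ 5 = (z - ω₁) * ρ₁) :
    IsBoundState V z (profile ψ₀ ψ₁ ρ₀ ρ₁ ξ) := by
  have hsum : iteratedDeriv 2 (profile ψ₀ ψ₁ ρ₀ ρ₁ ξ)
      = ρ₀ • iteratedDeriv 2 ψ₀ + ρ₁ • iteratedDeriv 2 ψ₁ + iteratedDeriv 2 ξ := funext fun x => by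
    have c₀ := (H₀.const_smul ρ₀).contDiff.contDiffAt (x := x)
    have c₁ := (H₁.const_smul ρ₁).contDiff.contDiffAt (x := x)
    have c₂ := ((H₀.const_smul ρ₀).add (H₁.const_smul ρ₁)).contDiff.contDiffAt (x := x)
    rw [profile_eq, iteratedDeriv_add c₂ h.isH2.contDiff.contDiffAt,
      iteratedDeriv_add c₀ c₁, iteratedDeriv_const_smul_field, iteratedDeriv_const_smul_field]
    rfl
  refine ⟨((H₀.const_smul ρ₀).add (H₁.const_smul ρ₁)).add h.isH2, fun x => ?_⟩
  have he := h.eqn x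
  simp only [contProj, h₀, h₁] at he
  have a₀ := q₀ x
  have a₁ := q₁ x
  rw [hsum]
  simp only [Pi.add_apply, Pi.smul_apply, smul_eq_mul]
  have hp : profile ψ₀ ψ₁ ρ₀ ρ₁ ξ x = ρ₀ * ψ₀ x + ρ₁ * ψ₁ x + ξ x := rfl
  generalize profile ψ₀ ψ₁ ρ₀ ρ₁ ξ x ^ 5 = P at he ⊢
  rw [hp]
  linear_combination he + ρ₀ * a₀ + ρ₁ * a₁

/-- By orthogonality the pairings of the profile with `ψ₀` and `ψ₁` are `ρ₀` and `ρ₁`. The first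
would vanish for an odd profile, the second for an even one. -/
theorem SolvesContEq.not_even_not_odd (h : SolvesContEq V ψ₀ ψ₁ r ρ₀ ρ₁ z ξ)
    (h₀ : MemLp ψ₀ 2) (h₁ : MemLp ψ₁ 2) (n₀ : ∫ x, ψ₀ x ^ 2 = 1) (n₁ : ∫ x, ψ₁ x ^ 2 = 1)
    (E₀ : Function.Even ψ₀) (O₁ : Function.Odd ψ₁) (hρ₀ : ρ₀ ≠ 0) (hρ₁ : ρ₁ ≠ 0) :
    ¬ Function.Even (profile ψ₀ ψ₁ ρ₀ ρ₁ ξ) ∧ ¬ Function.Odd (profile ψ₀ ψ₁ ρ₀ ρ₁ ξ) := by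
  have hξ := h.isH2.memLp
  have h01 : ∫ x, ψ₀ x * ψ₁ x = 0 :=
    integral_eq_zero_of_odd fun x => by rw [E₀ x, O₁ x, mul_neg]
  have key : ∀ {ψ : ℝ → ℝ}, MemLp ψ 2 → ∫ x, ψ x * profile ψ₀ ψ₁ ρ₀ ρ₁ ξ x
      = ρ₀ * (∫ x, ψ x * ψ₀ x) + ρ₁ * (∫ x, ψ x * ψ₁ x) + ∫ x, ψ x * ξ x := by
    intro ψ hψ
    have i₀ : Integrable fun x => ψ x * ψ₀ x := hψ.integrable_mul h₀
    have i₁ : Integrable fun x => ψ x * ψ₁ x := hψ.integrable_mul h₁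
    have i₂ : Integrable fun x => ψ x * ξ x := hψ.integrable_mul hξ
    have i₃ : Integrable fun x => ρ₀ * (ψ x * ψ₀ x) + ρ₁ * (ψ x * ψ₁ x) :=
      (i₀.const_mul _).add (i₁.const_mul _)
    rw [← integral_const_mul, ← integral_const_mul, ← integral_add (i₀.const_mul _)
      (i₁.const_mul _), ← integral_add i₃ i₂]
    refine integral_congr_ae (ae_of_all _ fun x => ?_)
    simp only [profile]; ring
  refine ⟨fun hE => hρ₁ ?_, fun hO => hρ₀ ?_⟩
  · have k := key h₁
    rw [integral_eq_zero_of_odd fun x => by rw [hE x, O₁ x, neg_mul], h.orth₁] at k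
    simp only [mul_comm (ψ₁ _) (ψ₀ _), h01, ← sq, n₁] at k
    linarith
  · have k := key h₀
    rw [integral_eq_zero_of_odd fun x => by rw [hO x, E₀ x, mul_neg], h.orth₀] at k
    simp only [h01, ← sq, n₀] at k
    linarith

variable {η : ℝ → ℝ → ℝ → ℝ → ℝ}

theorem quinticPairing_of_redF_eq_zero (h : redF ψ₀ ψ₁ ω₀ η ρ₀ ρ₁ z = 0) :
    quinticPairing ψ₀ ψ₀ ψ₁ η ρ₀ ρ₁ z = (z - ω₀) * ρ₀ := by
  rw [redF] at h; linarith

theorem quinticPairing_of_redG_eq_zero (h : redG ψ₀ ψ₁ ω₁ η ρ₀ ρ₁ z = 0) (hρ₁ : ρ₁ ≠ 0) :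
    quinticPairing ψ₁ ψ₀ ψ₁ η ρ₀ ρ₁ z = (z - ω₁) * ρ₁ := by
  rw [redG, if_neg hρ₁, sub_eq_zero, one_div, eq_inv_mul_iff_mul_eq₀ hρ₁] at h
  rw [← h]; ring

theorem IsReductionMap.isBoundState (hη : IsReductionMap V ψ₀ ψ₁ ω₀ r' r η)
    (hV : Function.Even V) (h₀ : NormalizedGenerator V ω₀ ψ₀) (h₁ : NormalizedGenerator V ω₁ ψ₁)
    (H₀ : IsH2 ψ₀) (H₁ : IsH2 ψ₁) (E₀ : Function.Even ψ₀) (O₁ : Function.Odd ψ₁)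
    (hb : InBox r' ω₀ ρ₀ ρ₁ z) (hF : redF ψ₀ ψ₁ ω₀ η ρ₀ ρ₁ z = 0)
    (hG : redG ψ₀ ψ₁ ω₁ η ρ₀ ρ₁ z = 0) :
    IsBoundState V z (profile ψ₀ ψ₁ ρ₀ ρ₁ (η ρ₀ ρ₁ z)) := by
  refine (hη _ _ _ hb).1.isBoundState H₀ H₁ h₀.eqn h₁.eqn (quinticPairing_of_redF_eq_zero hF) ?_
  -- At `ρ₁ = 0` the equation `G = 0` does not constrain the pairing itself, which vanishes by
  -- oddness.
  rcases eq_or_ne ρ₁ 0 with rfl | hρ₁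
  · have h := hη.pairing_odd hV E₀ O₁ hb
    rw [neg_zero] at h
    rw [mul_zero]
    exact self_eq_neg.1 h
  · exact quinticPairing_of_redG_eq_zero hG hρ₁

end Bound

theorem SpectralPair.exists_reduction {v : ℝ →ᵇ ℝ} {ω₀ ω₁ : ℝ} {g₀ g₁ : L2 ℝ} {ψ₀ ψ₁ : ℝ → ℝ}
    (S : SpectralPair v ω₀ ω₁ g₀ g₁) (e₀ : expAvg g₀ = ψ₀) (e₁ : expAvg g₁ = ψ₁)
    (hV : Function.Even v) (E₀ : Function.Even ψ₀) (O₁ : Function.Odd ψ₁) {A : L2 ℝ →L[ℝ] L2 ℝ}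
    {a₀ N c C e : ℝ} (ha : 0 < a₀) (hI : InteractionBounds a₀ ψ₀ ψ₁)
    (hA : IsAugInv v ω₀ g₀ g₁ A N) (hN : 0 ≤ N) (h₀ : ‖g₀‖ + 1 ≤ c) (h₁ : ‖g₁‖ + 1 ≤ c)
    (hC : (3 * N + 1) * (160 * c ^ 5) ≤ C) (hC' : 160 * c ^ 5 ≤ C) (he : 0 < e) (he1 : e ≤ 1)
    (s₁ : 8 * C * e ≤ 1) (s₂ : 2 * e * c ≤ 1) (s₃ : N * (96 * c + 1) * e < 1) :
    ∃ η : ℝ → ℝ → ℝ → ℝ → ℝ, IsReductionMap v ψ₀ ψ₁ ω₀ e (2 * e) η ∧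
      ∃ (E : ℝ) (f g : ℝ × ℝ × ℝ → ℝ),
        RedPair a₀ C (72 * C ^ 2 + 36 * C ^ 3) e (coef ψ₀ ψ₁ 6 0) (coef ψ₀ ψ₁ 4 2)
          (coef ψ₀ ψ₁ 2 4) E (ω₀ - ω₁) f g ∧
        ReducesTo e ω₀ f g (redF ψ₀ ψ₁ ω₀ η) (redG ψ₀ ψ₁ ω₁ η) := by
  have H := S.smallFamily hA hN h₀ h₁ hC he he1 s₁
  have hη := S.isReductionMap H e₀ e₁ hA hN h₀ h₁ s₂ s₃
  have hP := S.redPair H e₀ e₁ ha hI h₀ h₁ hC'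
  exact ⟨_, hη, _, _, _, hP, fun _ _ _ hb => redF_eq H hη e₀ e₁ hV E₀ O₁ hb,
    fun _ _ _ hb => redG_eq H hη e₀ e₁ hV E₀ O₁
      (fun p hp => (hP.hg.smooth p hp).differentiableAt (by simp)) hb⟩

/-! ### The constants -/

theorem exists_smallBox {a₀ N c C₀ C₁ : ℝ} (ha : 0 < a₀) (hN : 0 ≤ N) (hc : 0 ≤ c) (h₀ : 0 ≤ C₀)
    (h₁ : 0 ≤ C₁) :
    ∃ e, SmallBox a₀ C₀ C₁ e ∧ 8 * C₀ * e ≤ 1 ∧ 2 * e * c ≤ 1 ∧ N * (96 * c + 1) * e < 1 := by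
  set P := N * (96 * c + 1) with hP
  set Q := 1000 * (C₀ + C₁ + 1) ^ 2 with hQ
  have hP0 : 0 ≤ P := by positivity
  have hQ0 : 0 ≤ Q := by positivity
  -- With `e L = min 1 a₀`, each nonnegative summand of `e L` satisfies its own bound; the summand
  -- `1` makes the last inequality strict.
  set L := 1 + 8 * C₀ + 2 * c + P + Q with hL
  have hL0 : 0 < L := by positivity
  have hm : 0 < min 1 a₀ := lt_min one_pos ha
  have he : 0 < min 1 a₀ / L := by positivity
  set e := min 1 a₀ / L with hedef
  have heL : e * L = min 1 a₀ := div_mul_cancel₀ _ hL0.ne'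
  have m1 : min 1 a₀ ≤ 1 := min_le_left _ _
  have m2 : min 1 a₀ ≤ a₀ := min_le_right _ _
  have t1 : 0 ≤ e * (8 * C₀) := by positivity
  have t2 : 0 ≤ e * (2 * c) := by positivity
  have t3 : 0 ≤ e * P := by positivity
  have t4 : 0 ≤ e * Q := by positivity
  have hsum : e + e * (8 * C₀) + e * (2 * c) + e * P + e * Q = min 1 a₀ := by
    rw [← heL, hL]; ring
  exact ⟨e, ⟨he, by linarith, h₀, h₁, by linarith, by linarith⟩, by linarith, by linarith,
    by linarith⟩

theorem branchConst_pos {a₀ M C : ℝ} (ha : 0 < a₀) (hM : 0 ≤ M) (hC : 0 ≤ C) :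
    0 < branchConst a₀ M C := by
  rw [branchConst]; positivity

end QuinticNLS

end

/-! ### Choice of the constants and assembly. -/

theorem mainTheorem3 (a₀ K κ : ℝ) (ha₀ : 0 < a₀) (hκ : 0 < κ) :
    ∃ ε r δ C : ℝ, 0 < ε ∧ 0 < r ∧ 0 < δ ∧ 0 < C ∧
      ∀ (V ψ₀ ψ₁ : ℝ → ℝ) (ω₀ ω₁ : ℝ),
        QuinticNLS.TwoBoundStates V ω₀ ω₁ → Function.Even V → QuinticNLS.SmoothDecaying V →
        QuinticNLS.NormalizedGenerator V ω₀ ψ₀ → QuinticNLS.NormalizedGenerator V ω₁ ψ₁ →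
        QuinticNLS.InteractionBounds a₀ ψ₀ ψ₁ →
        (∀ x, |V x| ≤ K) → κ ≤ ω₁ → ω₀ - ω₁ < δ →
        ∃ η : ℝ → ℝ → ℝ → ℝ → ℝ, QuinticNLS.IsReductionMap V ψ₀ ψ₁ ω₀ ε r η ∧
          ∃ F G : ℝ → ℝ → ℝ → ℝ,
            F = QuinticNLS.redF ψ₀ ψ₁ ω₀ η ∧ G = QuinticNLS.redG ψ₀ ψ₁ ω₁ η ∧
          ∃ ρs ωs : ℝ,
            -- the bifurcation point exists and is unique
            QuinticNLS.IsBifurcationPoint F G ω₀ ε ρs ωs ∧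
            (∀ ρ ω : ℝ, QuinticNLS.IsBifurcationPoint F G ω₀ ε ρ ω → ρ = ρs ∧ ω = ωs) ∧
            -- the reduced system is smooth there and its Jacobian has rank two
            ContDiffAt ℝ (⊤ : ℕ∞) (fun p : ℝ × ℝ × ℝ => F p.1 p.2.1 p.2.2) (ρs, 0, ωs) ∧
            ContDiffAt ℝ (⊤ : ℕ∞) (fun p : ℝ × ℝ × ℝ => G p.1 p.2.1 p.2.2) (ρs, 0, ωs) ∧
            (QuinticNLS.jacobian F G ρs 0 ωs).rank = 2 ∧
            -- the smooth branch of asymmetric states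
            ∃ (τ : ℝ) (R Ω : ℝ → ℝ), 0 < τ ∧ QuinticNLS.IsBranch F G ω₀ ε ρs ωs τ R Ω ∧
              (∀ s ∈ Set.Ioo (-τ) τ, QuinticNLS.IsBoundState V (Ω s)
                (QuinticNLS.profile ψ₀ ψ₁ (R s) s (η (R s) s (Ω s)))) ∧
              (∀ s ∈ Set.Ioo (-τ) τ, s ≠ 0 →
                ¬ Function.Even (QuinticNLS.profile ψ₀ ψ₁ (R s) s (η (R s) s (Ω s))) ∧
                ¬ Function.Odd (QuinticNLS.profile ψ₀ ψ₁ (R s) s (η (R s) s (Ω s)))) ∧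
              -- its second-order expansion
              deriv R 0 = 0 ∧ deriv Ω 0 = 0 ∧
              (fun s => R s - (ρs + iteratedDeriv 2 R 0 / 2 * s ^ 2)) =o[𝓝 0]
                (fun s : ℝ => s ^ 2) ∧
              (fun s => Ω s - (ωs + iteratedDeriv 2 Ω 0 / 2 * s ^ 2)) =o[𝓝 0]
                (fun s : ℝ => s ^ 2) ∧
              |iteratedDeriv 2 Ω 0 - 20 * ρs ^ 2 *
                ((5 * QuinticNLS.coef ψ₀ ψ₁ 4 2 ^ 2
                    - QuinticNLS.coef ψ₀ ψ₁ 6 0 * QuinticNLS.coef ψ₀ ψ₁ 2 4) /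
                  (5 * QuinticNLS.coef ψ₀ ψ₁ 4 2 - QuinticNLS.coef ψ₀ ψ₁ 6 0))|
                ≤ C * ρs ^ 6 ∧
              0 < iteratedDeriv 2 Ω 0 ∧
              |iteratedDeriv 2 R 0 - 5 / ρs *
                ((QuinticNLS.coef ψ₀ ψ₁ 4 2 - QuinticNLS.coef ψ₀ ψ₁ 2 4) /
                  (5 * QuinticNLS.coef ψ₀ ψ₁ 4 2 - QuinticNLS.coef ψ₀ ψ₁ 6 0))|
                ≤ C * ρs ^ 3 := by
  -- `K` is an arbitrary real number; the maximum keeps the constants built from it nonnegative.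
  set K' := max K 0 with hK'
  have hK0 : 0 ≤ K' := le_max_right _ _
  have hm : 0 < min 1 κ := lt_min one_pos hκ
  set N := (min 1 κ + K' + 1) / min 1 κ with hN
  have hN0 : 0 ≤ N := by positivity
  -- A bound for `‖gⱼ‖ + 1`, from `‖gⱼ‖² ≤ ‖v‖ + 1` and `2 ‖gⱼ‖ ≤ ‖gⱼ‖² + 1`.
  set c := K' + 2 with hc
  have hc0 : 0 ≤ c := by positivity
  set C₀ := (3 * N + 1) * (160 * c ^ 5) with hC₀
  have hC₀0 : 0 ≤ C₀ := by positivity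
  have h160 : 160 * c ^ 5 ≤ C₀ := by
    rw [hC₀]; exact le_mul_of_one_le_left (by positivity) (by linarith)
  set C₁ := 72 * C₀ ^ 2 + 36 * C₀ ^ 3 with hC₁
  have hC₁0 : 0 ≤ C₁ := by positivity
  obtain ⟨e, hs, s1, s2, s3⟩ := QuinticNLS.exists_smallBox ha₀ hN0 hc0 hC₀0 hC₁0
  have he := hs.pos
  -- `δ = a₀ t² / 2` with `t = e² / 2`: a smaller eigenvalue gap makes `g` change sign on `0 ≤ s ≤
  -- t`.
  refine ⟨e, 2 * e, a₀ * (e ^ 2 / 2) ^ 2 / 2, QuinticNLS.branchConst a₀ C₀ C₁, he, by positivity,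
    by positivity, QuinticNLS.branchConst_pos ha₀ hC₀0 hC₁0, ?_⟩
  intro V ψ₀ ψ₁ ω₀ ω₁ hT hE hD hψ₀ hψ₁ hI hVK hκω hδ
  have hL2 := hD.memLp
  obtain ⟨v, rfl, hvK⟩ := QuinticNLS.exists_bcf hD.1.continuous
    fun x => (hVK x).trans (le_max_left K 0)
  have hω₁ : 0 < ω₁ := hκ.trans_le hκω
  obtain ⟨g₀, e₀, q₀, H₀, l₀⟩ := QuinticNLS.exists_preimage hψ₀.contDiff hψ₀.memLp hψ₀.eqn
  obtain ⟨g₁, e₁, q₁, H₁, l₁⟩ := QuinticNLS.exists_preimage hψ₁.contDiff hψ₁.memLp hψ₁.eqn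
  have S := QuinticNLS.spectralPair_of_hyp hL2 hT hψ₀ hψ₁ hω₁ e₀ e₁ q₀ q₁
    (by rw [l₀]; exact hψ₀.norm_toLp) (by rw [l₁]; exact hψ₁.norm_toLp)
  obtain ⟨E₀, O₁⟩ := QuinticNLS.parity S hψ₀ hψ₁ hE e₀ e₁
  obtain ⟨m₀, m₁⟩ := S.norm_sq_le
  have b₀ : ‖g₀‖ + 1 ≤ c := by linarith [sq_nonneg (‖g₀‖ - 1), hvK.trans_eq hK'.symm]
  have b₁ : ‖g₁‖ + 1 ≤ c := by linarith [sq_nonneg (‖g₁‖ - 1), hvK.trans_eq hK'.symm]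
  obtain ⟨A, hA⟩ := S.exists_augInv hvK hκ hκω
  obtain ⟨η, hη, E, f, g, hP, hred⟩ := S.exists_reduction e₀ e₁ hE E₀ O₁ ha₀ hI hA hN0 b₀ b₁
    le_rfl h160 he hs.le_one s1 s2 s3
  obtain ⟨ρs, ωs, hbif, huniq⟩ := hP.exists_bifurcation hs hred (sub_pos.2 S.lt) hδ
  obtain ⟨cF, cG, hrank⟩ := hP.smooth_and_rank hs hred hbif
  obtain ⟨τ, R, Ω, hτ, hbr, hRpos, hexp⟩ := hP.exists_isBranch hs hred hbif
  exact ⟨η, hη, _, _, rfl, rfl, ρs, ωs, hbif, huniq, cF, cG, hrank, τ, R, Ω, hτ, hbr,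
    fun s hsτ => hη.isBoundState hE hψ₀ hψ₁ H₀ H₁ E₀ O₁ (hbr.inBox s hsτ) (hbr.F_eq s hsτ)
      (hbr.G_eq s hsτ),
    fun s hsτ hs0 => (hη _ _ _ (hbr.inBox s hsτ)).1.not_even_not_odd hψ₀.memLp hψ₁.memLp
      hψ₀.norm_one hψ₁.norm_one E₀ O₁ (hRpos s hsτ).ne' hs0, hexp⟩
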